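/- \textbf{Theorem 5 (nonlinear transformation of amplitudes).} Let $f:\mathbb{C}\to[-1,1]$ be a function that is Lipschitz continuous on the square $Q=\{z:\ |\mathrm{Re}\,z|\le 1,\ |\mathrm{Im}\,z|\le 1\}$ and efficiently computable in the following sense: there is a polynomial $p$ such that for every $m\ge 1$ there is a quantum circuit of at most $p(m)$ single- and two-qubit gates which, for all fixed-point numbers $x,y\in[-1,1)$ with a sign bit and $m$ binary digits, maps $|x\rangle|y\rangle|0\rangle|0\rangle$ to $|x\rangle|y\rangle|r\rangle|0\rangle$, where $r=r(x,y)$ is a number of the same format with $|r-f(x+iy)|\le 2^{-m}$. Then there are constants $C>0$ and $k\ge 1$, depending only on $f$, such that for all $N=2^n$ with $n\ge 1$ and all $\epsilon\in(0,1)$ there are a function $\tilde f:\mathbb{C}\to\mathbb{R}$ with $|\tilde f(z)-f(z)|\le\epsilon$ for all $z$, and a quantum circuit on $n$ data qubits and finitely many ancilla qubits, consisting of at most $C/\epsilon$ controlled-$U_A$ gates (controlled-$U_A^\dagger$ gates included in the count) and at most $C\,(\log N)^2/\epsilon$ single- and two-qubit gates, with the following property. For every data vector $(c_j)_{j=1}^N$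 of complex numbers and every $n$-qubit unitary $U_A$ with $U_A|0\rangle=\sum_j c_j|j\rangle$ (so that $\sum_j|c_j|^2=1$), run the circuit with this $U_A$ on $\sum_j c_j|j\rangle\otimes|0\cdots0\rangle$, measure the ancilla qubits in the computational basis, and call the outcome $0\cdots 0$ success. Then the probability of success is exactly $\frac1N\sum_{j=1}^N\tilde f(c_j)^2$ and, if it is positive, the normalized state $|\psi\rangle$ of the data qubits after success has fidelity $$\Bigl|\Bigl\langle \psi\Big|\,C'\sum_{j=1}^N\tilde f(c_j)\,|j\rangle\Bigr\rangle\Bigr|\ \ge\ 1-C\,\epsilon^{k},\qquad C'=\Bigl(\sum_{j=1}^N\tilde f(c_j)^2\Bigr)^{-1/2}.$$ -/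

import Mathlib

open scoped BigOperators Matrix

noncomputable section

namespace QCirc

/-- Computational basis labels of a register whose qubits are indexed by `ι`. -/
abbrev Bits (ι : Type) : Type := ι → Bool

/-- (Not necessarily normalized) state vectors, given by their amplitudes in the computational
basis. -/
abbrev State (ι : Type) : Type := Bits ι → ℂ

/-- Unitary matrices acting on a register with qubits indexed by `κ`. -/
abbrev Unitary (κ : Type) [Fintype κ] [DecidableEq κ] : Type :=
  Matrix.unitaryGroup (Bits κ) ℂ

/-- The all-zeros label. -/
def zeros (ι : Type) : Bits ι := fun _ => false

/-- The computational basis state `|x⟩`. -/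
def ket {ι : Type} [DecidableEq (Bits ι)] (x : Bits ι) : State ι := Pi.single x 1

/-- Apply the matrix `M` to the qubits `e k`, `k : κ`, of a register indexed by `ι`, and the
identity to all other qubits. (`Function.extend e y x` is the label `x` with the bits at the
positions `e k` replaced by `y k`.) -/
def applyOn {κ ι : Type} [Fintype κ] [DecidableEq κ] (e : κ ↪ ι)
    (M : Matrix (Bits κ) (Bits κ) ℂ) (ψ : State ι) : State ι :=
  fun x => ∑ y : Bits κ, M (fun k => x (e k)) y * ψ (Function.extend e y x)

/-- Elementary gates: arbitrary unitaries on one qubit or on two distinct qubits. -/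
inductive ElemGate (ι : Type) : Type
  | single (q : Fin 1 ↪ ι) (M : Unitary (Fin 1)) : ElemGate ι
  | double (q : Fin 2 ↪ ι) (M : Unitary (Fin 2)) : ElemGate ι

/-- The action of an elementary gate on states. -/
def ElemGate.apply {ι : Type} : ElemGate ι → State ι → State ι
  | .single q M => applyOn q M.1
  | .double q M => applyOn q M.1

/-- The action of a circuit of elementary gates; the head of the list acts first. -/
def runElem {ι : Type} (V : List (ElemGate ι)) (ψ : State ι) : State ι :=
  V.foldl (fun φ g => g.apply φ) ψ

/-- `controlled U` is `|0⟩⟨0| ⊗ 1 + |1⟩⟨1| ⊗ U`; qubit `0` is the control and the qubits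
`1, …, n` are the targets. -/
def controlled {n : ℕ} (U : Matrix (Bits (Fin n)) (Bits (Fin n)) ℂ) :
    Matrix (Bits (Fin (n + 1))) (Bits (Fin (n + 1))) ℂ :=
  fun x y =>
    if x 0 = y 0 then
      (if x 0 = true then U else 1) (fun i => x i.succ) (fun i => y i.succ)
    else 0

/-- Gates of a circuit with access to an unknown `n`-qubit unitary `U`: elementary gates,
controlled-`U`, and its inverse. The control and the targets may be any distinct qubits. -/
inductive Gate (n : ℕ) (ι : Type) : Type
  | elem (g : ElemGate ι) : Gate n ι
  | ctrlU (q : Fin (n + 1) ↪ ι) : Gate n ι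
  | ctrlUInv (q : Fin (n + 1) ↪ ι) : Gate n ι

/-- The action of a gate on states once the unitary `U` is given. -/
def Gate.apply {n : ℕ} {ι : Type} (U : Unitary (Fin n)) : Gate n ι → State ι → State ι
  | .elem g => g.apply
  | .ctrlU q => applyOn q (controlled U.1)
  | .ctrlUInv q => applyOn q (controlled U.1ᴴ)

/-- The action of a circuit; the head of the list acts first. -/
def run {n : ℕ} {ι : Type} (U : Unitary (Fin n)) (V : List (Gate n ι)) (ψ : State ι) :
    State ι :=
  V.foldl (fun φ g => g.apply U φ) ψ

/-- Is the gate an elementary (single- or two-qubit) gate? -/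
def Gate.isElem {n : ℕ} {ι : Type} : Gate n ι → Bool
  | .elem _ => true
  | .ctrlU _ => false
  | .ctrlUInv _ => false

/-- Number of single- and two-qubit gates of a circuit. -/
def elemCount {n : ℕ} {ι : Type} (V : List (Gate n ι)) : ℕ :=
  V.countP (fun g => g.isElem)

/-- Number of controlled-`U` gates of a circuit, the inverse ones included. -/
def oracleCount {n : ℕ} {ι : Type} (V : List (Gate n ι)) : ℕ :=
  V.countP (fun g => !g.isElem)

/-- The value in `[-1, 1)` of a string `b₀ b₁ … bₘ` of a sign bit and `m` binary digits, in two's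
complement: `-b₀ + ∑ bₖ 2⁻ᵏ`. -/
def fixedVal {m : ℕ} (b : Bits (Fin (m + 1))) : ℝ :=
  -(if b 0 = true then 1 else 0) + ∑ k : Fin m, if b k.succ = true then (1 / 2 : ℝ) ^ (k.1 + 1) else 0

/-- The label `|x⟩|y⟩|r⟩|0⟩` of four registers: the real part and the imaginary part of the
argument, the result, and `a` work qubits. -/
def fourRegs {m : ℕ} (a : ℕ) (x y r : Bits (Fin (m + 1))) :
    Bits (Fin (m + 1) ⊕ Fin (m + 1) ⊕ Fin (m + 1) ⊕ Fin a) :=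
  Sum.elim x (Sum.elim y (Sum.elim r (zeros (Fin a))))

/-- `f` can be computed to every accuracy `ε = 2⁻ᵐ` with `O(poly(log(1/ε)))` single- and two-qubit
gates: `|x⟩|y⟩|0⟩|0⟩ ↦ |x⟩|y⟩|f̃(x + iy)⟩|0⟩` with `|f̃(x + iy) - f(x + iy)| ≤ ε`, for all `m`-digit
arguments `x`, `y`. -/
def EfficientlyComputable (f : ℂ → ℝ) : Prop :=
  ∃ p : Polynomial ℕ, ∀ m : ℕ, 1 ≤ m →
    ∃ (a : ℕ) (V : List (ElemGate (Fin (m + 1) ⊕ Fin (m + 1) ⊕ Fin (m + 1) ⊕ Fin a))),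
      V.length ≤ p.eval m ∧
      ∀ x y : Bits (Fin (m + 1)), ∃ r : Bits (Fin (m + 1)),
        runElem V (ket (fourRegs a x y (zeros _))) = ket (fourRegs a x y r) ∧
        |fixedVal r - f ⟨fixedVal x, fixedVal y⟩| ≤ (1 / 2 : ℝ) ^ m

/-- `U` is an analog-encoding unitary of the data `c`: `U|0⟩ = ∑ⱼ cⱼ|j⟩`. -/
def IsAnalogEncoding {n : ℕ} (U : Unitary (Fin n)) (c : Bits (Fin n) → ℂ) : Prop :=
  U.1 *ᵥ ket (zeros (Fin n)) = c

/-- The state `(∑ⱼ cⱼ|j⟩) ⊗ |0…0⟩` with `a` ancilla qubits. -/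
def withAncillas {n : ℕ} (a : ℕ) (c : State (Fin n)) : State (Fin n ⊕ Fin a) :=
  fun x => if (fun i => x (Sum.inr i)) = zeros (Fin a) then c (fun i => x (Sum.inl i)) else 0

/-- The unnormalized state of the `n` data qubits after all ancilla qubits have been measured in
the computational basis with outcome `0`. -/
def postselect {n a : ℕ} (ψ : State (Fin n ⊕ Fin a)) : State (Fin n) :=
  fun x => ψ (Sum.elim x (zeros (Fin a)))

/-- The squared norm of a state vector; for a postselected vector, the probability of the
outcome. -/
def normSqState {ι : Type} [Fintype ι] [DecidableEq ι] (ψ : State ι) : ℝ :=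
  ∑ x, ‖ψ x‖ ^ 2

/-- The normalized vector (meaningful when `ψ` is not zero). -/
def normalized {ι : Type} [Fintype ι] [DecidableEq ι] (ψ : State ι) : State ι :=
  fun x => ψ x / (Real.sqrt (normSqState ψ) : ℂ)

/-- The fidelity `|⟨φ|ψ⟩|` of two normalized vectors. -/
def fidelity {ι : Type} [Fintype ι] [DecidableEq ι] (φ ψ : State ι) : ℝ :=
  ‖star φ ⬝ᵥ ψ‖

end QCirc

end

/-!
The circuit multiplies the amplitude of every data label `j` *exactly* by a number that depends on
`c j` alone. On the unit disc `ft` is defined to be this number, so that the probability of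
success is exact and the fidelity is `1`; only the distance of `ft` to `f` has to be estimated.

*Estimating an amplitude.* Let `G = (|0⟩|0⟩ + ζ|1⟩U|0⟩)/√2` for a phase `ζ`. The involution
`|b⟩|y⟩ ↦ |¬b⟩|y ⊕ j⟩` has expectation `Re (ζ c_j)` in `G`. Its product with the reflection at `G`
is the walk operator `walk`; writing `cos θ = Re (ζ c_j)`, the inner products of its iterates on `G`
are `cos ((s - t) θ)` (`star_iterate_walk_dotProduct`). Phase estimation of the walk therefore
yields each result `o` with a probability `ampProb M θ o` that depends on nothing but `θ`
(`sum_norm_estVector_sq`). The data qubits only control the involution, so this happens for all `j`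
in superposition. With `ζ = 1` and `ζ = -i` one estimates the real and the imaginary part of `c_j`.

*The window.* The superposition of times is not uniform but weighted with
`(1 - exp (2πi t / M)) / √(2M)`, which vanishes at both ends. This makes the tails of the result
decay fast enough for the *mean* error of `cos (2πo / M)` to be at most `5 / M`
(`sum_ampProb_error_le`); a uniform window would cost a logarithm. So `O(1/ε)` steps of the walk
suffice.

*From estimates to an amplitude.* From the two results a table lookup produces fixed-point numbers
`x`, `y`, the function circuit produces `r(x, y) ≈ f (x + iy)`, and a random bit is computed whose
sign has expectation `r(x, y)`. Apply this sign and undo everything. The amplitude of returning to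
`|j⟩|0⟩` is the expectation of the sign in the sampled state, that is, the average of `r` over
independent estimates of the two parts of `c_j` (`run_coreCircuit`, `averaged`). By the Lipschitz
condition it is within `O(1/M)` of `f (c_j)` (`abs_averaged_fixedVal_sub_le`).

*The start.* The data register holds `∑ c_j |j⟩` instead of the uniform superposition. As this is
`U|0⟩`, one controlled `U⁻¹` with the control set leads to `|0⟩`, and a Fourier transform to
`2^(-n/2) ∑ |j⟩` (`run_uniformCircuit`); this is the factor `1/N` in the probability.

*Cost.* A step of the walk takes `O(n)` elementary gates, the Fourier transform of the data `O(n²)`,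
the tables `O(M)`, and the function circuit `poly(log M)`, hence `O(M)`.
-/

noncomputable section

namespace QCirc

/-! ### Label surgery and gates on sub-registers -/

section Extend

variable {κ ι ι' : Type}

theorem extend_comp_self (e : κ ↪ ι) (x : Bits ι) : Function.extend e (x ∘ e) x = x := by
  funext w
  by_cases h : ∃ k, e k = w
  · obtain ⟨k, rfl⟩ := h
    rw [e.injective.extend_apply]; rfl
  · rw [Function.extend_apply' _ _ _ h]

theorem extend_comp_embedding (e : κ ↪ ι) (y : Bits κ) (x : Bits ι) :
    Function.extend e y x ∘ e = y :=
  Function.extend_comp e.injective y x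

theorem extend_extend (e : κ ↪ ι) (y y' : Bits κ) (x : Bits ι) :
    Function.extend e y (Function.extend e y' x) = Function.extend e y x := by
  funext w
  by_cases h : ∃ k, e k = w
  · obtain ⟨k, rfl⟩ := h
    simp only [e.injective.extend_apply]
  · simp only [Function.extend_apply' _ _ _ h]

theorem extend_extend_comp (e : κ ↪ ι) (g : ι ↪ ι') (y : Bits κ) (x : Bits ι') :
    Function.extend g (Function.extend e y (x ∘ g)) x = Function.extend (e.trans g) y x := by
  funext w
  by_cases h : ∃ k, g k = w
  · obtain ⟨k, rfl⟩ := h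
    rw [g.injective.extend_apply]
    by_cases h' : ∃ l, e l = k
    · obtain ⟨l, rfl⟩ := h'
      rw [e.injective.extend_apply]
      exact ((e.trans g).injective.extend_apply y x l).symm
    · rw [Function.extend_apply' _ _ _ h', Function.extend_apply']
      · rfl
      · rintro ⟨l, hl⟩
        exact h' ⟨l, g.injective hl⟩
  · rw [Function.extend_apply' _ _ _ h, Function.extend_apply']
    rintro ⟨l, hl⟩
    exact h ⟨e l, hl⟩

end Extend

section ApplyOn

variable {κ ι ι' : Type} [Fintype κ] [DecidableEq κ]

theorem applyOn_add (e : κ ↪ ι) (M : Matrix (Bits κ) (Bits κ) ℂ) (φ ψ : State ι) :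
    applyOn e M (φ + ψ) = applyOn e M φ + applyOn e M ψ := by
  funext x
  simp [applyOn, mul_add, Finset.sum_add_distrib]

theorem applyOn_smul (e : κ ↪ ι) (M : Matrix (Bits κ) (Bits κ) ℂ) (a : ℂ) (ψ : State ι) :
    applyOn e M (a • ψ) = a • applyOn e M ψ := by
  funext x
  simp only [applyOn, Pi.smul_apply, smul_eq_mul, Finset.mul_sum]
  exact Finset.sum_congr rfl fun y _ => by ring

theorem applyOn_mul (e : κ ↪ ι) (M N : Matrix (Bits κ) (Bits κ) ℂ) (ψ : State ι) :
    applyOn e (M * N) ψ = applyOn e M (applyOn e N ψ) := by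
  funext x
  simp only [applyOn, Matrix.mul_apply, Finset.sum_mul, Finset.mul_sum]
  rw [Finset.sum_comm]
  refine Finset.sum_congr rfl fun y _ => Finset.sum_congr rfl fun z _ => ?_
  rw [extend_extend, show (fun k => Function.extend (⇑e) y x (e k)) = y from
    extend_comp_embedding e y x, mul_assoc]

theorem applyOn_diagonal (e : κ ↪ ι) (d : Bits κ → ℂ) (ψ : State ι) :
    applyOn e (Matrix.diagonal d) ψ = fun x => d (x ∘ e) * ψ x := by
  funext x
  rw [applyOn, Finset.sum_eq_single (x ∘ e)]
  · rw [extend_comp_self, show (fun k => x (e k)) = x ∘ e from rfl, Matrix.diagonal_apply_eq]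
  · intro y _ hy
    rw [Matrix.diagonal_apply_ne _ (by exact fun h => hy h.symm), zero_mul]
  · simp

theorem applyOn_one (e : κ ↪ ι) (ψ : State ι) :
    applyOn e (1 : Matrix (Bits κ) (Bits κ) ℂ) ψ = ψ := by
  rw [← Matrix.diagonal_one, applyOn_diagonal]
  simp

/-- Adjointness of `M` and `Mᴴ` survives the tensoring with the identity. -/
theorem star_applyOn_dotProduct [Fintype ι] [DecidableEq ι] (e : κ ↪ ι)
    (M : Matrix (Bits κ) (Bits κ) ℂ) (φ ψ : State ι) :
    star (applyOn e M φ) ⬝ᵥ ψ = star φ ⬝ᵥ applyOn e Mᴴ ψ := by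
  simp only [dotProduct, applyOn, Pi.star_apply, star_sum, star_mul', Finset.sum_mul,
    Finset.mul_sum, Matrix.conjTranspose_apply]
  rw [← Fintype.sum_prod_type', ← Fintype.sum_prod_type']
  have hinv : Function.Involutive
      (fun p : Bits ι × Bits κ => (Function.extend e p.2 p.1, p.1 ∘ e)) := by
    rintro ⟨x, y⟩
    simp only [Prod.mk.injEq]
    exact ⟨by rw [extend_extend, extend_comp_self], extend_comp_embedding e y x⟩
  refine Fintype.sum_equiv hinv.toPerm _ _ ?_
  rintro ⟨x, y⟩
  simp only [Function.Involutive.coe_toPerm]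
  rw [extend_extend, extend_comp_self, show (fun k => Function.extend (⇑e) y x (e k)) = y from
    extend_comp_embedding e y x, show (fun k => x (e k)) = x ∘ e from rfl]
  ring

/-- The vector of amplitudes of the sub-register `g`, all other qubits being as in `x`. -/
def slice (g : ι ↪ ι') (x : Bits ι') (ψ : State ι') : State ι :=
  fun y => ψ (Function.extend g y x)

theorem slice_applyOn (e : κ ↪ ι) (g : ι ↪ ι') (M : Matrix (Bits κ) (Bits κ) ℂ) (x : Bits ι')
    (ψ : State ι') : slice g x (applyOn (e.trans g) M ψ) = applyOn e M (slice g x ψ) := by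
  funext y
  simp only [slice, applyOn]
  refine Finset.sum_congr rfl fun z _ => ?_
  have h1 : (fun k => Function.extend g y x ((e.trans g) k)) = fun k => y (e k) := by
    funext k
    exact g.injective.extend_apply y x (e k)
  rw [h1, ← extend_extend_comp, extend_comp_embedding, extend_extend]

end ApplyOn

/-! ### Sums over labels -/

theorem sum_bits_cons {n : ℕ} {β : Type*} [AddCommMonoid β] (h : Bits (Fin (n + 1)) → β) :
    ∑ x, h x = ∑ b : Bool, ∑ y : Bits (Fin n), h (Fin.cons b y) := by
  rw [← Fintype.sum_prod_type']
  exact (Fintype.sum_equiv (Fin.consEquiv fun _ : Fin (n + 1) => Bool) _ _ fun _ => rfl).symm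

theorem sum_bits_snoc {n : ℕ} {β : Type*} [AddCommMonoid β] (h : Bits (Fin (n + 1)) → β) :
    ∑ x, h x = ∑ b : Bool, ∑ y : Bits (Fin n), h (Fin.snoc y b) := by
  rw [← Fintype.sum_prod_type']
  exact (Fintype.sum_equiv (Fin.snocEquiv fun _ : Fin (n + 1) => Bool) _ _ fun _ => rfl).symm

theorem sum_bits_sum {α γ : Type} [Fintype α] [DecidableEq α] [Fintype γ] [DecidableEq γ]
    {β : Type*} [AddCommMonoid β] (h : Bits (α ⊕ γ) → β) :
    ∑ x, h x = ∑ y : Bits α, ∑ z : Bits γ, h (Sum.elim y z) := by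
  rw [← Fintype.sum_prod_type']
  exact (Fintype.sum_equiv (Equiv.sumArrowEquivProdArrow α γ Bool).symm _ _ fun _ => rfl).symm

/-! ### Circuits: linearity, sub-registers, inverses -/

theorem controlled_mul {n : ℕ} (U V : Matrix (Bits (Fin n)) (Bits (Fin n)) ℂ) :
    controlled U * controlled V = controlled (U * V) := by
  ext x z
  rw [Matrix.mul_apply, sum_bits_cons]
  simp only [controlled, Fin.cons_zero, Fin.cons_succ, Fintype.sum_bool]
  cases hx : x 0 <;> cases hz : z 0 <;>
    simp [Matrix.mul_apply, Matrix.one_apply]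

theorem controlled_one {n : ℕ} :
    controlled (1 : Matrix (Bits (Fin n)) (Bits (Fin n)) ℂ) = 1 := by
  ext x z
  have key : x = z ↔ x 0 = z 0 ∧ (fun i : Fin n => x i.succ) = fun i => z i.succ := by
    constructor
    · rintro rfl; exact ⟨rfl, rfl⟩
    · rintro ⟨h0, h1⟩
      funext i
      refine Fin.cases h0 (fun i => congrFun h1 i) i
  simp only [controlled, ite_self, Matrix.one_apply]
  by_cases h0 : x 0 = z 0 <;> simp [key, h0]

theorem controlled_conjTranspose {n : ℕ} (U : Matrix (Bits (Fin n)) (Bits (Fin n)) ℂ) :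
    (controlled U)ᴴ = controlled Uᴴ := by
  ext x z
  simp only [controlled, Matrix.conjTranspose_apply]
  cases hx : x 0 <;> cases hz : z 0 <;> simp [Matrix.one_apply, eq_comm, apply_ite]

section Circuits

variable {ι ι' : Type} {n : ℕ}

/-- The same gate acting on a larger register that contains the original one along `g`. -/
def ElemGate.lift (g : ι ↪ ι') : ElemGate ι → ElemGate ι'
  | .single q M => .single (q.trans g) M
  | .double q M => .double (q.trans g) M

/-- The same gate acting on a larger register that contains the original one along `g`. -/
def Gate.lift (g : ι ↪ ι') : Gate n ι → Gate n ι'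
  | .elem h => .elem (h.lift g)
  | .ctrlU q => .ctrlU (q.trans g)
  | .ctrlUInv q => .ctrlUInv (q.trans g)

/-- The inverse gate. -/
def Gate.inv : Gate n ι → Gate n ι
  | .elem (.single q M) => .elem (.single q M⁻¹)
  | .elem (.double q M) => .elem (.double q M⁻¹)
  | .ctrlU q => .ctrlUInv q
  | .ctrlUInv q => .ctrlU q

/-- The circuit `V` on a sub-register. -/
def liftCircuit (g : ι ↪ ι') (V : List (Gate n ι)) : List (Gate n ι') := V.map (Gate.lift g)

/-- The inverse circuit. -/
def invCircuit (V : List (Gate n ι)) : List (Gate n ι) := (V.map Gate.inv).reverse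

variable (U : Unitary (Fin n))

theorem Gate.apply_add (g : Gate n ι) (φ ψ : State ι) :
    g.apply U (φ + ψ) = g.apply U φ + g.apply U ψ := by
  rcases g with (⟨q, M⟩ | ⟨q, M⟩) | q | q <;> exact applyOn_add q _ _ _

theorem Gate.apply_smul (g : Gate n ι) (a : ℂ) (ψ : State ι) :
    g.apply U (a • ψ) = a • g.apply U ψ := by
  rcases g with (⟨q, M⟩ | ⟨q, M⟩) | q | q <;> exact applyOn_smul q _ _ _

@[simp] theorem run_nil (ψ : State ι) : run U [] ψ = ψ := rfl

@[simp] theorem run_cons (g : Gate n ι) (V : List (Gate n ι)) (ψ : State ι) :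
    run U (g :: V) ψ = run U V (g.apply U ψ) := rfl

@[simp] theorem run_append (V W : List (Gate n ι)) (ψ : State ι) :
    run U (V ++ W) ψ = run U W (run U V ψ) := by
  simp [run]

theorem run_add (V : List (Gate n ι)) (φ ψ : State ι) :
    run U V (φ + ψ) = run U V φ + run U V ψ := by
  induction V generalizing φ ψ with
  | nil => rfl
  | cons g V ih => simp only [run_cons, Gate.apply_add, ih]

theorem run_smul (V : List (Gate n ι)) (a : ℂ) (ψ : State ι) :
    run U V (a • ψ) = a • run U V ψ := by
  induction V generalizing ψ with
  | nil => rfl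
  | cons g V ih => simp only [run_cons, Gate.apply_smul, ih]

theorem run_zero (V : List (Gate n ι)) : run U V (0 : State ι) = 0 := by
  simpa using run_smul U V 0 (0 : State ι)

theorem run_sum {α : Type*} (s : Finset α) (V : List (Gate n ι)) (ψ : α → State ι) :
    run U V (∑ i ∈ s, ψ i) = ∑ i ∈ s, run U V (ψ i) := by
  classical
  induction s using Finset.induction_on with
  | empty => simp [run_zero]
  | insert a s ha ih => rw [Finset.sum_insert ha, Finset.sum_insert ha, run_add, ih]

theorem eq_sum_ket [Fintype ι] [DecidableEq ι] (ψ : State ι) : ψ = ∑ x, ψ x • ket x := by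
  funext y
  simp [ket, Finset.sum_apply, Pi.single_apply]

theorem run_eq_sum_ket [Fintype ι] [DecidableEq ι] (V : List (Gate n ι)) (ψ : State ι) :
    run U V ψ = ∑ x, ψ x • run U V (ket x) := by
  conv_lhs => rw [eq_sum_ket ψ, run_sum]
  simp only [run_smul]

theorem run_map_elem (V : List (ElemGate ι)) (ψ : State ι) :
    run U (V.map Gate.elem) ψ = runElem V ψ := by
  induction V generalizing ψ with
  | nil => rfl
  | cons g V ih => exact ih _

theorem slice_gate_lift (g : ι ↪ ι') (h : Gate n ι) (x : Bits ι') (ψ : State ι') :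
    slice g x ((h.lift g).apply U ψ) = h.apply U (slice g x ψ) := by
  rcases h with (⟨q, M⟩ | ⟨q, M⟩) | q | q <;> exact slice_applyOn q _ _ _ _

theorem slice_run_lift (g : ι ↪ ι') (V : List (Gate n ι)) (x : Bits ι') (ψ : State ι') :
    slice g x (run U (liftCircuit g V) ψ) = run U V (slice g x ψ) := by
  induction V generalizing ψ with
  | nil => rfl
  | cons h V ih =>
    rw [run_cons, ← slice_gate_lift]
    exact ih _

/-- A circuit on a sub-register acts on every slice separately. -/
theorem run_lift_apply (g : ι ↪ ι') (V : List (Gate n ι)) (ψ : State ι') (x : Bits ι') :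
    run U (liftCircuit g V) ψ x = run U V (slice g x ψ) (x ∘ g) := by
  rw [← slice_run_lift, slice, extend_comp_self]

/-- A circuit on a sub-register of a product state changes only the factor of the
sub-register. -/
theorem run_lift_mul (g : ι ↪ ι') (V : List (Gate n ι)) (φ : State ι) (χ : State ι')
    (hχ : ∀ x y, χ (Function.extend g y x) = χ x) :
    run U (liftCircuit g V) (fun x => φ (x ∘ g) * χ x) =
      fun x => run U V φ (x ∘ g) * χ x := by
  funext x
  have : slice g x (fun x => φ (x ∘ g) * χ x) = χ x • φ := by
    funext y
    simp only [slice, hχ, extend_comp_embedding, Pi.smul_apply, smul_eq_mul, mul_comm]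
  rw [run_lift_apply, this, run_smul, Pi.smul_apply, smul_eq_mul, mul_comm]

theorem run_lift_ket [DecidableEq (Bits ι)] [DecidableEq (Bits ι')] (g : ι ↪ ι')
    (V : List (Gate n ι)) (x : Bits ι') (y : Bits ι) (h : run U V (ket (x ∘ g)) = ket y) :
    run U (liftCircuit g V) (ket x) = ket (Function.extend g y x) := by
  funext z
  rw [run_lift_apply]
  by_cases hz : Function.extend g (x ∘ g) z = x
  · have : slice g z (ket x) = ket (x ∘ g) := by
      funext w
      simp only [slice, ket, Pi.single_apply]
      congr 1
      refine propext ⟨fun h => ?_, fun h => ?_⟩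
      · rw [← h, extend_comp_embedding]
      · rw [h, hz]
    rw [this, h]
    simp only [ket, Pi.single_apply]
    congr 1
    refine propext ⟨fun h => ?_, fun h => ?_⟩
    · rw [← h, ← hz, extend_extend, extend_comp_self]
    · rw [h, extend_comp_embedding]
  · have : slice g z (ket x) = 0 := by
      funext w
      simp only [slice, ket, Pi.single_apply, Pi.zero_apply, ite_eq_right_iff]
      intro h
      refine absurd ?_ hz
      rw [← h, extend_comp_embedding, h] at *
    rw [this, run_zero]
    simp only [ket, Pi.single_apply, Pi.zero_apply]
    rw [if_neg]
    intro h
    apply hz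
    rw [h, extend_extend, extend_comp_self]

theorem Gate.apply_inv (g : Gate n ι) (ψ : State ι) : g.inv.apply U (g.apply U ψ) = ψ := by
  rcases g with (⟨q, M⟩ | ⟨q, M⟩) | q | q
  · change applyOn q (M⁻¹).1 (applyOn q M.1 ψ) = ψ
    rw [← applyOn_mul, ← Submonoid.coe_mul, inv_mul_cancel]
    exact applyOn_one _ _
  · change applyOn q (M⁻¹).1 (applyOn q M.1 ψ) = ψ
    rw [← applyOn_mul, ← Submonoid.coe_mul, inv_mul_cancel]
    exact applyOn_one _ _
  · change applyOn q (controlled U.1ᴴ) (applyOn q (controlled U.1) ψ) = ψ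
    rw [← applyOn_mul, controlled_mul, ← Matrix.star_eq_conjTranspose,
      Matrix.mem_unitaryGroup_iff'.1 U.2, controlled_one, applyOn_one]
  · change applyOn q (controlled U.1) (applyOn q (controlled U.1ᴴ) ψ) = ψ
    rw [← applyOn_mul, controlled_mul, ← Matrix.star_eq_conjTranspose,
      Matrix.mem_unitaryGroup_iff.1 U.2, controlled_one, applyOn_one]

theorem Gate.star_apply_dotProduct [Fintype ι] [DecidableEq ι] (g : Gate n ι) (φ ψ : State ι) :
    star (g.apply U φ) ⬝ᵥ ψ = star φ ⬝ᵥ g.inv.apply U ψ := by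
  rcases g with (⟨q, M⟩ | ⟨q, M⟩) | q | q
  · exact star_applyOn_dotProduct _ _ _ _
  · exact star_applyOn_dotProduct _ _ _ _
  · refine (star_applyOn_dotProduct _ _ _ _).trans ?_
    rw [controlled_conjTranspose]; rfl
  · refine (star_applyOn_dotProduct _ _ _ _).trans ?_
    rw [controlled_conjTranspose, Matrix.conjTranspose_conjTranspose]; rfl

theorem invCircuit_cons (g : Gate n ι) (V : List (Gate n ι)) :
    invCircuit (g :: V) = invCircuit V ++ [g.inv] := by
  simp [invCircuit]

theorem run_invCircuit (V : List (Gate n ι)) (ψ : State ι) :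
    run U (invCircuit V) (run U V ψ) = ψ := by
  induction V generalizing ψ with
  | nil => rfl
  | cons g V ih => rw [invCircuit_cons, run_append, run_cons, run_cons, run_nil, ih, Gate.apply_inv]

theorem Gate.inv_inv (g : Gate n ι) : g.inv.inv = g := by
  rcases g with (⟨q, M⟩ | ⟨q, M⟩) | q | q <;> simp [Gate.inv]

theorem invCircuit_invCircuit (V : List (Gate n ι)) : invCircuit (invCircuit V) = V := by
  simp only [invCircuit, List.map_reverse, List.reverse_reverse, List.map_map]
  rw [show (Gate.inv ∘ Gate.inv : Gate n ι → Gate n ι) = id from funext Gate.inv_inv, List.map_id]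

theorem run_run_invCircuit (V : List (Gate n ι)) (ψ : State ι) :
    run U V (run U (invCircuit V) ψ) = ψ := by
  conv_lhs => rw [← invCircuit_invCircuit V]
  rw [invCircuit_invCircuit V]
  simpa only [invCircuit_invCircuit] using run_invCircuit U (invCircuit V) ψ

theorem star_run_dotProduct [Fintype ι] [DecidableEq ι] (V : List (Gate n ι)) (φ ψ : State ι) :
    star (run U V φ) ⬝ᵥ ψ = star φ ⬝ᵥ run U (invCircuit V) ψ := by
  induction V generalizing φ with
  | nil => rfl
  | cons g V ih =>
    rw [run_cons, ih, Gate.star_apply_dotProduct, invCircuit_cons, run_append, run_cons, run_nil]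

/-! ### Gate counts -/

theorem elemCount_append (V W : List (Gate n ι)) :
    elemCount (V ++ W) = elemCount V + elemCount W := List.countP_append

theorem oracleCount_append (V W : List (Gate n ι)) :
    oracleCount (V ++ W) = oracleCount V + oracleCount W := List.countP_append

theorem elemCount_lift (g : ι ↪ ι') (V : List (Gate n ι)) :
    elemCount (liftCircuit g V) = elemCount V := by
  rw [elemCount, liftCircuit, List.countP_map]
  congr 1
  funext h
  cases h <;> rfl

theorem oracleCount_lift (g : ι ↪ ι') (V : List (Gate n ι)) :
    oracleCount (liftCircuit g V) = oracleCount V := by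
  rw [oracleCount, liftCircuit, List.countP_map]
  congr 1
  funext h
  cases h <;> rfl

theorem elemCount_inv (V : List (Gate n ι)) : elemCount (invCircuit V) = elemCount V := by
  rw [elemCount, invCircuit, List.countP_reverse, List.countP_map]
  congr 1
  funext h
  rcases h with (⟨q, M⟩ | ⟨q, M⟩) | q | q <;> rfl

theorem oracleCount_inv (V : List (Gate n ι)) : oracleCount (invCircuit V) = oracleCount V := by
  rw [oracleCount, invCircuit, List.countP_reverse, List.countP_map]
  congr 1
  funext h
  rcases h with (⟨q, M⟩ | ⟨q, M⟩) | q | q <;> rfl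

theorem elemCount_map_elem (V : List (ElemGate ι)) :
    elemCount (V.map Gate.elem : List (Gate n ι)) = V.length := by
  rw [elemCount, List.countP_map]
  exact List.countP_eq_length.2 fun _ _ => rfl

theorem oracleCount_map_elem (V : List (ElemGate ι)) :
    oracleCount (V.map Gate.elem : List (Gate n ι)) = 0 := by
  rw [oracleCount, List.countP_map]
  exact List.countP_eq_zero.2 fun _ _ => by simp [Gate.isElem]

end Circuits

/-! ### Concrete gates -/

section Gates

variable {ι : Type} {n : ℕ}

/-- The single qubit `q` as a register. -/
def oneWire (q : ι) : Fin 1 ↪ ι := ⟨fun _ => q, Function.injective_of_subsingleton _⟩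

/-- Two distinct qubits as a register. -/
def twoWires (a b : ι) (h : a ≠ b) : Fin 2 ↪ ι :=
  ⟨![a, b], by
    intro i j hij
    fin_cases i <;> fin_cases j <;> simp_all⟩

theorem extend_oneWire [DecidableEq ι] (q : ι) (y : Bits (Fin 1)) (x : Bits ι) :
    Function.extend (oneWire q) y x = Function.update x q (y 0) := by
  funext w
  by_cases h : w = q
  · subst h
    rw [Function.update_self]
    exact (oneWire w).injective.extend_apply y x 0
  · rw [Function.update_of_ne h, Function.extend_apply']
    rintro ⟨k, hk⟩
    exact h hk.symm

theorem extend_twoWires [DecidableEq ι] (a b : ι) (h : a ≠ b) (y : Bits (Fin 2)) (x : Bits ι) :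
    Function.extend (twoWires a b h) y x =
      Function.update (Function.update x a (y 0)) b (y 1) := by
  funext w
  by_cases hb : w = b
  · subst hb
    rw [Function.update_self]
    exact (twoWires a w h).injective.extend_apply y x 1
  rw [Function.update_of_ne hb]
  by_cases ha : w = a
  · subst ha
    rw [Function.update_self]
    exact (twoWires w b h).injective.extend_apply y x 0
  · rw [Function.update_of_ne ha, Function.extend_apply']
    rintro ⟨k, hk⟩
    fin_cases k
    · exact ha hk.symm
    · exact hb hk.symm

theorem sqrt_two_inv_mul_self : ((Real.sqrt 2 : ℂ))⁻¹ * ((Real.sqrt 2 : ℂ))⁻¹ = 1 / 2 := by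
  rw [← mul_inv, ← Complex.ofReal_mul, Real.mul_self_sqrt (by norm_num)]
  norm_num

theorem Circle.mul_star_self (ζ : Circle) : (ζ : ℂ) * (starRingEnd ℂ) ζ = 1 := by
  rw [Complex.mul_conj, Circle.normSq_coe]; norm_num

/-- The matrix with columns `(|0⟩ + ζ|1⟩)/√2` and `(|0⟩ - ζ|1⟩)/√2`; for `ζ = 1` the Hadamard
matrix. -/
def phaseHadamardMatrix (ζ : Circle) : Matrix (Bits (Fin 1)) (Bits (Fin 1)) ℂ := fun y z =>
  (Real.sqrt 2 : ℂ)⁻¹ * (if y 0 = true then (ζ : ℂ) else 1) *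
    (if (y 0 && z 0) = true then -1 else 1)

theorem phaseHadamardMatrix_mem (ζ : Circle) :
    phaseHadamardMatrix ζ ∈ Matrix.unitaryGroup (Bits (Fin 1)) ℂ := by
  rw [Matrix.mem_unitaryGroup_iff]
  ext y z
  have hyz : y = z ↔ y 0 = z 0 := by
    constructor
    · rintro rfl; rfl
    · intro h
      funext i
      rw [Subsingleton.elim i 0, h]
  have h2 := sqrt_two_inv_mul_self
  have h1 := Circle.mul_star_self ζ
  rw [Matrix.mul_apply, sum_bits_cons]
  simp only [Matrix.star_apply, phaseHadamardMatrix, Matrix.one_apply, hyz, Fintype.sum_bool,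
    Fin.cons_zero, Finset.univ_unique, Finset.sum_singleton]
  cases hy : y 0 <;> cases hz : z 0 <;> simp <;>
    first
      | linear_combination (0 : ℂ) * h2
      | linear_combination 2 * h2
      | linear_combination 2 * ((ζ : ℂ) * (starRingEnd ℂ) ζ) * h2 + h1

/-- The gate with matrix `phaseHadamardMatrix ζ` on the qubit `q`. -/
def phaseHadamard (ζ : Circle) (q : ι) : Gate n ι :=
  .elem (.single (oneWire q) ⟨phaseHadamardMatrix ζ, phaseHadamardMatrix_mem ζ⟩)

theorem phaseHadamard_apply [DecidableEq ι] (U : Unitary (Fin n)) (ζ : Circle) (q : ι)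
    (ψ : State ι) (x : Bits ι) :
    (phaseHadamard ζ q).apply U ψ x = (Real.sqrt 2 : ℂ)⁻¹ * (if x q = true then (ζ : ℂ) else 1) *
      (ψ (Function.update x q false) +
        (if x q = true then -1 else 1) * ψ (Function.update x q true)) := by
  change applyOn (oneWire q) (phaseHadamardMatrix ζ) ψ x = _
  simp only [applyOn, phaseHadamardMatrix, extend_oneWire]
  rw [sum_bits_cons]
  simp only [Fintype.sum_bool, Fin.cons_zero, Finset.univ_unique, Finset.sum_singleton,
    Bool.and_true, Bool.and_false]
  have hq : ∀ i, (oneWire q) i = q := fun _ => rfl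
  simp only [hq]
  cases x q <;> simp <;> ring

theorem diagonal_mem_unitaryGroup {κ : Type} [Fintype κ] [DecidableEq κ] (d : Bits κ → Circle) :
    Matrix.diagonal (fun y => (d y : ℂ)) ∈ Matrix.unitaryGroup (Bits κ) ℂ := by
  rw [Matrix.mem_unitaryGroup_iff, Matrix.star_eq_conjTranspose, Matrix.diagonal_conjTranspose,
    Matrix.diagonal_mul_diagonal, ← Matrix.diagonal_one]
  congr 1
  funext y
  exact Circle.mul_star_self (d y)

open Classical in
/-- The two-qubit gate multiplying `|…x_a…x_b…⟩` by the phase `d x_a x_b` (no gate at all if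
`a = b`). -/
def diagGate (a b : ι) (d : Bool → Bool → Circle) : List (Gate n ι) :=
  if h : a ≠ b then
    [.elem (.double (twoWires a b h) ⟨_, diagonal_mem_unitaryGroup fun y => d (y 0) (y 1)⟩)]
  else []

theorem run_diagGate (U : Unitary (Fin n)) {a b : ι} (h : a ≠ b) (d : Bool → Bool → Circle)
    (ψ : State ι) : run U (diagGate a b d) ψ = fun x => (d (x a) (x b) : ℂ) * ψ x := by
  rw [diagGate, dif_pos h]
  exact applyOn_diagonal (twoWires a b h) _ ψ

/-- The label `y` with its second bit changed by `h` of the first. -/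
def xorBit (h : Bool → Bool) (y : Bits (Fin 2)) : Bits (Fin 2) := ![y 0, y 1 ^^ h (y 0)]

theorem xorBit_involutive (h : Bool → Bool) : Function.Involutive (xorBit h) := by
  intro y
  funext i
  fin_cases i <;> simp [xorBit]

/-- The matrix permuting the basis states by the involution `σ`. -/
def permMatrix {κ : Type} [Fintype κ] [DecidableEq κ] (σ : Bits κ → Bits κ) :
    Matrix (Bits κ) (Bits κ) ℂ :=
  Matrix.of fun y z => if σ y = z then 1 else 0

theorem permMatrix_mem_unitaryGroup {κ : Type} [Fintype κ] [DecidableEq κ]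
    {σ : Bits κ → Bits κ} (hσ : Function.Involutive σ) :
    permMatrix σ ∈ Matrix.unitaryGroup (Bits κ) ℂ := by
  rw [Matrix.mem_unitaryGroup_iff]
  ext y z
  rw [Matrix.mul_apply]
  simp [permMatrix, Matrix.star_apply, Matrix.one_apply, hσ.injective.eq_iff, eq_comm, apply_ite]

theorem applyOn_permMatrix {κ : Type} [Fintype κ] [DecidableEq κ] (e : κ ↪ ι)
    (σ : Bits κ → Bits κ) (ψ : State ι) :
    applyOn e (permMatrix σ) ψ = fun x => ψ (Function.extend e (σ (x ∘ e)) x) := by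
  funext x
  simp [applyOn, permMatrix, Function.comp_def]

open Classical in
/-- The two-qubit gate `x_t ↦ x_t ⊕ h(x_a)` (no gate at all if `a = t`). -/
def xorGate (a t : ι) (h : Bool → Bool) : List (Gate n ι) :=
  if hat : a ≠ t then
    [.elem (.double (twoWires a t hat) ⟨_, permMatrix_mem_unitaryGroup (xorBit_involutive h)⟩)]
  else []

theorem run_xorGate [DecidableEq ι] (U : Unitary (Fin n)) {a t : ι} (hat : a ≠ t)
    (h : Bool → Bool) (ψ : State ι) :
    run U (xorGate a t h) ψ = fun x => ψ (Function.update x t (x t ^^ h (x a))) := by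
  rw [xorGate, dif_pos hat]
  funext x
  refine (congrFun (applyOn_permMatrix (twoWires a t hat) (xorBit h) ψ) x).trans ?_
  have h0 : twoWires a t hat 0 = a := rfl
  have h1 : twoWires a t hat 1 = t := rfl
  simp [extend_twoWires, xorBit, h0, h1]

/-- Fourier coefficients of `h` with respect to the functions `1, a, b, a ⊕ b`: exponents of
phases on two qubits at a time that add up to the phase `(-1)^h(a, b)`. -/
def xorCoeff (h : Bool → Bool → Bool) : ℝ :=
  ((h true false).toNat + (h false true).toNat - (h false false).toNat
    - (h true true).toNat) / 2

/-- The phase `(-1)^(x_t h(x_a, x_b))`, split into phases on two qubits at a time. -/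
def controlledPhase (a b t : ι) (h : Bool → Bool → Bool) : List (Gate n ι) :=
  diagGate a t (fun x z => if z then Circle.exp (Real.pi * ((h false false).toNat +
        (if x then (h true false).toNat - (h false false).toNat - xorCoeff h else 0))) else 1) ++
    diagGate b t (fun y z => if z then Circle.exp (Real.pi *
      (if y then (h false true).toNat - (h false false).toNat - xorCoeff h else 0)) else 1) ++
    xorGate a b id ++
    diagGate b t (fun y z => if z then Circle.exp (Real.pi *
      (if y then xorCoeff h else 0)) else 1) ++
    xorGate a b id

/-- The circuit `x_t ↦ x_t ⊕ h(x_a, x_b)` for an arbitrary Boolean function `h` of two bits. -/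
def toffoliGate (a b t : ι) (h : Bool → Bool → Bool) : List (Gate n ι) :=
  [phaseHadamard 1 t] ++ controlledPhase a b t h ++ [phaseHadamard 1 t]

theorem toffoli_phase (h : Bool → Bool → Bool) (x y : Bool) :
    ((Circle.exp (Real.pi * ((h false false).toNat +
        (if x then (h true false).toNat - (h false false).toNat - xorCoeff h else 0))) : Circle) : ℂ)
      * (Circle.exp (Real.pi *
      (if y then (h false true).toNat - (h false false).toNat - xorCoeff h else 0)) : Circle)
      * (Circle.exp (Real.pi * (if y ^^ x then xorCoeff h else 0)) : Circle) =
      if h x y = true then -1 else 1 := by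
  rw [← Circle.coe_mul, ← Circle.coe_mul, ← Circle.exp_add, ← Circle.exp_add, ← mul_add, ← mul_add]
  have key : ((h false false).toNat : ℝ) +
        (if x then (h true false).toNat - (h false false).toNat - xorCoeff h else 0) +
      (if y then (h false true).toNat - (h false false).toNat - xorCoeff h else 0) +
      (if y ^^ x then xorCoeff h else 0) = (h x y).toNat := by
    unfold xorCoeff
    cases x <;> cases y <;> simp <;> ring
  rw [key]
  cases h x y <;> simp

theorem run_controlledPhase [DecidableEq ι] (U : Unitary (Fin n)) {a b t : ι} (hab : a ≠ b)
    (hat : a ≠ t) (hbt : b ≠ t) (h : Bool → Bool → Bool) (ψ : State ι) :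
    run U (controlledPhase a b t h) ψ =
      fun x => (if (x t && h (x a) (x b)) = true then -1 else 1) * ψ x := by
  funext x
  simp only [controlledPhase, run_append, run_diagGate U hat, run_diagGate U hbt,
    run_xorGate U hab, Function.update_self, Function.update_of_ne hab,
    Function.update_of_ne hbt.symm, Function.update_idem, id, Bool.xor_assoc, Bool.xor_self,
    Bool.xor_false, Function.update_eq_self]
  have key := toffoli_phase h (x a) (x b)
  cases hx : x t
  · simp
  · simp only [if_true, Bool.true_and]
    rw [← key]
    ring

theorem run_toffoliGate [DecidableEq ι] (U : Unitary (Fin n)) {a b t : ι} (hab : a ≠ b)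
    (hat : a ≠ t) (hbt : b ≠ t) (h : Bool → Bool → Bool) (ψ : State ι) :
    run U (toffoliGate a b t h) ψ =
      fun x => ψ (Function.update x t (x t ^^ h (x a) (x b))) := by
  have h2 := sqrt_two_inv_mul_self
  funext x
  simp only [toffoliGate, run_cons, run_append, run_controlledPhase U hab hat hbt,
    phaseHadamard_apply, run_nil, Function.update_self, Function.update_of_ne hat,
    Function.update_of_ne hbt, Function.update_idem, Circle.coe_one, ite_self]
  cases hx : x t <;> cases h (x a) (x b) <;> simp <;>
    first
      | linear_combination (2 * ψ (Function.update x t false)) * h2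
      | linear_combination (2 * ψ (Function.update x t true)) * h2
end Gates

/-! ### Classical reversible programs -/

/-- Instructions of reversible programs on bits: `x_t ↦ x_t ⊕ h(x_a)` and
`x_t ↦ x_t ⊕ h(x_a, x_b)`. -/
inductive ClInstr (ι : Type) : Type
  | xor1 (a t : ι) (h : Bool → Bool) : ClInstr ι
  | xor2 (a b t : ι) (h : Bool → Bool → Bool) : ClInstr ι

section Classical

variable {ι : Type} {n : ℕ}

open Classical in
/-- The action of an instruction on labels; instructions whose qubits are not distinct do
nothing. -/
def ClInstr.act : ClInstr ι → Bits ι → Bits ι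
  | .xor1 a t h, x => if a ≠ t then Function.update x t (x t ^^ h (x a)) else x
  | .xor2 a b t h, x =>
    if a ≠ b ∧ a ≠ t ∧ b ≠ t then Function.update x t (x t ^^ h (x a) (x b)) else x

open Classical in
/-- The circuit of an instruction. -/
def ClInstr.gates : ClInstr ι → List (Gate n ι)
  | .xor1 a t h => xorGate a t h
  | .xor2 a b t h => if a ≠ b ∧ a ≠ t ∧ b ≠ t then toffoliGate a b t h else []

/-- The action of a program on labels; the head of the list acts first. -/
def exec (P : List (ClInstr ι)) (x : Bits ι) : Bits ι := P.foldl (fun y i => i.act y) x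

/-- The circuit of a program. -/
def compile (P : List (ClInstr ι)) : List (Gate n ι) := P.flatMap ClInstr.gates

@[simp] theorem exec_nil (x : Bits ι) : exec [] x = x := rfl

@[simp] theorem exec_cons (i : ClInstr ι) (P : List (ClInstr ι)) (x : Bits ι) :
    exec (i :: P) x = exec P (i.act x) := rfl

@[simp] theorem exec_append (P Q : List (ClInstr ι)) (x : Bits ι) :
    exec (P ++ Q) x = exec Q (exec P x) := by
  simp [exec]

theorem act_xor1 [DecidableEq ι] {a t : ι} (hat : a ≠ t) (h : Bool → Bool) (x : Bits ι) :
    (ClInstr.xor1 a t h).act x = Function.update x t (x t ^^ h (x a)) := by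
  rw [ClInstr.act, if_pos hat]
  congr!

theorem act_xor2 [DecidableEq ι] {a b t : ι} (hab : a ≠ b) (hat : a ≠ t) (hbt : b ≠ t)
    (h : Bool → Bool → Bool) (x : Bits ι) :
    (ClInstr.xor2 a b t h).act x = Function.update x t (x t ^^ h (x a) (x b)) := by
  rw [ClInstr.act, if_pos ⟨hab, hat, hbt⟩]
  congr!

theorem ClInstr.act_involutive (i : ClInstr ι) : Function.Involutive i.act := by
  classical
  intro x
  rcases i with ⟨a, t, h⟩ | ⟨a, b, t, h⟩
  · by_cases hat : a ≠ t
    · simp [act_xor1 hat, Function.update_of_ne hat]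
    · simp [ClInstr.act, hat]
  · by_cases hv : a ≠ b ∧ a ≠ t ∧ b ≠ t
    · obtain ⟨hab, hat, hbt⟩ := hv
      simp [act_xor2 hab hat hbt, Function.update_of_ne hat, Function.update_of_ne hbt]
    · simp [ClInstr.act, hv]

theorem ClInstr.run_gates (U : Unitary (Fin n)) (i : ClInstr ι) (ψ : State ι) :
    run U i.gates ψ = fun x => ψ (i.act x) := by
  classical
  rcases i with ⟨a, t, h⟩ | ⟨a, b, t, h⟩
  · by_cases hat : a ≠ t
    · rw [ClInstr.gates, run_xorGate U hat]
      simp only [act_xor1 hat]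
    · simp [ClInstr.gates, ClInstr.act, hat, xorGate]
  · by_cases hv : a ≠ b ∧ a ≠ t ∧ b ≠ t
    · obtain ⟨hab, hat, hbt⟩ := hv
      rw [ClInstr.gates, if_pos ⟨hab, hat, hbt⟩, run_toffoliGate U hab hat hbt]
      simp only [act_xor2 hab hat hbt]
    · simp [ClInstr.gates, ClInstr.act, hv]

theorem run_compile_ket [DecidableEq (Bits ι)] (U : Unitary (Fin n)) (P : List (ClInstr ι))
    (x : Bits ι) : run U (compile P) (ket x) = ket (exec P x) := by
  induction P generalizing x with
  | nil => rfl
  | cons i P ih =>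
    have : run U i.gates (ket x) = ket (i.act x) := by
      rw [ClInstr.run_gates]
      funext y
      simp only [ket, Pi.single_apply]
      congr 1
      rw [i.act_involutive.eq_iff]
    rw [compile, List.flatMap_cons, run_append, this]
    exact ih _

theorem ClInstr.oracleCount_gates (i : ClInstr ι) :
    oracleCount (i.gates : List (Gate n ι)) = 0 := by
  have hx : ∀ (a t : ι) h, oracleCount (xorGate a t h : List (Gate n ι)) = 0 := by
    intro a t h
    unfold xorGate
    split_ifs <;> simp [oracleCount, Gate.isElem]
  have hd : ∀ (a t : ι) h, oracleCount (diagGate a t h : List (Gate n ι)) = 0 := by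
    intro a t h
    unfold diagGate
    split_ifs <;> simp [oracleCount, Gate.isElem]
  rcases i with ⟨a, t, h⟩ | ⟨a, b, t, h⟩
  · exact hx _ _ _
  · simp only [ClInstr.gates]
    split_ifs
    · simp only [toffoliGate, controlledPhase, oracleCount_append, hx, hd]
      simp [oracleCount, phaseHadamard, Gate.isElem]
    · rfl

theorem elemCount_xorGate_le (a t : ι) (h : Bool → Bool) :
    elemCount (xorGate a t h : List (Gate n ι)) ≤ 1 := by
  unfold xorGate
  split_ifs <;> simp [elemCount, Gate.isElem]

theorem elemCount_diagGate_le (a t : ι) (h : Bool → Bool → Circle) :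
    elemCount (diagGate a t h : List (Gate n ι)) ≤ 1 := by
  unfold diagGate
  split_ifs <;> simp [elemCount, Gate.isElem]

theorem oracleCount_diagGate (a t : ι) (h : Bool → Bool → Circle) :
    oracleCount (diagGate a t h : List (Gate n ι)) = 0 := by
  unfold diagGate
  split_ifs <;> simp [oracleCount, Gate.isElem]

theorem ClInstr.elemCount_gates_le (i : ClInstr ι) :
    elemCount (i.gates : List (Gate n ι)) ≤ 7 := by
  rcases i with ⟨a, t, h⟩ | ⟨a, b, t, h⟩
  · exact (elemCount_xorGate_le _ _ _).trans (by norm_num)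
  · simp only [ClInstr.gates]
    split_ifs
    · simp only [toffoliGate, controlledPhase, elemCount_append]
      have h1 : elemCount [(phaseHadamard 1 t : Gate n ι)] = 1 := by
        simp [elemCount, phaseHadamard, Gate.isElem]
      have h2 := elemCount_xorGate_le (n := n) a b id
      have h3 := fun d => elemCount_diagGate_le (n := n) a t d
      have h4 := fun d => elemCount_diagGate_le (n := n) b t d
      rw [h1]
      grw [h2, h3, h4, h4]
    · simp [elemCount]

theorem oracleCount_compile (P : List (ClInstr ι)) :
    oracleCount (compile P : List (Gate n ι)) = 0 := by
  induction P with
  | nil => rfl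
  | cons i P ih =>
    rw [compile, List.flatMap_cons, oracleCount_append, i.oracleCount_gates, zero_add]
    exact ih

theorem elemCount_compile_le (P : List (ClInstr ι)) :
    elemCount (compile P : List (Gate n ι)) ≤ 7 * P.length := by
  induction P with
  | nil => rfl
  | cons i P ih =>
    rw [compile, List.flatMap_cons, elemCount_append, List.length_cons]
    have := i.elemCount_gates_le (n := n)
    change _ + elemCount (compile P) ≤ _
    omega

/-- A diagonal operator conjugated by a circuit that maps one basis state to another acts on the
former as a scalar. -/
theorem run_conj_ket [DecidableEq (Bits ι)] (U : Unitary (Fin n)) (S D : List (Gate n ι))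
    (d : Bits ι → ℂ) (hD : ∀ ψ, run U D ψ = fun x => d x * ψ x) {x y : Bits ι}
    (h : run U S (ket x) = ket y) :
    run U (S ++ D ++ invCircuit S) (ket x) = d y • ket x := by
  have : run U D (ket y) = d y • ket y := by
    rw [hD]
    funext z
    by_cases hz : z = y
    · subst hz; simp
    · simp [ket, hz]
  rw [run_append, run_append, h, this, run_smul, ← h, run_invCircuit]

theorem run_conj_of_ket [Fintype ι] [DecidableEq ι] (U : Unitary (Fin n)) (S D : List (Gate n ι))
    (d : Bits ι → ℂ) (hD : ∀ ψ, run U D ψ = fun x => d x * ψ x) (π : Bits ι → Bits ι)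
    (ψ : State ι) (h : ∀ x, ψ x ≠ 0 → run U S (ket x) = ket (π x)) :
    run U (S ++ D ++ invCircuit S) ψ = fun x => d (π x) * ψ x := by
  rw [run_eq_sum_ket]
  have : ∀ x, ψ x • run U (S ++ D ++ invCircuit S) (ket x) =
      (d (π x) * ψ x) • (ket x : State ι) := by
    intro x
    by_cases hx : ψ x = 0
    · simp [hx]
    · rw [run_conj_ket U S D d hD (h x hx), smul_smul, mul_comm]
  simp only [this]
  exact (eq_sum_ket (fun x => d (π x) * ψ x)).symm

/-! ### Conjunctions -/

/-- The program leaving the conjunction of `x_c` and of all `¬x_{y i}` in the last qubit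
`an i`. -/
def andChain : (k : ℕ) → (c : ι) → (y an : Fin k → ι) → List (ClInstr ι)
  | 0, _, _, _ => []
  | k + 1, c, y, an =>
    .xor2 c (y 0) (an 0) (fun a b => a && !b) :: andChain k (an 0) (Fin.tail y) (Fin.tail an)

theorem length_andChain (k : ℕ) (c : ι) (y an : Fin k → ι) : (andChain k c y an).length = k := by
  induction k generalizing c with
  | zero => rfl
  | succ k ih => simp [andChain, ih]

theorem exec_andChain (k : ℕ) (c : ι) (y an : Fin k → ι) (han : Function.Injective an)
    (hya : ∀ i j, y i ≠ an j) (hcy : ∀ i, c ≠ y i) (hca : ∀ i, c ≠ an i) (x : Bits ι)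
    (hx : ∀ i, x (an i) = false) :
    exec (andChain k c y an) x ((Fin.cons c an : Fin (k + 1) → ι) (Fin.last k)) =
      (x c && decide (∀ i, x (y i) = false)) := by
  classical
  induction k generalizing c x with
  | zero => simp [andChain]
  | succ k ih =>
    have hlast : (Fin.cons c an : Fin (k + 2) → ι) (Fin.last (k + 1)) =
        (Fin.cons (an 0) (Fin.tail an) : Fin (k + 1) → ι) (Fin.last k) := by
      rw [Fin.cons_self_tail, ← Fin.succ_last, Fin.cons_succ]
    rw [hlast, andChain, exec_cons, act_xor2 (hcy 0) (hca 0) (hya 0 0), ih]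
    · have h1 : ∀ i, ∀ b, Function.update x (an 0) b (Fin.tail y i) =
          x (y i.succ) := fun i b => Function.update_of_ne (hya _ _) _ _
      simp only [h1, Function.update_self, hx, Bool.false_xor, Fin.forall_fin_succ]
      cases x c <;> cases x (y 0) <;> simp
    · exact fun i j hij => Fin.succ_injective _ (han hij)
    · exact fun i j => hya _ _
    · exact fun i => (hya _ _).symm
    · exact fun i h => absurd (han h) (Fin.succ_ne_zero i).symm
    · intro i
      rw [Function.update_of_ne]
      · exact hx _
      · exact fun h => absurd (han h) (Fin.succ_ne_zero i)

/-! ### Table lookup -/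

/-- Unary iteration: flip the qubit `leaf v` if `x_c = 1` and the qubits `e` hold `v`. The work
qubits `k` are returned to zero. -/
def decodeProg : (q : ℕ) → (c : ι) → (e k : Fin q → ι) → (leaf : Bits (Fin q) → ι) →
    List (ClInstr ι)
  | 0, c, _, _, leaf => [.xor1 c (leaf (zeros _)) id]
  | q + 1, c, e, k, leaf =>
    let l := k (Fin.last q)
    [.xor2 c (e (Fin.last q)) l (fun a b => a && !b)] ++
      decodeProg q l (Fin.init e) (Fin.init k) (fun v => leaf (Fin.snoc v false)) ++
      [.xor1 c l id] ++
      decodeProg q l (Fin.init e) (Fin.init k) (fun v => leaf (Fin.snoc v true)) ++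
      [.xor2 c (e (Fin.last q)) l (fun a b => a && b)]

theorem length_decodeProg (q : ℕ) (c : ι) (e k : Fin q → ι) (leaf : Bits (Fin q) → ι) :
    (decodeProg q c e k leaf).length + 3 = 4 * 2 ^ q := by
  induction q generalizing c with
  | zero => rfl
  | succ q ih =>
    have h1 := ih (k (Fin.last q)) (Fin.init e) (Fin.init k) (fun v => leaf (Fin.snoc v false))
    have h2 := ih (k (Fin.last q)) (Fin.init e) (Fin.init k) (fun v => leaf (Fin.snoc v true))
    simp only [decodeProg, List.length_append, List.length_singleton]
    rw [pow_succ]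
    omega

theorem exec_decodeProg (q : ℕ) (c : ι) (e k : Fin q → ι) (leaf : Bits (Fin q) → ι)
    (hk : Function.Injective k) (hce : ∀ i, c ≠ e i) (hck : ∀ i, c ≠ k i)
    (hcl : ∀ v, c ≠ leaf v) (hek : ∀ i j, e i ≠ k j) (hle : ∀ v i, leaf v ≠ e i)
    (hlk : ∀ v i, leaf v ≠ k i) (x : Bits ι) (hx : ∀ i, x (k i) = false) (w : ι) :
    exec (decodeProg q c e k leaf) x w = (x w ^^ (x c && (open Classical in decide
      (w = leaf (x ∘ e))))) := by
  classical
  induction q generalizing c x w with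
  | zero =>
    have : zeros (Fin 0) = x ∘ e := Subsingleton.elim _ _
    rw [decodeProg, exec_cons, exec_nil, act_xor1 (hcl _), this]
    by_cases hw : w = leaf (x ∘ e)
    · simp [hw]
    · simp [hw]
  | succ q ih =>
    have hl : ∀ i, k (Fin.last q) ≠ Fin.init k i := fun i h =>
      absurd (hk h) (Fin.castSucc_lt_last i).ne'
    have IH := fun leaf' h1 h2 h3 => ih (k (Fin.last q)) (Fin.init e) (Fin.init k) leaf'
      (fun i j h => Fin.castSucc_injective _ (hk h)) (fun i => (hek _ _).symm) hl h1
      (fun i j => hek _ _) h2 h3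
    have IH0 := IH (fun v => leaf (Fin.snoc v false)) (fun v => (hlk _ _).symm)
      (fun v i => hle _ _) (fun v i => hlk _ _)
    have IH1 := IH (fun v => leaf (Fin.snoc v true)) (fun v => (hlk _ _).symm)
      (fun v i => hle _ _) (fun v i => hlk _ _)
    clear ih IH
    obtain ⟨u, hu⟩ : ∃ u : Bits (Fin q), u = fun i => x (e i.castSucc) := ⟨_, rfl⟩
    have hxe : x ∘ e = Fin.snoc u (x (e (Fin.last q))) := by
      rw [hu]
      exact (Fin.snoc_init_self (x ∘ e)).symm
    have hue : ∀ z : Bits ι, (∀ i, z (e i) = x (e i)) → z ∘ Fin.init e = u := by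
      intro z hz
      rw [hu]
      exact funext fun i => hz _
    generalize hκ : k (Fin.last q) = κ at *
    have hcκ : c ≠ κ := hκ ▸ hck _
    have hlκ : ∀ v, leaf v ≠ κ := fun v => hκ ▸ hlk v _
    have heκ : ∀ i, e i ≠ κ := fun i => hκ ▸ hek i _
    rw [hxe]
    simp only [decodeProg, exec_append, exec_cons, exec_nil, hκ, act_xor2 (hce _) hcκ (heκ _),
      act_xor1 hcκ]
    generalize hb : x (e (Fin.last q)) = b at *
    -- The labels after each of the five parts of the program.
    obtain ⟨x1, hx1⟩ : ∃ x1, x1 = Function.update x κ (x κ ^^ (x c && !b)) := ⟨_, rfl⟩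
    have e1 : ∀ z, z ≠ κ → x1 z = x z := fun z hz => by rw [hx1, Function.update_of_ne hz]
    have k1 : x1 κ = (x c && !b) := by
      rw [hx1, Function.update_self, ← hκ, hx, Bool.false_xor]
    rw [← hx1]
    obtain ⟨x2, hx2⟩ : ∃ x2, x2 = exec (decodeProg q κ (Fin.init e) (Fin.init k)
      (fun v => leaf (Fin.snoc v false))) x1 := ⟨_, rfl⟩
    rw [← hx2]
    have e2 : ∀ z, x2 z = (x1 z ^^ ((x c && !b) && decide (z = leaf (Fin.snoc u false)))) := by
      intro z
      rw [hx2, IH0 x1 (fun i => (e1 _ (hl i).symm).trans (hx _)),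
        hue x1 fun i => e1 _ (heκ i), k1]
    have l2 : ∀ z, (∀ v, leaf v ≠ z) → x2 z = x1 z := fun z hz => by
      rw [e2, decide_eq_false (hz _).symm]; simp
    rw [l2 κ hlκ, l2 c (fun v => (hcl v).symm), e1 c hcκ, k1]
    obtain ⟨x3, hx3⟩ : ∃ x3, x3 = Function.update x2 κ ((x c && !b) ^^ id (x c)) := ⟨_, rfl⟩
    rw [← hx3]
    have e3 : ∀ z, z ≠ κ → x3 z = x2 z := fun z hz => by rw [hx3, Function.update_of_ne hz]
    have k3 : x3 κ = (x c && b) := by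
      rw [hx3, Function.update_self]
      cases x c <;> cases b <;> rfl
    obtain ⟨x4, hx4⟩ : ∃ x4, x4 = exec (decodeProg q κ (Fin.init e) (Fin.init k)
      (fun v => leaf (Fin.snoc v true))) x3 := ⟨_, rfl⟩
    rw [← hx4]
    have e4 : ∀ z, x4 z = (x3 z ^^ ((x c && b) && decide (z = leaf (Fin.snoc u true)))) := by
      intro z
      rw [hx4, IH1 x3 (fun i => ?_), hue x3 fun i => ?_, k3]
      · rw [e3 _ (heκ i), l2 _ (fun v => hle v i), e1 _ (heκ i)]
      · rw [e3 _ (hl i).symm, l2 (Fin.init k i) (fun v => hlk v _), e1 _ (hl i).symm]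
        exact hx _
    have l4 : ∀ z, (∀ v, leaf v ≠ z) → x4 z = x3 z := fun z hz => by
      rw [e4, decide_eq_false (hz _).symm]; simp
    rw [l4 κ hlκ, l4 c (fun v => (hcl v).symm), l4 _ (fun v => hle v _), e3 c hcκ,
      e3 _ (heκ _), l2 _ (fun v => hle v _), l2 c (fun v => (hcl v).symm), e1 c hcκ,
      e1 _ (heκ _), k3, hb]
    by_cases hw : w = κ
    · subst hw
      rw [Function.update_self, decide_eq_false (hlκ _).symm, ← hκ, hx]
      simp
    · rw [Function.update_of_ne hw, e4, e3 w hw, e2, e1 w hw]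
      cases b <;> cases x c <;> simp

/-- Fold the one-hot qubits `Y v`, `v ∈ l`, with last bit of `v` erased: one step of the
conversion from one-hot to binary. -/
def foldProg {p : ℕ} (Y : Bits (Fin (p + 1)) → ι) (o : ι) (l : List (Bits (Fin p))) :
    List (ClInstr ι) :=
  l.flatMap fun v => [.xor1 (Y (Fin.snoc v true)) o id,
    .xor1 (Y (Fin.snoc v true)) (Y (Fin.snoc v false)) id]

/-- Convert the one-hot qubits `Y` into binary in the qubits `o`. -/
def encodeProg : (p : ℕ) → (Y : Bits (Fin p) → ι) → (o : Fin p → ι) → List (ClInstr ι)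
  | 0, _, _ => []
  | p + 1, Y, o => foldProg Y (o (Fin.last p)) Finset.univ.toList ++
      encodeProg p (fun v => Y (Fin.snoc v false)) (Fin.init o)

theorem length_foldProg {p : ℕ} (Y : Bits (Fin (p + 1)) → ι) (o : ι) (l : List (Bits (Fin p))) :
    (foldProg Y o l).length = 2 * l.length := by
  simp [foldProg, List.length_flatMap, mul_comm]

theorem length_encodeProg (p : ℕ) (Y : Bits (Fin p) → ι) (o : Fin p → ι) :
    (encodeProg p Y o).length + 2 = 2 * 2 ^ p := by
  induction p with
  | zero => rfl
  | succ p ih =>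
    have := ih (fun v => Y (Fin.snoc v false)) (Fin.init o)
    rw [encodeProg, List.length_append, length_foldProg, Finset.length_toList, pow_succ]
    simp only [Finset.card_univ, Fintype.card_pi, Fintype.card_bool, Finset.prod_const,
      Fintype.card_fin]
    omega

theorem exec_foldProg_of_false {p : ℕ} (Y : Bits (Fin (p + 1)) → ι) (o : ι)
    (hY : Function.Injective Y) (hYo : ∀ v, Y v ≠ o) (l : List (Bits (Fin p))) (x : Bits ι)
    (hx : ∀ v ∈ l, x (Y (Fin.snoc v true)) = false) : exec (foldProg Y o l) x = x := by
  classical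
  induction l with
  | nil => rfl
  | cons v l ih =>
    have hne : Y (Fin.snoc v true) ≠ Y (Fin.snoc v false) := fun h => by
      simpa using congrFun (hY h) (Fin.last p)
    have hv := hx v (by simp)
    have := ih fun w hw => hx w (by simp [hw])
    simp only [foldProg, List.flatMap_cons, exec_append, exec_cons, exec_nil,
      act_xor1 (hYo _), act_xor1 hne, hv, id, Bool.xor_false, Function.update_eq_self]
    exact this

theorem exec_foldProg {p : ℕ} (Y : Bits (Fin (p + 1)) → ι) (o : ι)
    (hY : Function.Injective Y) (hYo : ∀ v, Y v ≠ o) (v : Bits (Fin (p + 1))) (x : Bits ι)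
    (hx : ∀ w, x (Y w) = (open Classical in decide (w = v))) (hxo : x o = false) :
    exec (foldProg Y o Finset.univ.toList) x o = v (Fin.last p) ∧
    (∀ w : Bits (Fin p), exec (foldProg Y o Finset.univ.toList) x (Y (Fin.snoc w false)) =
      (open Classical in decide (w = Fin.init v))) ∧
    ∀ z, z ≠ o → (∀ w, z ≠ Y w) → exec (foldProg Y o Finset.univ.toList) x z = x z := by
  classical
  have hsn : ∀ (w : Bits (Fin p)) b, Fin.snoc w b = v ↔ w = Fin.init v ∧ b = v (Fin.last p) := by
    intro w b
    conv_lhs => rw [← Fin.snoc_init_self v]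
    exact Fin.snoc_inj
  cases hb : v (Fin.last p)
  · rw [exec_foldProg_of_false Y o hY hYo _ x fun w _ => ?_]
    · refine ⟨hxo, fun w => ?_, fun _ _ _ => rfl⟩
      rw [hx]
      simp [hsn, hb]
    · rw [hx]
      simp [hsn, hb]
  · obtain ⟨l1, l2, hl⟩ := List.append_of_mem (Finset.mem_toList.2 (Finset.mem_univ (Fin.init v)))
    have hnd : (l1 ++ Fin.init v :: l2).Nodup := hl ▸ Finset.nodup_toList _
    rw [List.nodup_middle, List.nodup_cons, List.mem_append, not_or] at hnd
    have hne : Y (Fin.snoc (Fin.init v) true) ≠ Y (Fin.snoc (Fin.init v) false) := fun h => by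
      simpa using congrFun (hY h) (Fin.last p)
    have hsplit : ∀ z, exec (foldProg Y o Finset.univ.toList) x z =
        Function.update (Function.update x o true) (Y (Fin.snoc (Fin.init v) false)) true z := by
      intro z
      have h1 : exec (foldProg Y o l1) x = x :=
        exec_foldProg_of_false Y o hY hYo _ x fun w hw => by
          rw [hx, decide_eq_false]
          rw [hsn]
          rintro ⟨rfl, -⟩
          exact hnd.1.1 hw
      have hx1 : x (Y (Fin.snoc (Fin.init v) true)) = true := by
        rw [hx, decide_eq_true]; rw [hsn, hb]; exact ⟨rfl, rfl⟩
      have hx0 : x (Y (Fin.snoc (Fin.init v) false)) = false := by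
        rw [hx, decide_eq_false]; rw [hsn, hb]; simp
      have : foldProg Y o (l1 ++ Fin.init v :: l2) = foldProg Y o l1 ++
          [.xor1 (Y (Fin.snoc (Fin.init v) true)) o id,
            .xor1 (Y (Fin.snoc (Fin.init v) true)) (Y (Fin.snoc (Fin.init v) false)) id] ++
          foldProg Y o l2 := by
        simp [foldProg]
      rw [hl, this, exec_append, exec_append, h1]
      simp only [exec_cons, exec_nil, act_xor1 (hYo _), act_xor1 hne, hx1, hxo, id,
        Bool.false_xor, Function.update_of_ne (hYo _), hx0]
      rw [exec_foldProg_of_false Y o hY hYo _ _ fun w hw => ?_]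
      have hne2 : Y (Fin.snoc w true) ≠ Y (Fin.snoc (Fin.init v) false) := fun h => by
        simpa using congrFun (hY h) (Fin.last p)
      rw [Function.update_of_ne hne2, Function.update_of_ne (hYo _), hx, decide_eq_false]
      rw [hsn]
      rintro ⟨rfl, -⟩
      exact hnd.1.2 hw
    simp only [hsplit]
    refine ⟨?_, fun w => ?_, fun z hzo hzY => ?_⟩
    · rw [Function.update_of_ne (hYo _).symm, Function.update_self]
    · by_cases hw : w = Fin.init v
      · subst hw; simp
      · rw [Function.update_of_ne, Function.update_of_ne (hYo _), hx]
        · simp [hsn, hw]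
        · intro h
          exact hw (Fin.snoc_inj.1 (hY h)).1
    · rw [Function.update_of_ne (hzY _), Function.update_of_ne hzo]

theorem exec_encodeProg (p : ℕ) (Y : Bits (Fin p) → ι) (o : Fin p → ι)
    (hY : Function.Injective Y) (ho : Function.Injective o) (hYo : ∀ v i, Y v ≠ o i)
    (v : Bits (Fin p)) (x : Bits ι)
    (hx : ∀ w, x (Y w) = (open Classical in decide (w = v))) (hxo : ∀ i, x (o i) = false) :
    (∀ i, exec (encodeProg p Y o) x (o i) = v i) ∧
    ∀ z, (∀ i, z ≠ o i) → (∀ w, z ≠ Y w) → exec (encodeProg p Y o) x z = x z := by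
  induction p generalizing x with
  | zero => exact ⟨fun i => i.elim0, fun _ _ _ => rfl⟩
  | succ p ih =>
    obtain ⟨h1, h2, h3⟩ := exec_foldProg Y (o (Fin.last p)) hY (fun w => hYo _ _) v x hx (hxo _)
    have hli : ∀ i, o (Fin.last p) ≠ Fin.init o i := fun i h =>
      absurd (ho h) (Fin.castSucc_lt_last i).ne'
    obtain ⟨h4, h5⟩ := ih (fun v => Y (Fin.snoc v false)) (Fin.init o)
      (fun w w' h => (Fin.snoc_inj.1 (hY h)).1) (fun i j h => Fin.castSucc_injective _ (ho h))
      (fun w i => hYo _ _) (Fin.init v)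
      (exec (foldProg Y (o (Fin.last p)) Finset.univ.toList) x) h2
      (fun i => (h3 _ (hli i).symm fun w => (hYo _ _).symm).trans (hxo _))
    simp only [encodeProg, exec_append]
    refine ⟨fun i => ?_, fun z hz hz' => ?_⟩
    · refine Fin.lastCases ?_ (fun j => h4 j) i
      rw [h5 _ hli fun w => (hYo _ _).symm, h1]
    · rw [h5 z (fun i => hz _) (fun w => hz' _), h3 z (hz _) hz']

/-- Look up the table `T` at the label held by the qubits `e` and write the result into the qubits
`o`. The qubits `c`, `k`, `Y` are work qubits. -/
def tableProg {q p : ℕ} (T : Bits (Fin q) → Bits (Fin p)) (c : ι) (e k : Fin q → ι)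
    (Y : Bits (Fin p) → ι) (o : Fin p → ι) : List (ClInstr ι) :=
  [.xor1 (Y (zeros _)) c fun _ => true] ++ decodeProg q c e k (fun v => Y (T v)) ++
    encodeProg p Y o

theorem length_tableProg_le {q p : ℕ} (T : Bits (Fin q) → Bits (Fin p)) (c : ι) (e k : Fin q → ι)
    (Y : Bits (Fin p) → ι) (o : Fin p → ι) :
    (tableProg T c e k Y o).length ≤ 4 * 2 ^ q + 2 * 2 ^ p := by
  have h1 := length_decodeProg q c e k (fun v => Y (T v))
  have h2 := length_encodeProg p Y o
  simp only [tableProg, List.length_append, List.length_singleton]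
  omega

theorem exec_tableProg {q p : ℕ} (T : Bits (Fin q) → Bits (Fin p)) (c : ι) (e k : Fin q → ι)
    (Y : Bits (Fin p) → ι) (o : Fin p → ι)
    (hk : Function.Injective k) (hY : Function.Injective Y) (ho : Function.Injective o)
    (hce : ∀ i, c ≠ e i) (hck : ∀ i, c ≠ k i) (hcY : ∀ v, c ≠ Y v) (hco : ∀ i, c ≠ o i)
    (hek : ∀ i j, e i ≠ k j) (hYe : ∀ v i, Y v ≠ e i) (hYk : ∀ v i, Y v ≠ k i)
    (hYo : ∀ v i, Y v ≠ o i)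
    (x : Bits ι) (hxc : x c = false) (hxk : ∀ i, x (k i) = false)
    (hxY : ∀ v, x (Y v) = false) (hxo : ∀ i, x (o i) = false) :
    (∀ i, exec (tableProg T c e k Y o) x (o i) = T (x ∘ e) i) ∧
    ∀ z, z ≠ c → (∀ i, z ≠ o i) → (∀ w, z ≠ Y w) → exec (tableProg T c e k Y o) x z = x z := by
  classical
  simp only [tableProg, exec_append, exec_cons, exec_nil, act_xor1 (hcY _).symm, hxc,
    Bool.false_xor]
  have hd := exec_decodeProg q c e k (fun v => Y (T v)) hk hce hck (fun v => hcY _) hek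
    (fun v i => hYe _ _) (fun v i => hYk _ _) (Function.update x c true)
    (fun i => (Function.update_of_ne (hck i).symm _ _).trans (hxk i))
  have he : Function.update x c true ∘ e = x ∘ e :=
    funext fun i => Function.update_of_ne (hce i).symm _ _
  rw [he, Function.update_self] at hd
  simp only [Bool.true_and] at hd
  obtain ⟨h1, h2⟩ := exec_encodeProg p Y o hY ho hYo (T (x ∘ e))
    (exec (decodeProg q c e k (fun v => Y (T v))) (Function.update x c true))
    (fun w => by
      rw [hd, Function.update_of_ne (hcY w).symm, hxY, Bool.false_xor]
      exact decide_eq_decide.2 hY.eq_iff)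
    (fun i => by
      rw [hd, Function.update_of_ne (hco i).symm, hxo, decide_eq_false (hYo _ _).symm]
      rfl)
  refine ⟨h1, fun z hzc hzo hzY => ?_⟩
  rw [h2 z hzo hzY, hd, Function.update_of_ne hzc, decide_eq_false (hzY _), Bool.xor_false]

/-! ### A random bit whose bias is the value of a binary fraction -/

/-- The bit of `b` at the position of the first `0` of `u`, and `0` if there is none. If `u` is
uniformly distributed, this is `1` with probability `∑ b_k 2^{-(k+1)}`. -/
def firstZeroBit : (m : ℕ) → Bits (Fin m) → Bits (Fin m) → Bool
  | 0, _, _ => false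
  | m + 1, b, u => if u 0 then firstZeroBit m (Fin.tail b) (Fin.tail u) else b 0

/-- The program computing `firstZeroBit` in the qubit `γ 0`. -/
def firstZeroProg : (m : ℕ) → (b u : Fin m → ι) → (γ : Fin (m + 1) → ι) → List (ClInstr ι)
  | 0, _, _, _ => []
  | m + 1, b, u, γ => firstZeroProg m (Fin.tail b) (Fin.tail u) (Fin.tail γ) ++
      [.xor2 (u 0) (b 0) (γ 0) (fun x y => !x && y), .xor2 (u 0) (γ 1) (γ 0) (fun x y => x && y)]

theorem length_firstZeroProg (m : ℕ) (b u : Fin m → ι) (γ : Fin (m + 1) → ι) :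
    (firstZeroProg m b u γ).length = 2 * m := by
  induction m with
  | zero => rfl
  | succ m ih => rw [firstZeroProg, List.length_append, ih]; rfl

theorem exec_firstZeroProg (m : ℕ) (b u : Fin m → ι) (γ : Fin (m + 1) → ι)
    (hγ : Function.Injective γ) (hub : ∀ i j, u i ≠ b j) (huγ : ∀ i j, u i ≠ γ j)
    (hbγ : ∀ i j, b i ≠ γ j) (x : Bits ι) (hx : ∀ i, x (γ i) = false) :
    exec (firstZeroProg m b u γ) x (γ 0) = firstZeroBit m (x ∘ b) (x ∘ u) ∧
    ∀ z, (∀ i, z ≠ γ i) → exec (firstZeroProg m b u γ) x z = x z := by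
  classical
  induction m with
  | zero => exact ⟨hx 0, fun _ _ => rfl⟩
  | succ m ih =>
    obtain ⟨h1, h2⟩ := ih (Fin.tail b) (Fin.tail u) (Fin.tail γ)
      (fun i j h => Fin.succ_injective _ (hγ h)) (fun i j => hub _ _) (fun i j => huγ _ _)
      (fun i j => hbγ _ _) (fun i => hx _)
    have h10 : γ 1 ≠ γ 0 := fun h => absurd (hγ h) (by simp)
    have h0 : ∀ i, γ 0 ≠ Fin.tail γ i := fun i h => absurd (hγ h) (Fin.succ_ne_zero i).symm
    simp only [firstZeroProg, exec_append, exec_cons, exec_nil, act_xor2 (hub _ _) (huγ _ _)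
      (hbγ _ _), act_xor2 (huγ _ _) (huγ _ _) h10]
    refine ⟨?_, fun z hz => ?_⟩
    · rw [h2 _ h0, h2 (u 0) (fun i => huγ _ _), h2 (b 0) (fun i => hbγ _ _), hx]
      simp only [Function.update_self, Function.update_of_ne (huγ _ _),
        Function.update_of_ne h10, Bool.false_xor, h2 (u 0) (fun i => huγ _ _),
        show exec (firstZeroProg m (Fin.tail b) (Fin.tail u) (Fin.tail γ)) x (γ 1) =
          firstZeroBit m (x ∘ Fin.tail b) (x ∘ Fin.tail u) from h1, firstZeroBit,
        Function.comp_apply]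
      cases x (u 0) <;> simp
      rfl
    · rw [Function.update_of_ne (hz 0), Function.update_of_ne (hz 0), h2 z fun i => hz _]

theorem sum_firstZeroBit (m : ℕ) (b : Bits (Fin m)) :
    ∑ u : Bits (Fin m), ((firstZeroBit m b u).toNat : ℝ) =
      2 ^ m * ∑ k : Fin m, if b k = true then (1 / 2 : ℝ) ^ (k.1 + 1) else 0 := by
  induction m with
  | zero => simp [firstZeroBit]
  | succ m ih =>
    rw [sum_bits_cons, Fintype.sum_bool, Fin.sum_univ_succ]
    simp only [firstZeroBit, Fin.cons_zero, if_true, Bool.false_eq_true, if_false, Fin.tail_cons]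
    rw [ih]
    have : ∀ k : Fin m, (if Fin.tail b k = true then (1 / 2 : ℝ) ^ (k.1 + 1) else 0) =
        2 * (if b k.succ = true then (1 / 2 : ℝ) ^ (k.succ.1 + 1) else 0) := by
      intro k
      rw [show Fin.tail b k = b k.succ from rfl, Fin.val_succ]
      split_ifs
      · rw [pow_succ _ (k.1 + 1)]; ring
      · simp
    simp only [this, ← Finset.mul_sum]
    simp only [Finset.sum_const, Finset.card_univ, Fintype.card_pi, Fintype.card_bool,
      Finset.prod_const, Fintype.card_fin, nsmul_eq_mul]
    cases b 0 <;> simp <;> ring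

/-- The sign of the random bit used to multiply amplitudes by a fixed-point number: on average
over `u`, the bit `biasedBit b u` gives `2 · bit - 1` the value `fixedVal b`. -/
def biasedBit {m : ℕ} (b u : Bits (Fin (m + 1))) : Bool :=
  if u 0 then firstZeroBit m (Fin.tail b) (Fin.tail u) else !(b 0)

theorem sum_biasedBit {m : ℕ} (b : Bits (Fin (m + 1))) :
    ∑ u : Bits (Fin (m + 1)), (if biasedBit b u = true then (1 : ℝ) else -1) =
      2 ^ (m + 1) * fixedVal b := by
  have hs : ∀ u, (if biasedBit b u = true then (1 : ℝ) else -1) =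
      2 * ((biasedBit b u).toNat : ℝ) - 1 := by
    intro u
    cases biasedBit b u <;> norm_num
  simp only [hs, Finset.sum_sub_distrib, ← Finset.mul_sum]
  rw [sum_bits_cons, Fintype.sum_bool]
  simp only [biasedBit, Fin.cons_zero, if_true, Bool.false_eq_true, if_false, Fin.tail_cons]
  rw [sum_firstZeroBit, fixedVal]
  simp only [Finset.sum_const, Finset.card_univ, Fintype.card_pi, Fintype.card_bool,
      Finset.prod_const, Fintype.card_fin, nsmul_eq_mul, Fin.tail]
  cases b 0 <;> simp <;> ring

/-- The program computing `biasedBit` in the qubit `γ 0`. -/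
def biasedProg {m : ℕ} (b u : Fin (m + 1) → ι) (γ : Fin (m + 2) → ι) : List (ClInstr ι) :=
  firstZeroProg m (Fin.tail b) (Fin.tail u) (Fin.tail γ) ++
    [.xor2 (u 0) (b 0) (γ 0) (fun x y => !x && !y), .xor2 (u 0) (γ 1) (γ 0) (fun x y => x && y)]

theorem length_biasedProg {m : ℕ} (b u : Fin (m + 1) → ι) (γ : Fin (m + 2) → ι) :
    (biasedProg b u γ).length = 2 * (m + 1) := by
  rw [biasedProg, List.length_append, length_firstZeroProg]; rfl

theorem exec_biasedProg {m : ℕ} (b u : Fin (m + 1) → ι) (γ : Fin (m + 2) → ι)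
    (hγ : Function.Injective γ) (hub : ∀ i j, u i ≠ b j) (huγ : ∀ i j, u i ≠ γ j)
    (hbγ : ∀ i j, b i ≠ γ j) (x : Bits ι) (hx : ∀ i, x (γ i) = false) :
    exec (biasedProg b u γ) x (γ 0) = biasedBit (x ∘ b) (x ∘ u) := by
  classical
  obtain ⟨h1, h2⟩ := exec_firstZeroProg m (Fin.tail b) (Fin.tail u) (Fin.tail γ)
      (fun i j h => Fin.succ_injective _ (hγ h)) (fun i j => hub _ _) (fun i j => huγ _ _)
      (fun i j => hbγ _ _) x (fun i => hx _)
  have h10 : γ 1 ≠ γ 0 := fun h => absurd (hγ h) (by simp)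
  have h0 : ∀ i, γ 0 ≠ Fin.tail γ i := fun i h => absurd (hγ h) (Fin.succ_ne_zero i).symm
  simp only [biasedProg, exec_append, exec_cons, exec_nil, act_xor2 (hub _ _) (huγ _ _)
      (hbγ _ _), act_xor2 (huγ _ _) (huγ _ _) h10]
  rw [h2 _ h0, h2 (u 0) (fun i => huγ _ _), h2 (b 0) (fun i => hbγ _ _), hx]
  simp only [Function.update_self, Function.update_of_ne (huγ _ _),
    Function.update_of_ne h10, Bool.false_xor, h2 (u 0) (fun i => huγ _ _),
    show exec (firstZeroProg m (Fin.tail b) (Fin.tail u) (Fin.tail γ)) x (γ 1) =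
      firstZeroBit m (x ∘ Fin.tail b) (x ∘ Fin.tail u) from h1, biasedBit,
    Function.comp_apply]
  cases x (u 0) <;> simp
  rfl

end Classical

/-! ### The quantum Fourier transform -/

/-- The number with binary digits `t`, the digit `t 0` being the least significant one. -/
def natVal {q : ℕ} (t : Bits (Fin q)) : ℕ := ∑ i, if t i = true then 2 ^ (i : ℕ) else 0

/-- The number with binary digits `t`, the digit `t 0` being the most significant one. -/
def revVal {q : ℕ} (t : Bits (Fin q)) : ℕ := natVal (t ∘ Fin.rev)

theorem natVal_succ {q : ℕ} (t : Bits (Fin (q + 1))) :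
    natVal t = natVal (t ∘ Fin.castSucc) + if t (Fin.last q) = true then 2 ^ q else 0 := by
  simp [natVal, Fin.sum_univ_castSucc]

theorem revVal_succ {q : ℕ} (t : Bits (Fin (q + 1))) :
    revVal t = (if t (Fin.last q) = true then 1 else 0) + 2 * revVal (t ∘ Fin.castSucc) := by
  simp only [revVal, natVal, Fin.sum_univ_succ, Function.comp_apply, Fin.rev_zero, Fin.rev_succ,
    Fin.val_zero, pow_zero, Finset.mul_sum, Fin.val_succ, pow_succ, mul_ite, mul_zero]
  congr 1
  exact Finset.sum_congr rfl fun i _ => by rw [mul_comm]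

theorem sum_natVal {q : ℕ} {β : Type*} [AddCommMonoid β] (h : ℕ → β) :
    ∑ t : Bits (Fin q), h (natVal t) = ∑ k ∈ Finset.range (2 ^ q), h k := by
  induction q generalizing h with
  | zero => simp [natVal]
  | succ q ih =>
    rw [sum_bits_snoc, Fintype.sum_bool]
    have hc : ∀ (y : Bits (Fin q)) b, (Fin.snoc y b : Bits (Fin (q + 1))) ∘ Fin.castSucc = y :=
      fun y b => funext fun i => Fin.snoc_castSucc (α := fun _ => Bool) b y i
    simp only [natVal_succ, hc, Fin.snoc_last, if_true, Bool.false_eq_true, if_false, add_zero]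
    rw [ih, ih (fun k => h (k + 2 ^ q)), pow_succ, mul_two, Finset.sum_range_add, add_comm]
    simp only [add_comm]

theorem sum_revVal {q : ℕ} {β : Type*} [AddCommMonoid β] (h : ℕ → β) :
    ∑ t : Bits (Fin q), h (revVal t) = ∑ k ∈ Finset.range (2 ^ q), h k := by
  rw [← sum_natVal]
  exact Fintype.sum_equiv (Equiv.arrowCongr Fin.revPerm (Equiv.refl Bool)) _ _ fun t => rfl

/-- The Fourier transform of `ℤ/2^q`, up to the order of the bits of the result. -/
def qft {n : ℕ} : (q : ℕ) → List (Gate n (Fin q))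
  | 0 => []
  | q + 1 => [phaseHadamard 1 (Fin.last q)] ++
      (List.finRange q).flatMap (fun j : Fin q => diagGate (Fin.last q) j.castSucc fun b z =>
        if (b && z) = true then Circle.exp (2 * Real.pi * 2 ^ (j : ℕ) / 2 ^ (q + 1)) else 1) ++
      liftCircuit Fin.castSuccEmb (qft q)

theorem oracleCount_qft {n : ℕ} (q : ℕ) : oracleCount (qft q : List (Gate n (Fin q))) = 0 := by
  induction q with
  | zero => rfl
  | succ q ih =>
    rw [qft, oracleCount_append, oracleCount_append, oracleCount_lift, ih]
    have h2 : ∀ (l : List (Fin q)) (d : Fin q → Bool → Bool → Circle), oracleCount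
        (l.flatMap fun j =>
          (diagGate (Fin.last q) j.castSucc (d j) : List (Gate n (Fin (q + 1))))) = 0 := by
      intro l d
      induction l with
      | nil => rfl
      | cons j l ihl => rw [List.flatMap_cons, oracleCount_append, ihl, oracleCount_diagGate]
    rw [h2 _ fun (j : Fin q) b z =>
        if (b && z) = true then Circle.exp (2 * Real.pi * 2 ^ (j : ℕ) / 2 ^ (q + 1)) else 1]
    simp [oracleCount, phaseHadamard, Gate.isElem]

theorem elemCount_qft_le {n : ℕ} (q : ℕ) : elemCount (qft q : List (Gate n (Fin q))) ≤ q ^ 2 := by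
  induction q with
  | zero => rfl
  | succ q ih =>
    rw [qft, elemCount_append, elemCount_append, elemCount_lift]
    have h1 : elemCount [(phaseHadamard 1 (Fin.last q) : Gate n (Fin (q + 1)))] = 1 := by
      simp [elemCount, phaseHadamard, Gate.isElem]
    have h2 : ∀ (l : List (Fin q)) (d : Fin q → Bool → Bool → Circle), elemCount (l.flatMap fun j =>
        (diagGate (Fin.last q) j.castSucc (d j) : List (Gate n (Fin (q + 1))))) ≤ l.length := by
      intro l d
      induction l with
      | nil => rfl
      | cons j l ihl =>
        rw [List.flatMap_cons, elemCount_append, List.length_cons]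
        grw [ihl, elemCount_diagGate_le]
        omega
    have h3 := h2 (List.finRange q) (fun (j : Fin q) b z =>
        if (b && z) = true then Circle.exp (2 * Real.pi * 2 ^ (j : ℕ) / 2 ^ (q + 1)) else 1)
    rw [List.length_finRange] at h3
    rw [h1]
    nlinarith

theorem run_flatMap_diagGate {n : ℕ} {ι α : Type} (U : Unitary (Fin n)) (a : ι) (b : α → ι)
    (hab : ∀ j, a ≠ b j) (d : α → Bool → Bool → Circle) (l : List α) (ψ : State ι) :
    run U (l.flatMap fun j => diagGate a (b j) (d j)) ψ =
      fun x => (l.map fun j => (d j (x a) (x (b j)) : ℂ)).prod * ψ x := by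
  induction l generalizing ψ with
  | nil => simp
  | cons j l ih =>
    rw [List.flatMap_cons, run_append, run_diagGate U (hab j), ih]
    funext x
    rw [List.map_cons, List.prod_cons]
    ring

/-- The amplitudes of the Fourier transform of a basis state. -/
theorem run_qft_ket {n : ℕ} (U : Unitary (Fin n)) (q : ℕ) (t s : Bits (Fin q)) :
    run U (qft q) (ket t) s =
      (Real.sqrt 2 : ℂ)⁻¹ ^ q *
        Complex.exp (2 * Real.pi * Complex.I * (revVal s * natVal t) / 2 ^ q) := by
  induction q with
  | zero => simp [qft, ket, natVal, revVal, Subsingleton.elim s t]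
  | succ q ih =>
    set c : Bool → ℂ := fun b => (Real.sqrt 2 : ℂ)⁻¹ *
      (if (b && t (Fin.last q)) = true then -1 else 1) *
      ∏ j : Fin q, (if (b && t j.castSucc) = true then
        Complex.exp (2 * Real.pi * Complex.I * 2 ^ (j : ℕ) / 2 ^ (q + 1)) else 1) with hc
    have hstep : run U ([phaseHadamard 1 (Fin.last q)] ++
        (List.finRange q).flatMap (fun j : Fin q => diagGate (Fin.last q) j.castSucc fun b z =>
        if (b && z) = true then Circle.exp (2 * Real.pi * 2 ^ (j : ℕ) / 2 ^ (q + 1)) else 1))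
        (ket t) = fun x => ket (t ∘ Fin.castSucc) (x ∘ Fin.castSuccEmb) *
          c (x (Fin.last q)) := by
      rw [run_append, run_flatMap_diagGate U _ _ fun j => (Fin.castSucc_lt_last j).ne']
      funext x
      rw [← Fin.prod_univ_def, run_cons, run_nil, phaseHadamard_apply]
      have hk : ∀ b, ket t (Function.update x (Fin.last q) b) =
          ket (t ∘ Fin.castSucc) (x ∘ Fin.castSuccEmb) *
            if b = t (Fin.last q) then 1 else 0 := by
        intro b
        have : Function.update x (Fin.last q) b = t ↔
            x ∘ Fin.castSuccEmb = t ∘ Fin.castSucc ∧ b = t (Fin.last q) := by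
          constructor
          · rintro rfl
            refine ⟨funext fun i => ?_, by simp⟩
            simp
          · rintro ⟨h1, h2⟩
            funext i
            refine Fin.lastCases ?_ (fun j => ?_) i
            · simpa using h2
            · rw [Function.update_of_ne (Fin.castSucc_lt_last j).ne]
              exact congrFun h1 j
        simp only [ket, Pi.single_apply, this, ite_and, mul_ite, mul_one, mul_zero]
        split_ifs <;> rfl
      rw [hk, hk]
      by_cases hx : x ∘ Fin.castSuccEmb = t ∘ Fin.castSucc
      · have hxj : ∀ j : Fin q, x j.castSucc = t j.castSucc := fun j => congrFun hx j
        simp only [hxj, hc]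
        have hp : ∀ j : Fin q, ((if (x (Fin.last q) && t j.castSucc) = true then
            Circle.exp (2 * Real.pi * 2 ^ (j : ℕ) / 2 ^ (q + 1)) else 1 : Circle) : ℂ) =
            if (x (Fin.last q) && t j.castSucc) = true then
              Complex.exp (2 * Real.pi * Complex.I * 2 ^ (j : ℕ) / 2 ^ (q + 1)) else 1 := by
          intro j
          split_ifs
          · rw [Circle.coe_exp]
            congr 1
            push_cast
            ring
          · rfl
        simp only [hp]
        cases x (Fin.last q) <;> cases t (Fin.last q) <;> simp <;> ring
      · have : ket (t ∘ Fin.castSucc) (x ∘ Fin.castSuccEmb) = 0 := by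
          simp only [ket, Pi.single_apply, hx, if_false]
        simp only [this, zero_mul, mul_zero, add_zero]
    rw [qft, run_append, hstep, run_lift_mul]
    · change run U (qft q) (ket (t ∘ Fin.castSucc)) (s ∘ Fin.castSucc) * c (s (Fin.last q)) = _
      rw [ih, revVal_succ, natVal_succ, hc]
      have hprod : ∏ j : Fin q, (if (s (Fin.last q) && t j.castSucc) = true then
          Complex.exp (2 * Real.pi * Complex.I * 2 ^ (j : ℕ) / 2 ^ (q + 1)) else 1) =
          Complex.exp (2 * Real.pi * Complex.I * ((if s (Fin.last q) = true then 1 else 0) *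
            (natVal (t ∘ Fin.castSucc) : ℂ)) / 2 ^ (q + 1)) := by
        rw [natVal, Nat.cast_sum, Finset.mul_sum, Finset.mul_sum, Finset.sum_div, Complex.exp_sum]
        refine Finset.prod_congr rfl fun j _ => ?_
        cases s (Fin.last q) <;> cases h : t j.castSucc <;> simp [h]
      simp only [hprod]
      have hsgn : (if (s (Fin.last q) && t (Fin.last q)) = true then (-1 : ℂ) else 1) =
          Complex.exp (Real.pi * Complex.I * (if (s (Fin.last q) && t (Fin.last q)) = true then 1
            else 0)) := by
        split_ifs <;> simp
      -- The digit products missing in the circuit contribute integer multiples of `2πi`.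
      have hint : Complex.exp (((revVal (s ∘ Fin.castSucc) *
          (if t (Fin.last q) = true then 1 else 0) : ℕ) : ℂ) * (2 * Real.pi * Complex.I)) = 1 :=
        Complex.exp_nat_mul_two_pi_mul_I _
      have h2 : (2 : ℂ) ^ q ≠ 0 := pow_ne_zero _ two_ne_zero
      have hexp : 2 * Real.pi * Complex.I * ((((if s (Fin.last q) = true then 1 else 0) +
          2 * revVal (s ∘ Fin.castSucc) : ℕ) : ℂ) * ((natVal (t ∘ Fin.castSucc) +
          if t (Fin.last q) = true then 2 ^ q else 0 : ℕ) : ℂ)) / 2 ^ (q + 1) =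
          2 * Real.pi * Complex.I *
            (revVal (s ∘ Fin.castSucc) * natVal (t ∘ Fin.castSucc)) / 2 ^ q +
          Real.pi * Complex.I * (if (s (Fin.last q) && t (Fin.last q)) = true then 1 else 0) +
          2 * Real.pi * Complex.I * ((if s (Fin.last q) = true then 1 else 0) *
            (natVal (t ∘ Fin.castSucc) : ℂ)) / 2 ^ (q + 1) +
          ((revVal (s ∘ Fin.castSucc) * (if t (Fin.last q) = true then 1 else 0) : ℕ) : ℂ) *
            (2 * Real.pi * Complex.I) := by
        rw [pow_succ]
        push_cast
        field_simp
        cases s (Fin.last q) <;> cases t (Fin.last q) <;> simp <;> ring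
      rw [hsgn, hexp, Complex.exp_add, hint, Complex.exp_add, Complex.exp_add]
      ring
    · intro x y
      rw [Function.extend_apply']
      rintro ⟨j, hj⟩
      exact (Fin.castSucc_lt_last j).ne hj

/-! ### Phase estimation with a window vanishing at the ends -/

theorem norm_cexp_sub_one_le (x : ℝ) : ‖Complex.exp (x * Complex.I) - 1‖ ≤ |x| := by
  rw [mul_comm]
  exact Real.norm_exp_I_mul_ofReal_sub_one_le

/-- The Fourier character `k ↦ exp(2πi k / M)`. -/
def char (M k : ℕ) : ℂ := Complex.exp ((2 * Real.pi * k / M : ℝ) * Complex.I)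

theorem norm_char (M k : ℕ) : ‖char M k‖ = 1 := Complex.norm_exp_ofReal_mul_I _

theorem char_add (M k l : ℕ) : char M (k + l) = char M k * char M l := by
  rw [char, char, char, ← Complex.exp_add]
  congr 1
  push_cast
  ring

theorem char_zero (M : ℕ) : char M 0 = 1 := by simp [char]

theorem char_mul_self {M : ℕ} (hM : 0 < M) (k : ℕ) : char M (k * M) = 1 := by
  have hM' : (M : ℝ) ≠ 0 := by positivity
  rw [char, show ((2 * Real.pi * (k * M : ℕ) / M : ℝ) * Complex.I : ℂ) =
    k * (2 * Real.pi * Complex.I) by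
      rw [show (2 * Real.pi * (k * M : ℕ) / M : ℝ) = k * (2 * Real.pi) by
        push_cast; field_simp]
      push_cast; ring]
  exact Complex.exp_nat_mul_two_pi_mul_I k

theorem char_mul (M k l : ℕ) : char M (k * l) = char M k ^ l := by
  induction l with
  | zero => simp [char_zero]
  | succ l ih => rw [Nat.mul_succ, char_add, ih, pow_succ]

theorem char_mul_conj (M k : ℕ) : char M k * (starRingEnd ℂ) (char M k) = 1 := by
  rw [Complex.mul_conj, Complex.normSq_eq_norm_sq, norm_char]; simp

theorem char_ne_one {M : ℕ} {k : ℕ} (h0 : 0 < k) (hk : k < M) : char M k ≠ 1 := by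
  have hprim := Complex.isPrimitiveRoot_exp M (by omega)
  intro h
  have : Complex.exp (2 * Real.pi * Complex.I / M) ^ k = 1 := by
    rw [← Complex.exp_nat_mul, ← h, char]
    congr 1
    push_cast
    ring
  have := Nat.le_of_dvd h0 (hprim.dvd_of_pow_eq_one k this)
  omega

theorem sum_char_mul_conj {M : ℕ} {s t : ℕ} (hs : s < M) (ht : t < M) :
    ∑ o ∈ Finset.range M, char M (o * s) * (starRingEnd ℂ) (char M (o * t)) =
      if s = t then (M : ℂ) else 0 := by
  -- The ratio of the geometric progression has `M`-th power `1`.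
  have key : ∀ s t, s < t → t < M →
      ∑ o ∈ Finset.range M, char M (o * s) * (starRingEnd ℂ) (char M (o * t)) = 0 := by
    intro s t hst ht
    have h1 : ∀ o, char M (o * s) * (starRingEnd ℂ) (char M (o * t)) =
        (starRingEnd ℂ) (char M (t - s)) ^ o := by
      intro o
      have : o * t = o * s + (t - s) * o := by
        obtain ⟨d, rfl⟩ := Nat.exists_eq_add_of_lt hst
        rw [show s + d + 1 - s = d + 1 by omega]
        ring
      rw [this, char_add, map_mul, ← mul_assoc, char_mul_conj, one_mul, char_mul, map_pow]
    simp only [h1]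
    have h2 : (starRingEnd ℂ) (char M (t - s)) ≠ 1 := fun h =>
      char_ne_one (M := M) (k := t - s) (by omega) (by omega)
        (by simpa using congrArg (starRingEnd ℂ) h)
    have h3 := geom_sum_mul ((starRingEnd ℂ) (char M (t - s))) M
    rw [← map_pow, ← char_mul, char_mul_self (by omega), map_one, sub_self] at h3
    exact (mul_eq_zero.1 h3).resolve_right (sub_ne_zero.2 h2)
  rcases lt_trichotomy s t with h | h | h
  · rw [key s t h ht, if_neg h.ne]
  · subst h
    simp [char_mul_conj]
  · rw [if_neg h.ne', ← map_zero (starRingEnd ℂ), ← key t s h hs, map_sum]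
    refine Finset.sum_congr rfl fun o _ => ?_
    rw [map_mul, Complex.conj_conj, mul_comm]

/-- The unitary Fourier transform of length `M`. -/
def fourier (M : ℕ) (h : ℕ → ℂ) (o : ℕ) : ℂ :=
  (Real.sqrt M : ℂ)⁻¹ * ∑ t ∈ Finset.range M, char M (o * t) * h t

theorem sum_norm_fourier_sq {M : ℕ} (hM : 0 < M) (h : ℕ → ℂ) :
    ∑ o ∈ Finset.range M, ‖fourier M h o‖ ^ 2 = ∑ t ∈ Finset.range M, ‖h t‖ ^ 2 := by
  have hsq : (Real.sqrt M : ℂ)⁻¹ * (Real.sqrt M : ℂ)⁻¹ = (M : ℂ)⁻¹ := by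
    rw [← mul_inv, ← Complex.ofReal_mul, Real.mul_self_sqrt (by positivity)]
    simp
  have hM' : (M : ℂ) ≠ 0 := by exact_mod_cast hM.ne'
  have hn : ∀ z : ℂ, ((‖z‖ ^ 2 : ℝ) : ℂ) = z * (starRingEnd ℂ) z := fun z => by
    rw [Complex.mul_conj, Complex.normSq_eq_norm_sq]
  have goal : (((∑ o ∈ Finset.range M, ‖fourier M h o‖ ^ 2 : ℝ)) : ℂ) =
      ((∑ t ∈ Finset.range M, ‖h t‖ ^ 2 : ℝ) : ℂ) := by
    rw [Complex.ofReal_sum, Complex.ofReal_sum]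
    simp only [hn, fourier, map_mul, map_sum, map_inv₀, Complex.conj_ofReal]
    calc _ = ∑ o ∈ Finset.range M, ∑ s ∈ Finset.range M, ∑ t ∈ Finset.range M,
          (M : ℂ)⁻¹ * (h s * (starRingEnd ℂ) (h t)) *
            (char M (o * s) * (starRingEnd ℂ) (char M (o * t))) := by
          refine Finset.sum_congr rfl fun o _ => ?_
          rw [mul_mul_mul_comm, hsq, Finset.sum_mul_sum, Finset.mul_sum]
          refine Finset.sum_congr rfl fun s _ => ?_
          rw [Finset.mul_sum]
          refine Finset.sum_congr rfl fun t _ => ?_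
          ring
      _ = ∑ s ∈ Finset.range M, ∑ t ∈ Finset.range M,
          (M : ℂ)⁻¹ * (h s * (starRingEnd ℂ) (h t)) * (if s = t then (M : ℂ) else 0) := by
          rw [Finset.sum_comm]
          refine Finset.sum_congr rfl fun s hs => ?_
          rw [Finset.sum_comm]
          refine Finset.sum_congr rfl fun t ht => ?_
          rw [← Finset.mul_sum,
            sum_char_mul_conj (Finset.mem_range.1 hs) (Finset.mem_range.1 ht)]
      _ = _ := by
          refine Finset.sum_congr rfl fun s hs => ?_
          simp only [mul_ite, mul_zero, Finset.sum_ite_eq, hs, if_true]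
          field_simp
  exact_mod_cast goal

/-- The window `(1 - exp(2πi t / M)) / √(2M)`. It vanishes at both ends of `[0, M]` and varies
slowly, which makes the error of phase estimation of order `1 / M`. -/
def window (M t : ℕ) : ℂ := (Real.sqrt M : ℂ)⁻¹ * ((Real.sqrt 2 : ℂ)⁻¹ * (1 - char M t))

theorem window_zero (M : ℕ) : window M 0 = 0 := by simp [window, char_zero]

theorem window_self {M : ℕ} (hM : 0 < M) : window M M = 0 := by
  have := char_mul_self hM 1
  rw [one_mul] at this
  simp [window, this]

theorem norm_window_sub_le {M : ℕ} (hM : 0 < M) (t : ℕ) :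
    ‖window M (t + 1) - window M t‖ ≤ (Real.sqrt M)⁻¹ * ((Real.sqrt 2)⁻¹ * (2 * Real.pi / M)) := by
  have h1 : window M (t + 1) - window M t =
      (Real.sqrt M : ℂ)⁻¹ * ((Real.sqrt 2 : ℂ)⁻¹ * (char M t * -(char M 1 - 1))) := by
    rw [window, window, char_add]
    ring
  rw [h1, norm_mul, norm_mul, norm_mul, norm_neg, norm_char, one_mul, norm_inv, norm_inv,
    Complex.norm_real, Complex.norm_real, Real.norm_of_nonneg (Real.sqrt_nonneg _),
    Real.norm_of_nonneg (Real.sqrt_nonneg _)]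
  gcongr
  refine (norm_cexp_sub_one_le _).trans_eq ?_
  rw [Nat.cast_one, mul_one, abs_of_nonneg (by positivity)]

theorem sum_norm_window_sq {M : ℕ} (hM : 2 ≤ M) :
    ∑ t ∈ Finset.range M, ‖window M t‖ ^ 2 = 1 := by
  have hM' : (M : ℝ) ≠ 0 := by positivity
  have h1 : ∀ t, ‖window M t‖ ^ 2 = (M : ℝ)⁻¹ * (1 - (char M t).re) := by
    intro t
    have h3 : ‖1 - char M t‖ ^ 2 = 2 - 2 * (char M t).re := by
      have h4 := norm_char M t
      rw [← Complex.normSq_eq_norm_sq, Complex.normSq_sub, Complex.normSq_eq_norm_sq (char M t), h4]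
      simp
      ring
    rw [window, norm_mul, norm_mul, mul_pow, mul_pow, h3, norm_inv, norm_inv, Complex.norm_real,
      Complex.norm_real, Real.norm_of_nonneg (Real.sqrt_nonneg _),
      Real.norm_of_nonneg (Real.sqrt_nonneg _), inv_pow, inv_pow, Real.sq_sqrt (by positivity),
      Real.sq_sqrt (by positivity)]
    ring
  have h2 : ∑ t ∈ Finset.range M, char M t = 0 := by
    have := sum_char_mul_conj (M := M) (s := 1) (t := 0) (by omega) (by omega)
    simpa [char_zero] using this
  have h3 : ∑ t ∈ Finset.range M, (char M t).re = 0 := by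
    rw [← Complex.re_sum, h2, Complex.zero_re]
  simp only [h1, ← Finset.mul_sum, Finset.sum_sub_distrib, h3]
  simp [hM']

/-- The amplitude of the result `o` in the estimation of a phase `θ`. -/
def phaseAmp (M : ℕ) (θ : ℝ) (o : ℕ) : ℂ :=
  fourier M (fun t => window M t * Complex.exp (t * θ * Complex.I)) o

theorem norm_cexp_nat_mul (t : ℕ) (θ : ℝ) : ‖Complex.exp (t * θ * Complex.I)‖ = 1 := by
  rw [← Complex.ofReal_natCast, ← Complex.ofReal_mul]
  exact Complex.norm_exp_ofReal_mul_I _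

theorem sum_norm_phaseAmp_sq {M : ℕ} (hM : 2 ≤ M) (θ : ℝ) :
    ∑ o ∈ Finset.range M, ‖phaseAmp M θ o‖ ^ 2 = 1 := by
  simp only [phaseAmp]
  rw [sum_norm_fourier_sq (by omega)]
  simp only [norm_mul, norm_cexp_nat_mul, mul_one]
  exact sum_norm_window_sq hM

/-- The mean square error of the cosine of the estimated phase. In Fourier space the
multiplication by `cos(2π o / M)` is the average of the two cyclic shifts, and the shifts almost
preserve the window. -/
theorem sum_phaseAmp_error_sq_le {M : ℕ} (hM : 2 ≤ M) (θ : ℝ) :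
    ∑ o ∈ Finset.range M,
      ‖phaseAmp M θ o‖ ^ 2 * (Real.cos (2 * Real.pi * o / M) - Real.cos θ) ^ 2 ≤
      2 * Real.pi ^ 2 / M ^ 2 := by
  have hM0 : 0 < M := by omega
  obtain ⟨K, rfl⟩ : ∃ K, M = K + 1 := ⟨M - 1, by omega⟩
  set M := K + 1 with hMK
  set E : ℕ → ℂ := fun t => Complex.exp (t * θ * Complex.I) with hE
  set u : ℕ → ℂ := fun t => window M t * E t with hu
  have hu0 : u 0 = 0 := by simp [hu, window_zero]
  have huM : u M = 0 := by simp [hu, window_self hM0]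
  set v : ℕ → ℂ := fun t => if t = 0 then u K else u (t - 1) with hv
  set h : ℕ → ℂ := fun t => (v t + u (t + 1)) / 2 - Real.cos θ * u t with hh
  -- `v` is the cyclic shift of `u`; since `u` vanishes at `0` and at `M`, the shift in the other
  -- direction has no boundary term.
  have hshift1 : ∀ o, fourier M v o = char M o * fourier M u o := by
    intro o
    have h1 : ∑ t ∈ Finset.range M, char M (o * t) * v t =
        char M o * ∑ t ∈ Finset.range M, char M (o * t) * u t := by
      rw [hMK, Finset.sum_range_succ', Finset.sum_range_succ, mul_add, Finset.mul_sum]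
      congr 1
      · refine Finset.sum_congr rfl fun t _ => ?_
        rw [← hMK, Nat.mul_succ, char_add]
        simp [hv]
        ring
      · have : char M (o * M) = 1 := char_mul_self hM0 o
        rw [hMK, Nat.mul_succ, char_add] at this
        simp only [hv, if_true, mul_zero, char_zero, one_mul]
        linear_combination (-u K) * this
    rw [fourier, fourier, h1]
    ring
  have hshift2 : ∀ o, char M o * fourier M (fun t => u (t + 1)) o = fourier M u o := by
    intro o
    have h1 : char M o * ∑ t ∈ Finset.range M, char M (o * t) * u (t + 1) =
        ∑ t ∈ Finset.range M, char M (o * t) * u t := by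
      have h2 : ∑ t ∈ Finset.range (M + 1), char M (o * t) * u t =
          ∑ t ∈ Finset.range M, char M (o * t) * u t := by
        rw [Finset.sum_range_succ, huM, mul_zero, add_zero]
      rw [← h2, Finset.sum_range_succ' (fun t => char M (o * t) * u t) M, hu0, mul_zero, add_zero,
        Finset.mul_sum]
      refine Finset.sum_congr rfl fun t _ => ?_
      rw [Nat.mul_succ, char_add]
      ring
    rw [fourier, fourier, ← h1]
    ring
  have hcos : ∀ o : ℕ, ((Real.cos (2 * Real.pi * o / M) : ℝ) : ℂ) =
      (char M o + (starRingEnd ℂ) (char M o)) / 2 := by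
    intro o
    rw [Complex.add_conj, char, Complex.exp_ofReal_mul_I_re]
    push_cast
    ring
  have hmul : ∀ o : ℕ, ((Real.cos (2 * Real.pi * o / M) - Real.cos θ : ℝ) : ℂ) * fourier M u o =
      fourier M h o := by
    intro o
    have e1 : fourier M h o = (fourier M v o + fourier M (fun t => u (t + 1)) o) / 2 -
        Real.cos θ * fourier M u o := by
      simp only [fourier, hh, mul_sub, mul_add, mul_div_assoc, add_div, Finset.sum_sub_distrib,
        Finset.sum_add_distrib]
      simp only [Finset.mul_sum, Finset.sum_div]
      congr 1
      · congr 1 <;> exact Finset.sum_congr rfl fun t _ => by ring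
      · exact Finset.sum_congr rfl fun t _ => by ring
    rw [e1, hshift1, Complex.ofReal_sub, hcos, ← hshift2 o]
    linear_combination (fourier M (fun t => u (t + 1)) o / 2) * char_mul_conj M o
  have hEc : ∀ t : ℕ, (Real.cos θ : ℂ) * E (t + 1) = (E t + E (t + 2)) / 2 := by
    intro t
    have e1 : E t = E (t + 1) * Complex.exp (-(θ * Complex.I)) := by
      simp only [hE, ← Complex.exp_add]
      congr 1
      push_cast; ring
    have e2 : E (t + 2) = E (t + 1) * Complex.exp (θ * Complex.I) := by
      simp only [hE, ← Complex.exp_add]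
      congr 1
      push_cast; ring
    rw [e1, e2, Complex.ofReal_cos, Complex.cos]
    ring_nf
  set δ : ℝ := (Real.sqrt M)⁻¹ * ((Real.sqrt 2)⁻¹ * (2 * Real.pi / M)) with hδ
  have hEn : ∀ t, ‖E t‖ = 1 := fun t => norm_cexp_nat_mul t θ
  have hw := norm_window_sub_le hM0
  have hb : ∀ t, ‖h t‖ ≤ δ := by
    intro t
    rcases t with _ | t
    · have e1 : h 0 = (-((window M (K + 1) - window M K) * E K) +
          (window M (0 + 1) - window M 0) * E 1) / 2 := by
        rw [show window M (K + 1) = 0 from window_self hM0, window_zero]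
        simp [hh, hv, hu0]
        simp [hu]
      rw [e1, norm_div, Complex.norm_two, div_le_iff₀ (by norm_num)]
      refine (norm_add_le _ _).trans ?_
      rw [norm_neg, norm_mul, norm_mul, hEn, hEn, mul_one, mul_one]
      linarith [hw K, hw 0]
    · have e1 : h (t + 1) = (-((window M (t + 1) - window M t) * E t) +
          (window M (t + 1 + 1) - window M (t + 1)) * E (t + 2)) / 2 := by
        have := hEc t
        simp only [hh, hv, Nat.succ_ne_zero, if_false, Nat.add_sub_cancel, hu]
        linear_combination (-window M (t + 1)) * this
      rw [e1, norm_div, Complex.norm_two, div_le_iff₀ (by norm_num)]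
      refine (norm_add_le _ _).trans ?_
      rw [norm_neg, norm_mul, norm_mul, hEn, hEn, mul_one, mul_one]
      linarith [hw t, hw (t + 1)]
  calc _ = ∑ o ∈ Finset.range M, ‖fourier M h o‖ ^ 2 := by
        refine Finset.sum_congr rfl fun o _ => ?_
        rw [← hmul, norm_mul, mul_pow, Complex.norm_real, Real.norm_eq_abs, sq_abs, mul_comm]
        rfl
    _ = ∑ t ∈ Finset.range M, ‖h t‖ ^ 2 := sum_norm_fourier_sq hM0 h
    _ ≤ ∑ t ∈ Finset.range M, δ ^ 2 := by
        gcongr with t _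
        exact hb t
    _ = 2 * Real.pi ^ 2 / M ^ 2 := by
        have hMr : (M : ℝ) ≠ 0 := by positivity
        rw [Finset.sum_const, Finset.card_range, nsmul_eq_mul, hδ, mul_pow, mul_pow, inv_pow,
          inv_pow, Real.sq_sqrt (by positivity), Real.sq_sqrt (by positivity)]
        field_simp

/-- The probability of the result `o` in the estimation of an amplitude `cos θ`: the walk operator
has the two eigenvalues `exp(±iθ)`, with equal weights. -/
def ampProb (M : ℕ) (θ : ℝ) (o : ℕ) : ℝ := (‖phaseAmp M θ o‖ ^ 2 + ‖phaseAmp M (-θ) o‖ ^ 2) / 2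

theorem ampProb_nonneg (M : ℕ) (θ : ℝ) (o : ℕ) : 0 ≤ ampProb M θ o := by
  unfold ampProb; positivity

theorem sum_ampProb {M : ℕ} (hM : 2 ≤ M) (θ : ℝ) : ∑ o ∈ Finset.range M, ampProb M θ o = 1 := by
  simp only [ampProb]
  rw [← Finset.sum_div, Finset.sum_add_distrib, sum_norm_phaseAmp_sq hM, sum_norm_phaseAmp_sq hM]
  norm_num

/-- The mean error of amplitude estimation. -/
theorem sum_ampProb_error_le {M : ℕ} (hM : 2 ≤ M) (θ : ℝ) :
    ∑ o ∈ Finset.range M, ampProb M θ o * |Real.cos (2 * Real.pi * o / M) - Real.cos θ| ≤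
      5 / M := by
  have hM0 : (0 : ℝ) < M := by positivity
  have h1 : ∑ o ∈ Finset.range M,
      ampProb M θ o * |Real.cos (2 * Real.pi * o / M) - Real.cos θ| ^ 2 ≤ (5 / M) ^ 2 := by
    have e1 := sum_phaseAmp_error_sq_le hM θ
    have e2 := sum_phaseAmp_error_sq_le hM (-θ)
    rw [Real.cos_neg] at e2
    have e3 : ∑ o ∈ Finset.range M,
      ampProb M θ o * |Real.cos (2 * Real.pi * o / M) - Real.cos θ| ^ 2 ≤
        2 * Real.pi ^ 2 / M ^ 2 := by
      simp only [ampProb, sq_abs, div_mul_eq_mul_div, add_mul]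
      rw [← Finset.sum_div, Finset.sum_add_distrib]
      linarith
    refine e3.trans ?_
    rw [div_pow]
    gcongr
    nlinarith [Real.pi_lt_d2, Real.pi_pos]
  refine (sq_le_sq₀ (Finset.sum_nonneg fun o _ =>
    mul_nonneg (ampProb_nonneg _ _ _) (abs_nonneg _)) (by positivity)).1 ?_
  refine le_trans ?_ h1
  have hcs := Finset.sum_mul_sq_le_sq_mul_sq (Finset.range M) (fun o => Real.sqrt (ampProb M θ o))
    (fun o => Real.sqrt (ampProb M θ o) * |Real.cos (2 * Real.pi * o / M) - Real.cos θ|)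
  simp only [mul_pow, Real.sq_sqrt (ampProb_nonneg _ _ _), ← mul_assoc,
    Real.mul_self_sqrt (ampProb_nonneg _ _ _)] at hcs
  rw [sum_ampProb hM, one_mul] at hcs
  exact hcs

/-! ### The walk operator of an amplitude -/

section Walk

variable {n : ℕ} (U : Unitary (Fin n))

/-- The circuit preparing `(|0⟩|0⟩ + ζ|1⟩U|0⟩)/√2`; qubit `0` is the control. -/
def prepCircuit (ζ : Circle) : List (Gate n (Fin (n + 1))) :=
  [phaseHadamard ζ 0, .ctrlU (Function.Embedding.refl _)]

/-- The state `(|0⟩|0⟩ + ζ|1⟩U|0⟩)/√2`. -/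
def prepState (ζ : Circle) : State (Fin (n + 1)) := run U (prepCircuit ζ) (ket (zeros _))

/-- The involution `|b⟩|y⟩ ↦ |¬b⟩|y ⊕ j⟩`. -/
def flipLabel (j : Bits (Fin n)) (y : Bits (Fin (n + 1))) : Bits (Fin (n + 1)) :=
  Fin.cons (!(y 0)) fun i => y i.succ ^^ j i

/-- The operator of the involution `flipLabel j`. In the state `prepState U ζ` its expectation is
the real part of `ζ⟨j|U|0⟩`. -/
def flipOp (j : Bits (Fin n)) (φ : State (Fin (n + 1))) : State (Fin (n + 1)) :=
  fun y => φ (flipLabel j y)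

/-- The reflection `2|0⟩⟨0| - 1`. -/
def reflectZero (φ : State (Fin (n + 1))) : State (Fin (n + 1)) :=
  fun y => if y = zeros _ then φ y else -φ y

/-- The walk operator `(2|G⟩⟨G| - 1) · flipOp j`, where `G = prepState U ζ`. -/
def walk (ζ : Circle) (j : Bits (Fin n)) (φ : State (Fin (n + 1))) : State (Fin (n + 1)) :=
  run U (prepCircuit ζ) (reflectZero (run U (invCircuit (prepCircuit ζ)) (flipOp j φ)))

theorem flipLabel_involutive (j : Bits (Fin n)) : Function.Involutive (flipLabel j) := by
  intro y
  funext i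
  refine Fin.cases ?_ (fun i => ?_) i <;> simp [flipLabel]

theorem flipOp_flipOp (j : Bits (Fin n)) (φ : State (Fin (n + 1))) :
    flipOp j (flipOp j φ) = φ := by
  funext y
  simp only [flipOp, flipLabel_involutive j y]

theorem flipOp_sub_smul (j : Bits (Fin n)) (a : ℂ) (φ ψ : State (Fin (n + 1))) :
    flipOp j (a • φ - ψ) = a • flipOp j φ - flipOp j ψ := rfl

theorem star_flipOp_dotProduct (j : Bits (Fin n)) (φ ψ : State (Fin (n + 1))) :
    star (flipOp j φ) ⬝ᵥ flipOp j ψ = star φ ⬝ᵥ ψ :=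
  Fintype.sum_equiv (flipLabel_involutive j).toPerm _ _ fun _ => rfl

theorem star_ket_dotProduct {ι : Type} [Fintype ι] [DecidableEq ι] (x : Bits ι) (φ : State ι) :
    star (ket x) ⬝ᵥ φ = φ x := by
  simp [dotProduct, ket, Pi.single_apply, apply_ite]

theorem prepState_apply {c : Bits (Fin n) → ℂ} (hU : IsAnalogEncoding U c) (ζ : Circle)
    (b : Bool) (y : Bits (Fin n)) : prepState U ζ (Fin.cons b y) =
      (Real.sqrt 2 : ℂ)⁻¹ * if b = true then ζ * c y else if y = zeros _ then 1 else 0 := by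
  have hc : ∀ y, U.1 y (zeros _) = c y := by
    intro y
    rw [← hU]
    simp [Matrix.mulVec, dotProduct, ket, Pi.single_apply]
  have h1 : ∀ (a : Bool) (z : Bits (Fin n)),
      (phaseHadamard ζ 0 : Gate n (Fin (n + 1))).apply U (ket (zeros _)) (Fin.cons a z) =
        (Real.sqrt 2 : ℂ)⁻¹ * (if a = true then (ζ : ℂ) else 1) *
          if z = zeros _ then 1 else 0 := by
    intro a z
    have hz : ∀ b : Bool, (Fin.cons b z : Bits (Fin (n + 1))) = zeros _ ↔
        b = false ∧ z = zeros _ := by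
      intro b
      rw [← Fin.cons_self_tail (zeros (Fin (n + 1)))]
      exact Fin.cons_inj
    rw [phaseHadamard_apply]
    simp only [Fin.update_cons_zero, ket, Pi.single_apply, hz, Fin.cons_zero]
    simp
  have h2 : prepState U ζ (Fin.cons b y) = ∑ w, controlled U.1 (Fin.cons b y) w *
      (phaseHadamard ζ 0 : Gate n (Fin (n + 1))).apply U (ket (zeros _)) w := by
    change applyOn (Function.Embedding.refl _) _ _ _ = _
    rw [applyOn]
    refine Finset.sum_congr rfl fun w _ => ?_
    congr 2
    exact extend_comp_embedding (Function.Embedding.refl (Fin (n + 1))) w _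
  rw [h2, sum_bits_cons, Fintype.sum_bool]
  simp only [h1, controlled, Fin.cons_zero, Fin.cons_succ]
  cases b
  · simp [Matrix.one_apply]
  · simp [hc]
    ring

theorem star_prepState_dotProduct_self (ζ : Circle) :
    star (prepState U ζ) ⬝ᵥ prepState U ζ = 1 := by
  rw [prepState, star_run_dotProduct, run_invCircuit, star_ket_dotProduct]
  simp [ket]

theorem star_prepState_dotProduct_flipOp {c : Bits (Fin n) → ℂ} (hU : IsAnalogEncoding U c)
    (ζ : Circle) (j : Bits (Fin n)) :
    star (prepState U ζ) ⬝ᵥ flipOp j (prepState U ζ) = ((ζ * c j).re : ℂ) := by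
  have h2 := sqrt_two_inv_mul_self
  have hflip : ∀ (b : Bool) y, flipLabel j (Fin.cons b y) = Fin.cons (!b) fun i => y i ^^ j i := by
    intro b y
    simp [flipLabel]
  have hj : ∀ y : Bits (Fin n), (fun i => y i ^^ j i) = zeros _ ↔ y = j := by
    intro y
    simp only [funext_iff, zeros, bne_eq_false_iff_eq]
  rw [Complex.re_eq_add_conj, map_mul, dotProduct, sum_bits_cons, Fintype.sum_bool]
  simp only [Pi.star_apply, flipOp, hflip, prepState_apply U hU, hj]
  have hz : (fun i => zeros (Fin n) i ^^ j i) = j := by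
    funext i; simp [zeros]
  simp [apply_ite, hz]
  linear_combination ((ζ : ℂ) * c j + (starRingEnd ℂ) ζ * (starRingEnd ℂ) (c j)) * h2

theorem reflectZero_eq (φ : State (Fin (n + 1))) :
    reflectZero φ = (2 * φ (zeros _)) • ket (zeros _) - φ := by
  funext y
  by_cases hy : y = zeros _
  · subst hy
    simp [reflectZero, ket]
    ring
  · simp [reflectZero, ket, hy]

theorem run_sub {ι : Type} (V : List (Gate n ι)) (φ ψ : State ι) :
    run U V (φ - ψ) = run U V φ - run U V ψ := by
  rw [sub_eq_add_neg, run_add, ← neg_one_smul ℂ ψ, run_smul, neg_one_smul, sub_eq_add_neg]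

theorem walk_eq (ζ : Circle) (j : Bits (Fin n)) (φ : State (Fin (n + 1))) :
    walk U ζ j φ =
      (2 * (star (prepState U ζ) ⬝ᵥ flipOp j φ)) • prepState U ζ - flipOp j φ := by
  rw [walk, reflectZero_eq, run_sub, run_smul, run_run_invCircuit, prepState,
    star_run_dotProduct, star_ket_dotProduct]

theorem walk_sub_smul (ζ : Circle) (j : Bits (Fin n)) (a : ℂ) (φ ψ : State (Fin (n + 1))) :
    walk U ζ j (a • φ - ψ) = a • walk U ζ j φ - walk U ζ j ψ := by
  simp only [walk_eq, flipOp_sub_smul, dotProduct_sub, dotProduct_smul, smul_eq_mul]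
  module

theorem walk_smul (ζ : Circle) (j : Bits (Fin n)) (a : ℂ) (φ : State (Fin (n + 1))) :
    walk U ζ j (a • φ) = a • walk U ζ j φ := by
  have h0 : walk U ζ j 0 = 0 := by simpa using walk_sub_smul U ζ j 1 φ φ
  simpa [h0] using walk_sub_smul U ζ j a φ 0

theorem iterate_walk_smul (ζ : Circle) (j : Bits (Fin n)) (k : ℕ) (a : ℂ)
    (φ : State (Fin (n + 1))) : (walk U ζ j)^[k] (a • φ) = a • (walk U ζ j)^[k] φ := by
  induction k with
  | zero => rfl
  | succ k ih => rw [Function.iterate_succ_apply', Function.iterate_succ_apply', ih, walk_smul]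

/-- The recursion of the Chebyshev polynomials: the start vector of the walk sees only the
eigenvalues `exp(±iθ)` with `cos θ = Re (ζ c_j)`. -/
theorem iterate_walk_add_two {c : Bits (Fin n) → ℂ} (hU : IsAnalogEncoding U c) (ζ : Circle)
    (j : Bits (Fin n)) (k : ℕ) :
    (walk U ζ j)^[k + 2] (prepState U ζ) =
      (2 * ((ζ * c j).re : ℂ)) • (walk U ζ j)^[k + 1] (prepState U ζ) -
        (walk U ζ j)^[k] (prepState U ζ) := by
  have hx := star_prepState_dotProduct_flipOp U hU ζ j
  have h1 := star_prepState_dotProduct_self U ζ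
  induction k with
  | zero =>
    have hw : walk U ζ j (prepState U ζ) =
        (2 * ((ζ * c j).re : ℂ)) • prepState U ζ - flipOp j (prepState U ζ) := by
      rw [walk_eq, hx]
    change walk U ζ j (walk U ζ j (prepState U ζ)) = _ • walk U ζ j (prepState U ζ) - prepState U ζ
    rw [walk_eq U ζ j (walk U ζ j _), hw, flipOp_sub_smul, flipOp_flipOp, dotProduct_sub,
      dotProduct_smul, hx, h1, smul_eq_mul]
    module
  | succ k ih =>
    have := congrArg (walk U ζ j) ih
    rw [walk_sub_smul] at this
    simpa only [← Function.iterate_succ_apply'] using this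

theorem star_iterate_walk_dotProduct {c : Bits (Fin n) → ℂ} (hU : IsAnalogEncoding U c)
    (ζ : Circle) (j : Bits (Fin n)) {θ : ℝ} (hθ : Real.cos θ = (ζ * c j).re) (s t : ℕ) :
    star ((walk U ζ j)^[s] (prepState U ζ)) ⬝ᵥ (walk U ζ j)^[t] (prepState U ζ) =
      (Real.cos ((t - s : ℝ) * θ) : ℂ) := by
  have hx := star_prepState_dotProduct_flipOp U hU ζ j
  have h1 := star_prepState_dotProduct_self U ζ
  have hrec := iterate_walk_add_two U hU ζ j
  rw [← hθ] at hx hrec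
  set x := Real.cos θ with hxdef
  set G := prepState U ζ with hG
  set g : ℕ → State (Fin (n + 1)) := fun k => (walk U ζ j)^[k] G with hg
  have hrec' : ∀ k, g (k + 2) = (2 * (x : ℂ)) • g (k + 1) - g k := hrec
  have hx' : star (flipOp j G) ⬝ᵥ G = (x : ℂ) := by
    rw [← star_flipOp_dotProduct j, flipOp_flipOp, hx]
  have hg0 : g 0 = G := rfl
  have hg1 : g 1 = (2 * (x : ℂ)) • G - flipOp j G := by
    change walk U ζ j G = _
    rw [walk_eq, hx]
  have hV : star (flipOp j G) ⬝ᵥ flipOp j G = 1 := by rw [star_flipOp_dotProduct, h1]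
  -- Two steps of either index follow the recursion of the cosines.
  have hcos : ∀ a : ℝ, (Real.cos ((a + 2) * θ) : ℂ) =
      2 * x * Real.cos ((a + 1) * θ) - Real.cos (a * θ) := by
    intro a
    have : Real.cos ((a + 2) * θ) = 2 * x * Real.cos ((a + 1) * θ) - Real.cos (a * θ) := by
      rw [show (a + 2) * θ = (a + 1) * θ + θ by ring, show a * θ = (a + 1) * θ - θ by ring,
        Real.cos_add, Real.cos_sub]
      ring
    rw [this]
    push_cast
    ring
  have hright : ∀ (φ : State (Fin (n + 1))) (b : ℝ),
      star φ ⬝ᵥ g 0 = (Real.cos (b * θ) : ℂ) → star φ ⬝ᵥ g 1 = (Real.cos ((b + 1) * θ) : ℂ) →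
      ∀ t : ℕ, star φ ⬝ᵥ g t = (Real.cos ((b + t) * θ) : ℂ) := by
    intro φ b h0 h1 t
    induction t using Nat.twoStepInduction with
    | zero => rw [h0]; simp
    | one => rw [h1]; simp
    | more t ih0 ih1 =>
      rw [hrec', dotProduct_sub, dotProduct_smul, ih0, ih1, smul_eq_mul]
      have := hcos (b + t)
      push_cast at this ⊢
      rw [show (b : ℂ) + (t + 2) = b + t + 2 by ring, this]
      ring_nf
  have hrow0 : ∀ t : ℕ, star (g 0) ⬝ᵥ g t = (Real.cos ((0 + t) * θ) : ℂ) := by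
    refine hright _ 0 (by rw [hg0, h1]; simp) ?_
    rw [hg0, hg1, dotProduct_sub, dotProduct_smul, h1, hx, smul_eq_mul]
    simp only [zero_add, one_mul]
    rw [← hxdef]
    ring
  have hrow1 : ∀ t : ℕ, star (g 1) ⬝ᵥ g t = (Real.cos ((-1 + t) * θ) : ℂ) := by
    refine hright _ (-1) ?_ ?_
    · rw [hg0, hg1, star_sub, sub_dotProduct, star_smul, smul_dotProduct, h1, hx', smul_eq_mul]
      simp only [neg_one_mul, Real.cos_neg]
      rw [← hxdef]
      simp
      ring
    · rw [hg1, star_sub, sub_dotProduct, star_smul, smul_dotProduct, dotProduct_sub, dotProduct_sub,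
        dotProduct_smul, dotProduct_smul, h1, hx', hx, hV]
      simp
      ring
  have hall : ∀ s : ℕ, ∀ t : ℕ, star (g s) ⬝ᵥ g t = (Real.cos ((t - s : ℝ) * θ) : ℂ) := by
    intro s
    induction s using Nat.twoStepInduction with
    | zero => intro t; rw [hrow0]; simp
    | one => intro t; rw [hrow1]; simp only [Nat.cast_one]; ring_nf
    | more s ih0 ih1 =>
      intro t
      rw [hrec', star_sub, sub_dotProduct, star_smul, smul_dotProduct, ih0, ih1, smul_eq_mul]
      have := hcos ((s : ℝ) - t)
      rw [show ((s : ℝ) - t + 2) * θ = -((t - (s + 2 : ℕ) : ℝ) * θ) by push_cast; ring,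
        show ((s : ℝ) - t + 1) * θ = -((t - (s + 1 : ℕ) : ℝ) * θ) by push_cast; ring,
        show ((s : ℝ) - t) * θ = -((t - s : ℝ) * θ) by ring, Real.cos_neg, Real.cos_neg,
        Real.cos_neg] at this
      rw [this]
      simp
  exact hall s t

theorem sum_norm_sq_eq_of_gram {ι : Type} [Fintype ι] [DecidableEq ι] (g : ℕ → State ι) (θ : ℝ)
    (hg : ∀ s t, star (g s) ⬝ᵥ g t = (Real.cos ((t - s : ℝ) * θ) : ℂ)) (M : ℕ) (b : ℕ → ℂ) :
    ∑ y, ‖∑ k ∈ Finset.range M, b k * g k y‖ ^ 2 =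
      (‖∑ k ∈ Finset.range M, b k * Complex.exp (k * θ * Complex.I)‖ ^ 2 +
        ‖∑ k ∈ Finset.range M, b k * Complex.exp (k * (-θ : ℝ) * Complex.I)‖ ^ 2) / 2 := by
  have hn : ∀ z : ℂ, ((‖z‖ ^ 2 : ℝ) : ℂ) = (starRingEnd ℂ) z * z := fun z => by
    rw [mul_comm, Complex.mul_conj, Complex.normSq_eq_norm_sq]
  have hexp : ∀ θ : ℝ, (‖∑ k ∈ Finset.range M, b k * Complex.exp (k * θ * Complex.I)‖ ^ 2 : ℂ) =
      ∑ s ∈ Finset.range M, ∑ t ∈ Finset.range M, (starRingEnd ℂ) (b s) * b t *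
        Complex.exp (((t - s : ℝ) * θ : ℝ) * Complex.I) := by
    intro θ
    rw [← Complex.ofReal_pow, hn, map_sum, Finset.sum_mul_sum]
    refine Finset.sum_congr rfl fun s _ => Finset.sum_congr rfl fun t _ => ?_
    rw [map_mul, ← Complex.exp_conj]
    have : Complex.exp (((t - s : ℝ) * θ : ℝ) * Complex.I) =
        Complex.exp ((starRingEnd ℂ) (s * θ * Complex.I)) * Complex.exp (t * θ * Complex.I) := by
      rw [← Complex.exp_add]
      congr 1
      simp
      ring
    rw [this]
    ring
  have hl : ((∑ y, ‖∑ k ∈ Finset.range M, b k * g k y‖ ^ 2 : ℝ) : ℂ) =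
      ∑ s ∈ Finset.range M, ∑ t ∈ Finset.range M, (starRingEnd ℂ) (b s) * b t *
        (Real.cos ((t - s : ℝ) * θ) : ℂ) := by
    rw [Complex.ofReal_sum]
    simp only [hn, map_sum, Finset.sum_mul_sum]
    rw [Finset.sum_comm]
    refine Finset.sum_congr rfl fun s _ => ?_
    rw [Finset.sum_comm]
    refine Finset.sum_congr rfl fun t _ => ?_
    rw [← hg, dotProduct, Finset.mul_sum]
    refine Finset.sum_congr rfl fun y _ => ?_
    rw [map_mul]
    simp only [Pi.star_apply, RCLike.star_def]
    ring
  have : ((∑ y, ‖∑ k ∈ Finset.range M, b k * g k y‖ ^ 2 : ℝ) : ℂ) =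
      (((‖∑ k ∈ Finset.range M, b k * Complex.exp (k * θ * Complex.I)‖ ^ 2 +
        ‖∑ k ∈ Finset.range M, b k * Complex.exp (k * (-θ : ℝ) * Complex.I)‖ ^ 2) / 2 : ℝ) : ℂ) := by
    rw [hl, Complex.ofReal_div, Complex.ofReal_add, Complex.ofReal_pow, Complex.ofReal_pow, hexp,
      hexp, ← Finset.sum_add_distrib, Finset.sum_div]
    refine Finset.sum_congr rfl fun s _ => ?_
    rw [← Finset.sum_add_distrib, Finset.sum_div]
    refine Finset.sum_congr rfl fun t _ => ?_
    rw [Complex.ofReal_cos, Complex.cos]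
    push_cast
    ring_nf
  exact_mod_cast this

end Walk

/-! ### The amplitude estimation circuit -/

theorem extend_comp_of_disjoint {κ κ' ι : Type} (e : κ ↪ ι) (g : κ' → ι) (h : ∀ i j, e i ≠ g j)
    (y : Bits κ) (x : Bits ι) : Function.extend e y x ∘ g = x ∘ g := by
  funext j
  exact Function.extend_apply' _ _ _ fun ⟨i, hi⟩ => h i j hi

theorem run_compile {ι : Type} {n : ℕ} (U : Unitary (Fin n)) (P : List (ClInstr ι))
    (ψ : State ι) (x : Bits ι) : run U (compile P) ψ x = ψ (exec P.reverse x) := by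
  induction P generalizing ψ x with
  | nil => rfl
  | cons i P ih =>
    rw [compile, List.flatMap_cons, run_append, ClInstr.run_gates, List.reverse_cons, exec_append]
    exact ih _ x

theorem exec_andChain_of_ne {ι : Type} (k : ℕ) (c : ι) (y an : Fin k → ι) (x : Bits ι) (w : ι)
    (hw : ∀ i, w ≠ an i) : exec (andChain k c y an) x w = x w := by
  classical
  induction k generalizing c x with
  | zero => rfl
  | succ k ih =>
    rw [andChain, exec_cons, ih (an 0) (Fin.tail y) (Fin.tail an) _ fun i => hw i.succ, ClInstr.act]
    split_ifs
    · exact Function.update_of_ne (hw 0) _ _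
    · rfl

section Block

/-- The ancilla qubits of amplitude estimation with `m` bits: the time register, the walk register
and the work qubits of the reflection. -/
abbrev EstReg (n m : ℕ) : Type := Fin m ⊕ (Fin (n + 1) ⊕ Fin (n + 1))

variable {n m : ℕ}

/-- The data qubits. -/
def dataWire (i : Fin n) : Fin n ⊕ EstReg n m := .inl i

/-- The time register. -/
def timeWire : Fin m ↪ Fin n ⊕ EstReg n m := ⟨fun i => .inr (.inl i), fun i j h => by simpa using h⟩

/-- The walk register. -/
def walkWire : Fin (n + 1) ↪ Fin n ⊕ EstReg n m :=
  ⟨fun i => .inr (.inr (.inl i)), fun i j h => by simpa using h⟩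

/-- The work qubits of the reflection. -/
def workWire (i : Fin (n + 1)) : Fin n ⊕ EstReg n m := .inr (.inr (.inr i))

/-- The state `|j⟩ ∑_t |t⟩ Ξ_t |0⟩` of data, time, walk and work qubits. -/
def estState (j : Bits (Fin n)) (Ξ : Bits (Fin m) → State (Fin (n + 1))) :
    State (Fin n ⊕ EstReg n m) := fun x =>
  if x ∘ dataWire = j ∧ x ∘ workWire = zeros _ then Ξ (x ∘ timeWire) (x ∘ walkWire) else 0

variable (U : Unitary (Fin n))

theorem run_lift_walkWire (V : List (Gate n (Fin (n + 1)))) (j : Bits (Fin n))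
    (Ξ : Bits (Fin m) → State (Fin (n + 1))) :
    run U (liftCircuit walkWire V) (estState j Ξ) = estState j fun t => run U V (Ξ t) := by
  funext x
  rw [run_lift_apply]
  have : slice walkWire x (estState j Ξ) =
      if x ∘ dataWire = j ∧ x ∘ workWire = zeros _ then Ξ (x ∘ timeWire) else 0 := by
    funext y
    simp only [slice, estState]
    rw [extend_comp_of_disjoint _ dataWire (by intro i j h; cases h),
      extend_comp_of_disjoint _ workWire (by intro i j h; cases h),
      extend_comp_of_disjoint _ timeWire (by intro i j h; cases h), extend_comp_embedding]
    split_ifs <;> rfl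
  rw [this, estState]
  split_ifs
  · rfl
  · rw [run_zero]; rfl

theorem run_lift_timeWire (V : List (Gate n (Fin m))) (j : Bits (Fin n))
    (Ξ : Bits (Fin m) → State (Fin (n + 1))) :
    run U (liftCircuit timeWire V) (estState j Ξ) =
      estState j fun t y => run U V (fun t' => Ξ t' y) t := by
  funext x
  rw [run_lift_apply]
  have : slice timeWire x (estState j Ξ) =
      if x ∘ dataWire = j ∧ x ∘ workWire = zeros _ then (fun t' => Ξ t' (x ∘ walkWire)) else 0 := by
    funext y
    simp only [slice, estState]
    rw [extend_comp_of_disjoint _ dataWire (by intro i j h; cases h),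
      extend_comp_of_disjoint _ workWire (by intro i j h; cases h),
      extend_comp_of_disjoint _ walkWire (by intro i j h; cases h), extend_comp_embedding]
    split_ifs <;> rfl
  rw [this, estState]
  split_ifs
  · rfl
  · rw [run_zero]; rfl

/-- The program applying `flipLabel` to the walk register, with the data as `j`, if the time qubit
`i` is set. -/
def flipProg (i : Fin m) : List (ClInstr (Fin n ⊕ EstReg n m)) :=
  (List.finRange n).map (fun l =>
    .xor2 (timeWire i) (dataWire l) (walkWire l.succ) fun a b => a && b) ++
  [.xor1 (timeWire i) (walkWire 0) id]

theorem exec_map_flip (i : Fin m) (l : List (Fin n)) (hl : l.Nodup)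
    (x : Bits (Fin n ⊕ EstReg n m)) :
    (∀ a, exec (l.map fun l =>
      ClInstr.xor2 (timeWire i) (dataWire l) (walkWire l.succ) fun a b => a && b) x
        (walkWire a.succ) =
      (x (walkWire a.succ) ^^ (decide (a ∈ l) && (x (timeWire i) && x (dataWire a))))) ∧
    ∀ w, (∀ a : Fin n, w ≠ walkWire a.succ) → exec (l.map fun l =>
      ClInstr.xor2 (timeWire i) (dataWire l) (walkWire l.succ) fun a b => a && b) x w = x w := by
  induction l generalizing x with
  | nil => simp
  | cons b l ih =>
    rw [List.nodup_cons] at hl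
    simp only [List.map_cons, exec_cons]
    rw [act_xor2 (by intro h; cases h) (by intro h; cases h) (by intro h; cases h)]
    set x' := Function.update x (walkWire b.succ)
      (x (walkWire b.succ) ^^ (x (timeWire i) && x (dataWire b))) with hx'
    obtain ⟨h1, h2⟩ := ih hl.2 x'
    have ht : x' (timeWire i) = x (timeWire i) := Function.update_of_ne (by intro h; cases h) _ _
    have hd : ∀ a, x' (dataWire a) = x (dataWire a) := fun a =>
      Function.update_of_ne (by intro h; cases h) _ _
    refine ⟨fun a => ?_, fun w hw => ?_⟩
    · rw [h1, ht, hd]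
      by_cases hab : a = b
      · subst hab
        simp [hx', hl.1]
      · have hne : (walkWire a.succ : Fin n ⊕ EstReg n m) ≠ walkWire b.succ := by
          intro h
          exact hab (Fin.succ_injective _ (walkWire.injective h))
        rw [hx', Function.update_of_ne hne]
        simp [hab]
    · rw [h2 w hw, hx', Function.update_of_ne (hw b)]

theorem run_flipProg (i : Fin m) (j : Bits (Fin n)) (Ξ : Bits (Fin m) → State (Fin (n + 1))) :
    run U (compile (flipProg i)) (estState j Ξ) =
      estState j fun t => if t i = true then flipOp j (Ξ t) else Ξ t := by
  funext x
  rw [run_compile, flipProg, List.reverse_append, ← List.map_reverse, exec_append]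
  simp only [List.reverse_singleton, exec_cons, exec_nil]
  rw [act_xor1 (by intro h; cases h)]
  set x' := Function.update x (walkWire 0) (x (walkWire 0) ^^ id (x (timeWire i))) with hx'
  obtain ⟨h1, h2⟩ := exec_map_flip i (List.finRange n).reverse
    (List.nodup_reverse.2 (List.nodup_finRange n)) x'
  set x'' := exec ((List.finRange n).reverse.map fun l =>
    ClInstr.xor2 (timeWire i) (dataWire l) (walkWire l.succ) fun a b => a && b) x' with hx''
  have hne : ∀ w, (∀ a : Fin (n + 1), w ≠ walkWire a) → x'' w = x w := fun w hw => by
    rw [h2 w fun a => hw _, hx', Function.update_of_ne (hw 0)]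
  have hd : x'' ∘ dataWire = x ∘ dataWire := funext fun a => hne _ fun b h => by cases h
  have hk : x'' ∘ workWire = x ∘ workWire := funext fun a => hne _ fun b h => by cases h
  have ht : x'' ∘ timeWire = x ∘ timeWire := funext fun a => hne _ fun b h => by cases h
  simp only [estState, hd, hk, ht]
  by_cases hj : x ∘ dataWire = j ∧ x ∘ workWire = zeros _
  · rw [if_pos hj, if_pos hj]
    have hy : x'' ∘ walkWire =
        if x (timeWire i) = true then flipLabel j (x ∘ walkWire) else x ∘ walkWire := by
      funext a
      refine Fin.cases ?_ (fun a => ?_) a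
      · rw [Function.comp_apply, h2 _ fun a h => absurd (walkWire.injective h)
          (Fin.succ_ne_zero a).symm, hx', Function.update_self]
        cases x (timeWire i) <;> simp [flipLabel]
      · rw [Function.comp_apply, h1]
        have hne0 : (walkWire a.succ : Fin n ⊕ EstReg n m) ≠ walkWire 0 := fun h =>
          Fin.succ_ne_zero a (walkWire.injective h)
        have e1 : x' (walkWire a.succ) = x (walkWire a.succ) := Function.update_of_ne hne0 _ _
        have e2 : x' (timeWire i) = x (timeWire i) :=
          Function.update_of_ne (by intro h; cases h) _ _
        have e3 : x' (dataWire a) = j a := by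
          rw [← hj.1]
          exact Function.update_of_ne (by intro h; cases h) _ _
        rw [e1, e2, e3]
        cases x (timeWire i) <;> simp [flipLabel]
    rw [hy]
    change _ = (if x (timeWire i) = true then flipOp j (Ξ (x ∘ timeWire)) else Ξ (x ∘ timeWire))
      (x ∘ walkWire)
    split_ifs <;> rfl
  · rw [if_neg hj, if_neg hj]

/-- The reflection `reflectZero` of the walk register, controlled by the time qubit `i`. -/
def reflectCircuit (i : Fin m) : List (Gate n (Fin n ⊕ EstReg n m)) :=
  compile (andChain (n + 1) (timeWire i) walkWire workWire) ++
    diagGate (timeWire i) (workWire (Fin.last n))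
      (fun c a => if (c && !a) = true then Circle.exp Real.pi else 1) ++
    invCircuit (compile (andChain (n + 1) (timeWire i) walkWire workWire))

theorem run_reflectCircuit (i : Fin m) (j : Bits (Fin n))
    (Ξ : Bits (Fin m) → State (Fin (n + 1))) :
    run U (reflectCircuit i) (estState j Ξ) =
      estState j fun t => if t i = true then reflectZero (Ξ t) else Ξ t := by
  rw [reflectCircuit, run_conj_of_ket U _ _ _ (run_diagGate U (by intro h; cases h) _)
    (exec (andChain (n + 1) (timeWire i) walkWire workWire)) _ fun x _ => run_compile_ket U _ x]
  funext x
  simp only [estState]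
  by_cases hj : x ∘ dataWire = j ∧ x ∘ workWire = zeros _
  · rw [if_pos hj, if_pos hj]
    rw [exec_andChain_of_ne (w := timeWire i) _ _ _ _ _ (by intro a h; cases h)]
    have hw := exec_andChain (n + 1) (timeWire i : Fin n ⊕ EstReg n m) walkWire workWire
      (fun a b h => by cases h; rfl) (by intro a b h; cases h) (by intro a h; cases h)
      (by intro a h; cases h) x (fun a => congrFun hj.2 a)
    rw [← Fin.succ_last, Fin.cons_succ] at hw
    rw [hw]
    have hz : (∀ a, x (walkWire a) = false) ↔ x ∘ walkWire = zeros _ := funext_iff.symm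
    change _ = (if x (timeWire i) = true then reflectZero (Ξ (x ∘ timeWire)) else Ξ (x ∘ timeWire))
      (x ∘ walkWire)
    have hdec : decide (∀ a, x (walkWire a) = false) = decide (x ∘ walkWire = zeros _) :=
      decide_eq_decide.2 hz
    rw [hdec]
    cases x (timeWire i)
    · simp
    · by_cases h : x ∘ walkWire = zeros _ <;> simp [reflectZero, h]
  · rw [if_neg hj, if_neg hj, mul_zero]

/-- One step of the walk, controlled by the time qubit `i`. Only the two reflections need the
control: without them the two copies of the preparation circuit cancel. -/
def walkCircuit (ζ : Circle) (i : Fin m) : List (Gate n (Fin n ⊕ EstReg n m)) :=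
  compile (flipProg i) ++ liftCircuit walkWire (invCircuit (prepCircuit ζ)) ++ reflectCircuit i ++
    liftCircuit walkWire (prepCircuit ζ)

theorem run_walkCircuit (ζ : Circle) (i : Fin m) (j : Bits (Fin n))
    (Ξ : Bits (Fin m) → State (Fin (n + 1))) :
    run U (walkCircuit ζ i) (estState j Ξ) =
      estState j fun t => if t i = true then walk U ζ j (Ξ t) else Ξ t := by
  rw [walkCircuit, run_append, run_append, run_append, run_flipProg, run_lift_walkWire,
    run_reflectCircuit, run_lift_walkWire]
  congr 1
  funext t
  split_ifs
  · rfl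
  · rw [run_run_invCircuit]

theorem run_replicate_walkCircuit (ζ : Circle) (i : Fin m) (k : ℕ) (j : Bits (Fin n))
    (Ξ : Bits (Fin m) → State (Fin (n + 1))) :
    run U (List.replicate k (walkCircuit ζ i)).flatten (estState j Ξ) =
      estState j fun t => (walk U ζ j)^[if t i = true then k else 0] (Ξ t) := by
  induction k generalizing Ξ with
  | zero => simp
  | succ k ih =>
    rw [List.replicate_succ, List.flatten_cons, run_append, run_walkCircuit, ih]
    congr 1
    funext t
    split_ifs
    · rw [Function.iterate_succ_apply]
    · rfl

/-- The walk, repeated as often as the time register says. -/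
def walkPowerCircuit (ζ : Circle) : List (Gate n (Fin n ⊕ EstReg n m)) :=
  (List.finRange m).flatMap fun i => (List.replicate (2 ^ (i.rev : ℕ)) (walkCircuit ζ i)).flatten

theorem run_walkPowerCircuit (ζ : Circle) (j : Bits (Fin n))
    (Ξ : Bits (Fin m) → State (Fin (n + 1))) :
    run U (walkPowerCircuit ζ) (estState j Ξ) =
      estState j fun t => (walk U ζ j)^[revVal t] (Ξ t) := by
  have key : ∀ (l : List (Fin m)) (Ξ : Bits (Fin m) → State (Fin (n + 1))),
      run U (l.flatMap fun i =>
        (List.replicate (2 ^ (i.rev : ℕ)) (walkCircuit ζ i)).flatten) (estState j Ξ) =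
      estState j fun t =>
        (walk U ζ j)^[(l.map fun i => if t i = true then 2 ^ (i.rev : ℕ) else 0).sum] (Ξ t) := by
    intro l
    induction l with
    | nil => intro Ξ; rfl
    | cons i l ih =>
      intro Ξ
      rw [List.flatMap_cons, run_append, run_replicate_walkCircuit, ih]
      congr 1
      funext t
      rw [List.map_cons, List.sum_cons, ← Function.iterate_add_apply]
      exact congrArg (fun k => (walk U ζ j)^[k] (Ξ t)) (Nat.add_comm _ _)
  rw [walkPowerCircuit, key]
  congr 1
  funext t
  have : revVal t = ∑ i : Fin m, if t i = true then 2 ^ (i.rev : ℕ) else 0 := by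
    rw [revVal, natVal]
    exact Fintype.sum_equiv Fin.revPerm _ _ fun i => by simp
  rw [this, Fin.sum_univ_def]

/-- Amplitude estimation: with time `t` in a superposition given by the window, apply the `t`-th
power of the walk and take the Fourier transform of the time. The qubit `z` is the least
significant one of the time register. -/
def estCircuit (ζ : Circle) (z : Fin m) : List (Gate n (Fin n ⊕ EstReg n m)) :=
  liftCircuit timeWire ([phaseHadamard (Circle.exp Real.pi) z] ++ qft m) ++
    liftCircuit walkWire (prepCircuit ζ) ++ walkPowerCircuit ζ ++
    liftCircuit timeWire (liftCircuit Fin.revPerm.toEmbedding (qft m))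

theorem inv_sqrt_two_pow (m : ℕ) :
    (Real.sqrt 2 : ℂ)⁻¹ ^ m = (Real.sqrt ((2 ^ m : ℕ) : ℝ) : ℂ)⁻¹ := by
  rw [inv_pow, ← Complex.ofReal_pow, Nat.cast_pow, Nat.cast_ofNat, Real.sqrt_eq_rpow,
    Real.sqrt_eq_rpow, ← Real.rpow_natCast, ← Real.rpow_natCast, ← Real.rpow_mul (by norm_num),
    ← Real.rpow_mul (by norm_num), mul_comm (1 / 2 : ℝ)]

theorem cexp_eq_char (m k : ℕ) :
    Complex.exp (2 * Real.pi * Complex.I * k / 2 ^ m) = char (2 ^ m) k := by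
  rw [char]
  congr 1
  push_cast
  ring

theorem run_window (z : Fin m) (hz : (z : ℕ) = 0) (s : Bits (Fin m)) :
    run U ([phaseHadamard (Circle.exp Real.pi) z] ++ qft m) (ket (zeros _)) s =
      window (2 ^ m) (revVal s) := by
  have h1 : run U [phaseHadamard (Circle.exp Real.pi) z] (ket (zeros (Fin m))) =
      (Real.sqrt 2 : ℂ)⁻¹ • (ket (zeros _) - ket (Function.update (zeros _) z true)) := by
    funext x
    rw [run_cons, run_nil, phaseHadamard_apply]
    simp only [ket, Pi.single_apply, Pi.smul_apply, Pi.sub_apply, smul_eq_mul]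
    have e1 : ∀ b, Function.update x z b = zeros _ ↔
        b = false ∧ ∀ w, w ≠ z → x w = false := by
      intro b
      rw [Function.update_eq_iff]
      exact Iff.rfl
    have e2 : x = zeros _ ↔ x z = false ∧ ∀ w, w ≠ z → x w = false := by
      rw [← e1 (x z), Function.update_eq_self]
    have e3 : x = Function.update (zeros _) z true ↔ x z = true ∧ ∀ w, w ≠ z → x w = false := by
      rw [Function.eq_update_iff]
      exact Iff.rfl
    simp only [e1, e2, e3]
    cases x z
    · simp
    · simp
      split_ifs <;> simp
  have hv0 : natVal (zeros (Fin m)) = 0 := by simp [natVal, zeros]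
  have hv1 : natVal (Function.update (zeros (Fin m)) z true) = 1 := by
    rw [natVal, Finset.sum_eq_single z]
    · simp [hz]
    · intro w _ hw
      simp [Function.update_of_ne hw, zeros]
    · simp
  rw [run_append, h1, run_smul, run_sub]
  simp only [Pi.smul_apply, Pi.sub_apply, run_qft_ket, hv0, hv1, smul_eq_mul, Nat.cast_zero,
    Nat.cast_one, mul_one, mul_zero, zero_div, Complex.exp_zero]
  rw [cexp_eq_char, inv_sqrt_two_pow, window]
  ring

theorem run_lift_rev_qft (φ : State (Fin m)) (o : Bits (Fin m)) :
    run U (liftCircuit Fin.revPerm.toEmbedding (qft m)) φ o =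
      (Real.sqrt ((2 ^ m : ℕ) : ℝ) : ℂ)⁻¹ * ∑ s, char (2 ^ m) (natVal o * revVal s) * φ s := by
  have hext : ∀ y : Bits (Fin m), Function.extend (Fin.revPerm.toEmbedding : Fin m ↪ Fin m) y o =
      y ∘ Fin.rev := by
    intro y
    funext i
    conv_lhs => rw [← Fin.rev_rev i]
    exact (Fin.revPerm.toEmbedding : Fin m ↪ Fin m).injective.extend_apply y o (Fin.rev i)
  have hrr : ∀ y : Bits (Fin m), (y ∘ Fin.rev) ∘ Fin.rev = y := fun y =>
    funext fun i => by simp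
  rw [run_lift_apply, run_eq_sum_ket, Finset.sum_apply, Finset.mul_sum]
  refine Fintype.sum_equiv (Equiv.arrowCongr Fin.revPerm (Equiv.refl Bool)) _ _ fun t => ?_
  have e1 : Equiv.arrowCongr Fin.revPerm (Equiv.refl Bool) t = t ∘ Fin.rev := rfl
  have e2 : revVal (o ∘ (Fin.revPerm.toEmbedding : Fin m ↪ Fin m)) = natVal o := by
    rw [revVal]
    exact congrArg natVal (hrr o)
  rw [e1, Pi.smul_apply, smul_eq_mul, run_qft_ket, e2, slice, hext, revVal, hrr, inv_sqrt_two_pow,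
    ← cexp_eq_char]
  push_cast
  ring

theorem ket_eq_estState (j : Bits (Fin n)) :
    (ket (Sum.elim j (zeros _)) : State (Fin n ⊕ EstReg n m)) =
      estState j fun t => ket (zeros _) t • ket (zeros _) := by
  funext x
  have h : x = Sum.elim j (zeros _) ↔ (x ∘ dataWire = j ∧ x ∘ workWire = zeros _) ∧
      x ∘ timeWire = zeros _ ∧ x ∘ walkWire = zeros _ := by
    constructor
    · rintro rfl
      exact ⟨⟨rfl, rfl⟩, rfl, rfl⟩
    · rintro ⟨⟨h1, h2⟩, h3, h4⟩
      funext w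
      rcases w with w | w | w | w
      · exact congrFun h1 w
      · exact congrFun h3 w
      · exact congrFun h4 w
      · exact congrFun h2 w
  simp only [ket, Pi.single_apply, estState, h, Pi.smul_apply, smul_eq_mul]
  split_ifs <;> simp_all

/-- The walk register after the estimation, for the result `o`. -/
def estVector (ζ : Circle) (j : Bits (Fin n)) (o : Bits (Fin m)) : State (Fin (n + 1)) := fun y =>
  fourier (2 ^ m) (fun k => window (2 ^ m) k * (walk U ζ j)^[k] (prepState U ζ) y) (natVal o)

theorem run_estCircuit (ζ : Circle) (z : Fin m) (hz : (z : ℕ) = 0) (j : Bits (Fin n)) :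
    run U (estCircuit ζ z) (ket (Sum.elim j (zeros _))) = estState j (estVector U ζ j) := by
  rw [ket_eq_estState, estCircuit, run_append, run_append, run_append, run_lift_timeWire]
  have h1 : (fun (t : Bits (Fin m)) (y : Bits (Fin (n + 1))) =>
      run U ([phaseHadamard (Circle.exp Real.pi) z] ++ qft m)
        (fun t' => (ket (zeros _) t' • ket (zeros _) : State (Fin (n + 1))) y) t) =
      fun t => window (2 ^ m) (revVal t) • ket (zeros _) := by
    funext t y
    have : (fun t' : Bits (Fin m) => (ket (zeros _) t' • ket (zeros _) : State (Fin (n + 1))) y) =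
        (ket (zeros _) y : ℂ) • ket (zeros (Fin m)) := by
      funext t'
      simp only [Pi.smul_apply, smul_eq_mul, mul_comm]
    rw [this, run_smul, Pi.smul_apply, run_window U z hz, Pi.smul_apply, smul_eq_mul, smul_eq_mul,
      mul_comm]
  rw [h1, run_lift_walkWire, run_walkPowerCircuit, run_lift_timeWire]
  congr 1
  funext o y
  simp only [run_smul, iterate_walk_smul]
  rw [run_lift_rev_qft, estVector, fourier,
    ← sum_revVal (q := m) fun k => char (2 ^ m) (natVal o * k) *
      (window (2 ^ m) k * (walk U ζ j)^[k] (prepState U ζ) y)]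
  rfl

/-- The result of the estimation has the distribution `ampProb`. -/
theorem sum_norm_estVector_sq {c : Bits (Fin n) → ℂ} (hU : IsAnalogEncoding U c) (ζ : Circle)
    (j : Bits (Fin n)) {θ : ℝ} (hθ : Real.cos θ = (ζ * c j).re) (o : Bits (Fin m)) :
    ∑ y, ‖estVector U ζ j o y‖ ^ 2 = ampProb (2 ^ m) θ (natVal o) := by
  have h := sum_norm_sq_eq_of_gram (fun k => (walk U ζ j)^[k] (prepState U ζ)) θ
    (fun s t => star_iterate_walk_dotProduct U hU ζ j hθ s t) (2 ^ m)
    (fun k => char (2 ^ m) (natVal o * k) * window (2 ^ m) k)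
  simp only [estVector, ampProb, phaseAmp, fourier, norm_mul, mul_pow, ← Finset.mul_sum,
    ← mul_assoc]
  rw [h]
  ring

/-! ### The cost of amplitude estimation -/

theorem oracleCount_walkCircuit (ζ : Circle) (i : Fin m) :
    oracleCount (walkCircuit ζ i : List (Gate n (Fin n ⊕ EstReg n m))) = 2 := by
  have h : oracleCount (prepCircuit ζ : List (Gate n (Fin (n + 1)))) = 1 := by
    simp [oracleCount, prepCircuit, phaseHadamard, Gate.isElem]
  simp only [walkCircuit, reflectCircuit, oracleCount_append, oracleCount_compile,
    oracleCount_lift, oracleCount_inv, oracleCount_diagGate, h]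

theorem elemCount_walkCircuit_le (hn : 1 ≤ n) (ζ : Circle) (i : Fin m) :
    elemCount (walkCircuit ζ i : List (Gate n (Fin n ⊕ EstReg n m))) ≤ 45 * n := by
  have h : elemCount (prepCircuit ζ : List (Gate n (Fin (n + 1)))) = 1 := by
    simp [elemCount, prepCircuit, phaseHadamard, Gate.isElem]
  have h1 := elemCount_compile_le (n := n)
    (andChain (n + 1) (timeWire i : Fin n ⊕ EstReg n m) walkWire workWire)
  have h2 := elemCount_compile_le (n := n) (flipProg i : List (ClInstr (Fin n ⊕ EstReg n m)))
  rw [length_andChain] at h1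
  simp only [flipProg, List.length_append, List.length_map, List.length_finRange,
    List.length_singleton] at h2
  have h3 := elemCount_diagGate_le (n := n) (timeWire i : Fin n ⊕ EstReg n m)
    (workWire (Fin.last n)) (fun c a => if (c && !a) = true then Circle.exp Real.pi else 1)
  simp only [walkCircuit, reflectCircuit, elemCount_append, elemCount_lift, elemCount_inv, h]
  simp only [flipProg] at *
  omega

theorem counts_walkPowerCircuit (hn : 1 ≤ n) (ζ : Circle) :
    oracleCount (walkPowerCircuit ζ : List (Gate n (Fin n ⊕ EstReg n m))) ≤ 2 * 2 ^ m ∧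
    elemCount (walkPowerCircuit ζ : List (Gate n (Fin n ⊕ EstReg n m))) ≤ 45 * n * 2 ^ m := by
  have hrep : ∀ (i : Fin m) k,
      oracleCount (List.replicate k (walkCircuit ζ i : List (Gate n (Fin n ⊕ EstReg n m)))).flatten
        = 2 * k ∧
      elemCount (List.replicate k (walkCircuit ζ i : List (Gate n (Fin n ⊕ EstReg n m)))).flatten
        ≤ 45 * n * k := by
    intro i k
    induction k with
    | zero => simp [oracleCount, elemCount]
    | succ k ih =>
      rw [List.replicate_succ, List.flatten_cons, oracleCount_append, elemCount_append, ih.1,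
        oracleCount_walkCircuit]
      have := elemCount_walkCircuit_le hn ζ i
      exact ⟨by ring, by linarith [ih.2]⟩
  have hl : ∀ l : List (Fin m),
      oracleCount (l.flatMap fun i => (List.replicate (2 ^ (i.rev : ℕ))
        (walkCircuit ζ i : List (Gate n (Fin n ⊕ EstReg n m)))).flatten) =
        2 * (l.map fun i => 2 ^ (i.rev : ℕ)).sum ∧
      elemCount (l.flatMap fun i => (List.replicate (2 ^ (i.rev : ℕ))
        (walkCircuit ζ i : List (Gate n (Fin n ⊕ EstReg n m)))).flatten) ≤
        45 * n * (l.map fun i => 2 ^ (i.rev : ℕ)).sum := by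
    intro l
    induction l with
    | nil => simp [oracleCount, elemCount]
    | cons i l ih =>
      rw [List.flatMap_cons, oracleCount_append, elemCount_append, ih.1, (hrep i _).1,
        List.map_cons, List.sum_cons]
      exact ⟨by ring, by linarith [ih.2, (hrep i (2 ^ (i.rev : ℕ))).2]⟩
  have hsum : ((List.finRange m).map fun i => 2 ^ (i.rev : ℕ)).sum ≤ 2 ^ m := by
    rw [← Fin.sum_univ_def, Fintype.sum_equiv Fin.revPerm
      (fun i : Fin m => 2 ^ (i.rev : ℕ)) (fun i : Fin m => 2 ^ (i : ℕ))
      fun i => rfl, Fin.sum_univ_eq_sum_range (fun i => 2 ^ i), Nat.geomSum_eq le_rfl]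
    simp
  obtain ⟨h1, h2⟩ := hl (List.finRange m)
  exact ⟨h1.trans_le (by omega), h2.trans (by gcongr)⟩

theorem oracleCount_estCircuit_le (hn : 1 ≤ n) (ζ : Circle) (z : Fin m) :
    oracleCount (estCircuit ζ z : List (Gate n (Fin n ⊕ EstReg n m))) ≤ 3 * 2 ^ m := by
  have h : oracleCount (prepCircuit ζ : List (Gate n (Fin (n + 1)))) = 1 := by
    simp [oracleCount, prepCircuit, phaseHadamard, Gate.isElem]
  have h0 : oracleCount [(phaseHadamard (Circle.exp Real.pi) z : Gate n (Fin m))] = 0 := by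
    simp [oracleCount, phaseHadamard, Gate.isElem]
  have h1 := (counts_walkPowerCircuit (m := m) hn ζ).1
  have h2 : 1 ≤ 2 ^ m := Nat.one_le_two_pow
  simp only [estCircuit, oracleCount_append, oracleCount_lift, oracleCount_qft, h, h0]
  omega

theorem elemCount_estCircuit_le (hn : 1 ≤ n) (ζ : Circle) (z : Fin m) :
    elemCount (estCircuit ζ z : List (Gate n (Fin n ⊕ EstReg n m))) ≤
      45 * n * 2 ^ m + 2 * m ^ 2 + 2 := by
  have h : elemCount (prepCircuit ζ : List (Gate n (Fin (n + 1)))) = 1 := by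
    simp [elemCount, prepCircuit, phaseHadamard, Gate.isElem]
  have h0 : elemCount [(phaseHadamard (Circle.exp Real.pi) z : Gate n (Fin m))] = 1 := by
    simp [elemCount, phaseHadamard, Gate.isElem]
  have h1 := (counts_walkPowerCircuit (m := m) hn ζ).2
  have h2 := elemCount_qft_le (n := n) m
  simp only [estCircuit, elemCount_append, elemCount_lift, h, h0]
  omega

end Block

/-! ### The whole circuit -/

/-- The register of the function circuit: two arguments, the result and `a` work qubits. -/
abbrev FunReg (m a : ℕ) : Type := Fin (m + 1) ⊕ Fin (m + 1) ⊕ Fin (m + 1) ⊕ Fin a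

/-- The work qubits of a table lookup: the control, the qubits of the unary iteration, and the
one-hot qubits, indexed by the possible results. -/
abbrev TableReg (m : ℕ) : Type := Unit ⊕ Fin m ⊕ Bits (Fin (m + 1))

/-- The qubits that are still zero after the estimation of real and imaginary part: the register
of the function circuit, the qubits of the random bit, and those of the two table lookups. -/
abbrev RestReg (m a : ℕ) : Type := FunReg m a ⊕ Fin (m + 2) ⊕ TableReg m ⊕ TableReg m

instance (m : ℕ) : DecidableEq (TableReg m) := inferInstance

instance (m a : ℕ) : DecidableEq (RestReg m a) := inferInstance

instance (m a : ℕ) : Fintype (RestReg m a) := inferInstance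

/-- All ancilla qubits: two estimation registers, random bits, and the rest. -/
abbrev AncReg (n m a : ℕ) : Type := EstReg n m ⊕ EstReg n m ⊕ Fin (m + 1) ⊕ RestReg m a

instance (n m a : ℕ) : DecidableEq (AncReg n m a) := inferInstance

instance (n m a : ℕ) : Fintype (Bits (Fin n ⊕ AncReg n m a)) := inferInstance

section Full

variable {n m a : ℕ}

/-- Data and ancilla qubits of the estimation of the real part. -/
def reEmb : Fin n ⊕ EstReg n m ↪ Fin n ⊕ AncReg n m a :=
  ⟨Sum.map id .inl, Function.injective_id.sumMap Sum.inl_injective⟩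

/-- Data and ancilla qubits of the estimation of the imaginary part. -/
def imEmb : Fin n ⊕ EstReg n m ↪ Fin n ⊕ AncReg n m a :=
  ⟨Sum.map id (.inr ∘ .inl), Function.injective_id.sumMap
    (Sum.inr_injective.comp Sum.inl_injective)⟩

/-- The random bits. -/
def coinWire : Fin (m + 1) ↪ Fin n ⊕ AncReg n m a :=
  ⟨fun i => .inr (.inr (.inr (.inl i))), fun i j h => by simpa using h⟩

/-- The qubits not touched by the estimation. -/
def restWire : RestReg m a ↪ Fin n ⊕ AncReg n m a :=
  ⟨fun i => .inr (.inr (.inr (.inr i))), fun i j h => by simpa using h⟩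

/-- The register of the function circuit. -/
def funEmb : FunReg m a ↪ Fin n ⊕ AncReg n m a :=
  ⟨fun i => restWire (.inl i), restWire.injective.comp Sum.inl_injective⟩

/-- The qubits in which the random bit is computed. -/
def bitWire (i : Fin (m + 2)) : Fin n ⊕ AncReg n m a := restWire (.inr (.inl i))

/-- The phase that turns the imaginary part into a real part. -/
def negI : Circle := Circle.exp (-(Real.pi / 2))

theorem negI_mul_re (z : ℂ) : ((negI : ℂ) * z).re = z.im := by
  have : (negI : ℂ) = -Complex.I := by
    rw [negI, Circle.coe_exp]
    push_cast
    rw [neg_mul, Complex.exp_neg, Complex.exp_pi_div_two_mul_I, Complex.inv_I]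
  simp [this]

/-- Estimation of real and imaginary part, and random bits. -/
def samplingCircuit (z : Fin m) : List (Gate n (Fin n ⊕ AncReg n m a)) :=
  liftCircuit reEmb (estCircuit 1 z) ++ liftCircuit imEmb (estCircuit negI z) ++
    liftCircuit coinWire (qft (m + 1))

variable (U : Unitary (Fin n))

/-- The state `samplingCircuit` produces from `|j⟩|0⟩`. -/
def sampleState (j : Bits (Fin n)) : State (Fin n ⊕ AncReg n m a) := fun x =>
  (Real.sqrt 2 : ℂ)⁻¹ ^ (m + 1) *
    (estState j (estVector U 1 j) (x ∘ reEmb) * (estState j (estVector U negI j) (x ∘ imEmb) *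
      if x ∘ restWire = zeros _ then 1 else 0))

/-- The label `|j⟩|0⟩`. -/
def dataLabel {κ : Type} (j : Bits (Fin n)) : Bits (Fin n ⊕ κ) := Sum.elim j (zeros κ)

theorem eq_dataLabel_iff (j : Bits (Fin n)) (x : Bits (Fin n ⊕ AncReg n m a)) :
    x = dataLabel j ↔ x ∘ Sum.inl = j ∧ (fun i => x (.inr (.inl i))) = zeros (EstReg n m) ∧
      (fun i => x (.inr (.inr (.inl i)))) = zeros (EstReg n m) ∧ x ∘ coinWire = zeros _ ∧
      x ∘ restWire = zeros _ := by
  constructor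
  · rintro rfl
    exact ⟨rfl, rfl, rfl, rfl, rfl⟩
  · rintro ⟨h0, h1, h2, h3, h4⟩
    funext w
    rcases w with w | w | w | w | w
    · exact congrFun h0 w
    · exact congrFun h1 w
    · exact congrFun h2 w
    · exact congrFun h3 w
    · exact congrFun h4 w

theorem ket_comp_estEmb (j : Bits (Fin n)) (y : Bits (Fin n ⊕ EstReg n m)) :
    (ket (Sum.elim j (zeros _)) : State (Fin n ⊕ EstReg n m)) y =
      if y ∘ Sum.inl = j ∧ y ∘ Sum.inr = zeros _ then 1 else 0 := by
  have : y = Sum.elim j (zeros _) ↔ y ∘ Sum.inl = j ∧ y ∘ Sum.inr = zeros _ := by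
    constructor
    · rintro rfl
      exact ⟨rfl, rfl⟩
    · rintro ⟨h0, h1⟩
      rw [← h0, ← h1, Sum.elim_comp_inl_inr]
  simp only [ket, Pi.single_apply, this]

theorem estState_eq_zero (j : Bits (Fin n)) (Ξ : Bits (Fin m) → State (Fin (n + 1)))
    (y : Bits (Fin n ⊕ EstReg n m)) (h : y ∘ Sum.inl ≠ j) : estState j Ξ y = 0 := by
  rw [estState, if_neg]
  rintro ⟨h1, -⟩
  exact h h1

theorem run_samplingCircuit (z : Fin m) (hz : (z : ℕ) = 0) (j : Bits (Fin n)) :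
    run U (samplingCircuit z) (ket (dataLabel j) : State (Fin n ⊕ AncReg n m a)) =
      sampleState U j := by
  set φ₁ := estState j (estVector (m := m) U 1 j)
  set φ₂ := estState j (estVector (m := m) U negI j)
  have e1 : (ket (dataLabel j) : State (Fin n ⊕ AncReg n m a)) =
      fun x => ket (Sum.elim j (zeros _)) (x ∘ reEmb) *
        if (fun i => x (.inr (.inr (.inl i)))) = zeros (EstReg n m) ∧ x ∘ coinWire = zeros _ ∧
          x ∘ restWire = zeros _ then 1 else 0 := by
    funext x
    rw [ket_comp_estEmb]
    simp only [ket, Pi.single_apply, eq_dataLabel_iff]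
    rw [ite_zero_mul_ite_zero, one_mul]
    exact if_congr and_assoc.symm rfl rfl
  rw [samplingCircuit, run_append, run_append, e1, run_lift_mul, run_estCircuit U 1 z hz]
  swap
  · intro x y
    rw [extend_comp_of_disjoint _ coinWire (by rintro (i | i) j h <;> cases h),
      extend_comp_of_disjoint _ restWire (by rintro (i | i) j h <;> cases h)]
    have := extend_comp_of_disjoint (reEmb (a := a)) (fun i => .inr (.inr (.inl i)) :
      EstReg n m → Fin n ⊕ AncReg n m a) (by rintro (i | i) j h <;> cases h) y x
    rw [show (fun i => Function.extend reEmb y x (Sum.inr (Sum.inr (Sum.inl i)))) =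
      fun i => x (.inr (.inr (.inl i))) from this]
  have e2 : (fun x : Bits (Fin n ⊕ AncReg n m a) => φ₁ (x ∘ reEmb) *
        if (fun i => x (.inr (.inr (.inl i)))) = zeros (EstReg n m) ∧ x ∘ coinWire = zeros _ ∧
          x ∘ restWire = zeros _ then (1 : ℂ) else 0) =
      fun x => ket (Sum.elim j (zeros _)) (x ∘ imEmb) *
        (φ₁ (Sum.elim j fun i => x (.inr (.inl i))) * if x ∘ coinWire = zeros _ ∧
          x ∘ restWire = zeros _ then 1 else 0) := by
    funext x
    rw [ket_comp_estEmb]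
    by_cases hj : x ∘ Sum.inl = j
    · have hx : x ∘ (reEmb (a := a)) = Sum.elim j fun i => x (.inr (.inl i)) := by
        funext w
        rcases w with w | w
        · exact congrFun hj w
        · rfl
      have h1 : (x ∘ (imEmb (a := a))) ∘ Sum.inl = j := hj
      rw [hx, ite_and]
      by_cases h2 : (fun i => x (.inr (.inr (.inl i)))) = zeros (EstReg n m)
      · have h2' : (x ∘ (imEmb (a := a))) ∘ Sum.inr = zeros _ := h2
        have h4 : (if (x ∘ (imEmb (a := a))) ∘ Sum.inl = j ∧ (x ∘ (imEmb (a := a))) ∘ Sum.inr =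
          zeros _ then (1 : ℂ) else 0) = 1 := if_pos ⟨h1, h2'⟩
        rw [if_pos h2, h4, one_mul]
      · have h2' : (x ∘ (imEmb (a := a))) ∘ Sum.inr ≠ zeros _ := h2
        rw [if_neg h2, if_neg fun h => h2' h.2, zero_mul, mul_zero]
    · have h1 : (x ∘ (imEmb (a := a))) ∘ Sum.inl ≠ j := hj
      have h3 : φ₁ (x ∘ reEmb) = 0 := estState_eq_zero _ _ _ hj
      rw [h3, zero_mul]
      rw [if_neg fun h => h1 h.1, zero_mul]
  rw [e2, run_lift_mul, run_estCircuit U negI z hz]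
  swap
  · intro x y
    rw [extend_comp_of_disjoint _ coinWire (by rintro (i | i) j h <;> cases h),
      extend_comp_of_disjoint _ restWire (by rintro (i | i) j h <;> cases h)]
    have := extend_comp_of_disjoint (imEmb (a := a)) (fun i => .inr (.inl i) :
      EstReg n m → Fin n ⊕ AncReg n m a) (by rintro (i | i) j h <;> cases h) y x
    rw [show (fun i => Function.extend imEmb y x (Sum.inr (Sum.inl i))) =
      fun i => x (.inr (.inl i)) from this]
  have e3 : (fun x : Bits (Fin n ⊕ AncReg n m a) => φ₂ (x ∘ imEmb) *
        (φ₁ (Sum.elim j fun i => x (.inr (.inl i))) * if x ∘ coinWire = zeros _ ∧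
          x ∘ restWire = zeros _ then (1 : ℂ) else 0)) =
      fun x => ket (zeros _) (x ∘ coinWire) * (φ₁ (x ∘ reEmb) * (φ₂ (x ∘ imEmb) *
        if x ∘ restWire = zeros _ then 1 else 0)) := by
    funext x
    by_cases hj : x ∘ Sum.inl = j
    · have hx : x ∘ (reEmb (a := a)) = Sum.elim j fun i => x (.inr (.inl i)) := by
        funext w
        rcases w with w | w
        · exact congrFun hj w
        · rfl
      rw [hx]
      simp only [ket, Pi.single_apply, ite_and]
      split_ifs <;> ring
    · have h3 : φ₁ (x ∘ reEmb) = 0 := estState_eq_zero _ _ _ hj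
      have h4 : φ₂ (x ∘ imEmb) = 0 := estState_eq_zero _ _ _ hj
      rw [h3, h4]
      ring
  rw [e3, run_lift_mul]
  · funext x
    have hv0 : natVal (zeros (Fin (m + 1))) = 0 := by simp [natVal, zeros]
    rw [run_qft_ket, hv0, sampleState]
    simp
    ring
  · intro x y
    rw [extend_comp_of_disjoint _ restWire (by intro i j h; cases h),
      extend_comp_of_disjoint _ reEmb (by rintro i (j | j) h <;> cases h),
      extend_comp_of_disjoint _ imEmb (by rintro i (j | j) h <;> cases h)]

/-- The classical part: look up the fixed-point arguments for the two estimates, compute the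
function, and draw a random bit with the bias given by its value. -/
def evalCircuit (T : Bits (Fin m) → Bits (Fin (m + 1))) (F : List (ElemGate (FunReg m a))) :
    List (Gate n (Fin n ⊕ AncReg n m a)) :=
  compile (tableProg T (restWire (.inr (.inr (.inl (.inl ()))))) (fun i => reEmb (timeWire i))
      (fun i => restWire (.inr (.inr (.inl (.inr (.inl i))))))
      (fun v => restWire (.inr (.inr (.inl (.inr (.inr v)))))) (fun i => funEmb (.inl i)) ++
    tableProg T (restWire (.inr (.inr (.inr (.inl ()))))) (fun i => imEmb (timeWire i))
      (fun i => restWire (.inr (.inr (.inr (.inr (.inl i))))))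
      (fun v => restWire (.inr (.inr (.inr (.inr (.inr v))))))
      (fun i => funEmb (.inr (.inl i)))) ++
  liftCircuit funEmb (F.map Gate.elem) ++
  compile (biasedProg (fun i => funEmb (.inr (.inr (.inl i)))) coinWire bitWire)

theorem run_evalCircuit (T : Bits (Fin m) → Bits (Fin (m + 1)))
    (F : List (ElemGate (FunReg m a))) (r : Bits (Fin (m + 1)) → Bits (Fin (m + 1)) →
      Bits (Fin (m + 1)))
    (hF : ∀ x y, runElem F (ket (fourRegs a x y (zeros _))) = ket (fourRegs a x y (r x y)))
    (x : Bits (Fin n ⊕ AncReg n m a)) (hx : x ∘ restWire = zeros _) :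
    ∃ x', run U (evalCircuit T F) (ket x) = ket x' ∧ x' (bitWire 0) =
      biasedBit (r (T fun i => x (reEmb (timeWire i))) (T fun i => x (imEmb (timeWire i))))
        (x ∘ coinWire) := by
  have hx0 : ∀ w, x (restWire w) = false := fun w => congrFun hx w
  set p1 := tableProg T (restWire (.inr (.inr (.inl (.inl ()))))) (fun i => reEmb (timeWire i))
      (fun i => restWire (.inr (.inr (.inl (.inr (.inl i))))))
      (fun v => restWire (.inr (.inr (.inl (.inr (.inr v)))))) (fun i => funEmb (.inl i)) with hp1
  set p2 := tableProg T (restWire (.inr (.inr (.inr (.inl ()))))) (fun i => imEmb (timeWire i))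
      (fun i => restWire (.inr (.inr (.inr (.inr (.inl i))))))
      (fun v => restWire (.inr (.inr (.inr (.inr (.inr v))))))
      (fun i => funEmb (.inr (.inl i))) with hp2
  obtain ⟨h1, h1'⟩ := exec_tableProg T (restWire (.inr (.inr (.inl (.inl ())))))
    (fun i => (reEmb (timeWire i) : Fin n ⊕ AncReg n m a))
    (fun i => restWire (.inr (.inr (.inl (.inr (.inl i))))))
    (fun v => restWire (.inr (.inr (.inl (.inr (.inr v)))))) (fun i => funEmb (.inl i))
    (by intro i j h; cases h; rfl) (by intro i j h; cases h; rfl) (by intro i j h; cases h; rfl)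
    (by intro i h; cases h) (by intro i h; cases h) (by intro i h; cases h)
    (by intro i h; cases h) (by intro i j h; cases h) (by intro i j h; cases h)
    (by intro i j h; cases h) (by intro i j h; cases h) x (hx0 _) (fun i => hx0 _)
    (fun i => hx0 _) (fun i => hx0 _)
  rw [← hp1] at h1 h1'
  set x1 := exec p1 x
  obtain ⟨h2, h2'⟩ := exec_tableProg T (restWire (.inr (.inr (.inr (.inl ())))))
    (fun i => (imEmb (timeWire i) : Fin n ⊕ AncReg n m a))
    (fun i => restWire (.inr (.inr (.inr (.inr (.inl i))))))
    (fun v => restWire (.inr (.inr (.inr (.inr (.inr v)))))) (fun i => funEmb (.inr (.inl i)))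
    (by intro i j h; cases h; rfl) (by intro i j h; cases h; rfl) (by intro i j h; cases h; rfl)
    (by intro i h; cases h) (by intro i h; cases h) (by intro i h; cases h)
    (by intro i h; cases h) (by intro i j h; cases h) (by intro i j h; cases h)
    (by intro i j h; cases h) (by intro i j h; cases h) x1
    ((h1' _ (by intro h; cases h) (by intro i h; cases h) (by intro i h; cases h)).trans (hx0 _))
    (fun i =>
      (h1' _ (by intro h; cases h) (by intro i h; cases h) (by intro i h; cases h)).trans (hx0 _))
    (fun i =>
      (h1' _ (by intro h; cases h) (by intro i h; cases h) (by intro i h; cases h)).trans (hx0 _))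
    (fun i =>
      (h1' _ (by intro h; cases h) (by intro i h; cases h) (by intro i h; cases h)).trans (hx0 _))
  rw [← hp2] at h2 h2'
  have hx2 : exec (p1 ++ p2) x = exec p2 x1 := exec_append _ _ _
  set x2 := exec p2 x1
  set X := T fun i => x (reEmb (timeWire i)) with hX
  set Y := T fun i => x (imEmb (timeWire i)) with hY
  have hfun : x2 ∘ funEmb = fourRegs a X Y (zeros _) := by
    funext w
    rcases w with w | w | w | w
    · rw [Function.comp_apply,
        h2' _ (by intro h; cases h) (by intro i h; cases h) (by intro i h; cases h), h1]
      rfl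
    · rw [Function.comp_apply, h2]
      have : x1 ∘ (fun i => (imEmb (timeWire i) : Fin n ⊕ AncReg n m a)) =
          fun i => x (imEmb (timeWire i)) := funext fun i =>
        h1' _ (by intro h; cases h) (by intro i h; cases h) (by intro i h; cases h)
      rw [this]
      rfl
    · rw [Function.comp_apply,
        h2' _ (by intro h; cases h) (by intro i h; cases h) (by intro i h; cases h),
        h1' _ (by intro h; cases h) (by intro i h; cases h) (by intro i h; cases h)]
      exact hx0 _
    · rw [Function.comp_apply,
        h2' _ (by intro h; cases h) (by intro i h; cases h) (by intro i h; cases h),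
        h1' _ (by intro h; cases h) (by intro i h; cases h) (by intro i h; cases h)]
      exact hx0 _
  set x3 := Function.extend funEmb (fourRegs a X Y (r X Y)) x2 with hx3
  have hrun3 : run U (liftCircuit funEmb (F.map Gate.elem)) (ket x2) = ket x3 :=
    run_lift_ket U funEmb _ x2 _ (by rw [hfun, run_map_elem, hF])
  refine ⟨exec (biasedProg (fun i => funEmb (.inr (.inr (.inl i)))) coinWire bitWire) x3, ?_, ?_⟩
  · rw [evalCircuit, run_append, run_append, run_compile_ket, hx2, hrun3, run_compile_ket]
  · have hr3 : x3 ∘ (fun i => funEmb (.inr (.inr (.inl i)))) = r X Y := by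
      funext i
      exact funEmb.injective.extend_apply (fourRegs a X Y (r X Y)) x2 (.inr (.inr (.inl i)))
    have hc3 : x3 ∘ coinWire = x ∘ coinWire := by
      rw [hx3, extend_comp_of_disjoint _ coinWire (by intro i j h; cases h)]
      funext i
      rw [Function.comp_apply,
        h2' _ (by intro h; cases h) (by intro i h; cases h) (by intro i h; cases h),
        h1' _ (by intro h; cases h) (by intro i h; cases h) (by intro i h; cases h)]
      rfl
    have hb3 : ∀ i, x3 (bitWire i) = false := by
      intro i
      have : x3 ∘ bitWire = x2 ∘ bitWire := by
        rw [hx3, extend_comp_of_disjoint _ bitWire (by intro i j h; cases h)]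
      rw [show x3 (bitWire i) = x2 (bitWire i) from congrFun this i,
        h2' _ (by intro h; cases h) (by intro i h; cases h) (by intro i h; cases h),
        h1' _ (by intro h; cases h) (by intro i h; cases h) (by intro i h; cases h)]
      exact hx0 _
    rw [exec_biasedProg _ _ _ (by intro i j h; cases h; rfl) (by intro i j h; cases h)
      (by intro i j h; cases h) (by intro i j h; cases h) x3 hb3, hr3, hc3]

/-- The sign of the random bit. -/
def signCircuit : List (Gate n (Fin n ⊕ AncReg n m a)) :=
  diagGate (coinWire 0) (bitWire 0) fun _ g => if g = true then 1 else Circle.exp Real.pi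

theorem run_signCircuit (ψ : State (Fin n ⊕ AncReg n m a)) :
    run U signCircuit ψ = fun x => (if x (bitWire 0) = true then (1 : ℂ) else -1) * ψ x := by
  rw [signCircuit, run_diagGate U (by intro h; cases h)]
  funext x
  cases x (bitWire 0) <;> simp

/-- Sample, evaluate, take the sign, and undo everything. On `|j⟩` this multiplies the amplitude
of the ancilla state `|0⟩` by the expectation of the sign. -/
def coreCircuit (z : Fin m) (T : Bits (Fin m) → Bits (Fin (m + 1)))
    (F : List (ElemGate (FunReg m a))) : List (Gate n (Fin n ⊕ AncReg n m a)) :=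
  samplingCircuit z ++ (evalCircuit T F ++ signCircuit ++ invCircuit (evalCircuit T F)) ++
    invCircuit (samplingCircuit z)

/-- The function applied to the amplitudes: the average of the values in the table, weighted with
the probabilities of the estimates of real and imaginary part. -/
def averaged (m : ℕ) (val : Bits (Fin m) → Bits (Fin m) → ℝ) (z : ℂ) : ℝ :=
  ∑ s : Bits (Fin m), ∑ t : Bits (Fin m),
    ampProb (2 ^ m) (Real.arccos z.re) (natVal s) *
      (ampProb (2 ^ m) (Real.arccos z.im) (natVal t) * val s t)

theorem sum_estState (j : Bits (Fin n)) (Ξ : Bits (Fin m) → State (Fin (n + 1)))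
    (h : Bits (Fin m) → ℝ) :
    ∑ y : Bits (EstReg n m), ‖estState j Ξ (Sum.elim j y)‖ ^ 2 * h (fun i => y (.inl i)) =
      ∑ t, (∑ y, ‖Ξ t y‖ ^ 2) * h t := by
  rw [sum_bits_sum]
  refine Finset.sum_congr rfl fun t _ => ?_
  rw [sum_bits_sum, Finset.sum_mul]
  refine Finset.sum_congr rfl fun y _ => ?_
  rw [Finset.sum_eq_single (zeros _)]
  · have : estState j Ξ (Sum.elim j (Sum.elim t (Sum.elim y (zeros _)))) = Ξ t y := by
      rw [estState, if_pos ⟨rfl, rfl⟩]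
      rfl
    rw [this]
    rfl
  · intro k _ hk
    have : estState j Ξ (Sum.elim j (Sum.elim t (Sum.elim y k))) = 0 := by
      rw [estState, if_neg]
      rintro ⟨-, h⟩
      exact hk h
    rw [this]
    simp
  · simp

/-- A sum over the labels of all qubits is supported on those with data `i` and with vanishing
remaining qubits, if the summand is. -/
theorem sum_labels (i : Bits (Fin n)) (G₁ G₂ : Bits (Fin n ⊕ EstReg n m) → ℝ)
    (hG : ∀ y, y ∘ Sum.inl ≠ i → G₁ y = 0)
    (h : Bits (Fin m) → Bits (Fin m) → Bits (Fin (m + 1)) → ℝ) :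
    ∑ x : Bits (Fin n ⊕ AncReg n m a), G₁ (x ∘ reEmb) * (G₂ (x ∘ imEmb) *
      ((if x ∘ restWire = zeros _ then 1 else 0) *
        h (fun k => x (reEmb (timeWire k))) (fun k => x (imEmb (timeWire k))) (x ∘ coinWire))) =
    ∑ y₁ : Bits (EstReg n m), ∑ y₂ : Bits (EstReg n m), G₁ (Sum.elim i y₁) *
      (G₂ (Sum.elim i y₂) * ∑ u, h (fun k => y₁ (.inl k)) (fun k => y₂ (.inl k)) u) := by
  rw [sum_bits_sum, Finset.sum_eq_single i]
  · refine (sum_bits_sum _).trans (Finset.sum_congr rfl fun y₁ _ => ?_)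
    refine (sum_bits_sum _).trans (Finset.sum_congr rfl fun y₂ _ => ?_)
    rw [Finset.mul_sum, Finset.mul_sum]
    refine (sum_bits_sum _).trans (Finset.sum_congr rfl fun u _ => ?_)
    have e1 : ∀ w, (Sum.elim i (Sum.elim y₁ (Sum.elim y₂ (Sum.elim u w)))) ∘ (reEmb (a := a)) =
        Sum.elim i y₁ := by
      intro w
      funext v
      rcases v with v | v <;> rfl
    have e2 : ∀ w, (Sum.elim i (Sum.elim y₁ (Sum.elim y₂ (Sum.elim u w)))) ∘ (imEmb (a := a)) =
        Sum.elim i y₂ := by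
      intro w
      funext v
      rcases v with v | v <;> rfl
    have e3 : ∀ w, (Sum.elim i (Sum.elim y₁ (Sum.elim y₂ (Sum.elim u w)))) ∘
        (restWire (n := n) (m := m) (a := a)) = w := fun _ => rfl
    have e4 : ∀ w : Bits (RestReg m a), (Sum.elim i (Sum.elim y₁ (Sum.elim y₂ (Sum.elim u w)))) ∘
        (coinWire (a := a)) = u := fun _ => rfl
    rw [Finset.sum_eq_single (zeros _)]
    · rw [e1, e2, e3, e4, if_pos rfl, one_mul]
      rfl
    · intro w _ hw
      rw [e3, if_neg hw, zero_mul, mul_zero, mul_zero]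
    · exact fun h => absurd (Finset.mem_univ _) h
  · intro y _ hy
    refine Finset.sum_eq_zero fun w _ => ?_
    rw [hG (Sum.elim y w ∘ (reEmb (a := a))) hy, zero_mul]
  · exact fun h => absurd (Finset.mem_univ _) h

/-- The expectation of the sign of the random bit in the state `sampleState U i`. -/
theorem sum_sign {c : Bits (Fin n) → ℂ} (hU : IsAnalogEncoding U c) (i : Bits (Fin n))
    (hc : ‖c i‖ ≤ 1) (b : Bits (Fin m) → Bits (Fin m) → Bits (Fin (m + 1))) :
    ∑ y₁ : Bits (EstReg n m), ∑ y₂ : Bits (EstReg n m),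
      ‖estState i (estVector U 1 i) (Sum.elim i y₁)‖ ^ 2 *
        (‖estState i (estVector U negI i) (Sum.elim i y₂)‖ ^ 2 *
          ∑ u, if biasedBit (b (fun k => y₁ (.inl k)) (fun k => y₂ (.inl k))) u = true
            then (1 : ℝ) else -1) =
      2 ^ (m + 1) * averaged m (fun s t => fixedVal (b s t)) (c i) := by
  have hre := abs_le.1 ((Complex.abs_re_le_norm (c i)).trans hc)
  have him := abs_le.1 ((Complex.abs_im_le_norm (c i)).trans hc)
  have hθ₁ : Real.cos (Real.arccos (c i).re) = (((1 : Circle) : ℂ) * c i).re := by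
    rw [Circle.coe_one, one_mul]
    exact Real.cos_arccos hre.1 hre.2
  have hθ₂ : Real.cos (Real.arccos (c i).im) = ((negI : ℂ) * c i).re := by
    rw [negI_mul_re]
    exact Real.cos_arccos him.1 him.2
  have inner : ∀ y₁ : Bits (EstReg n m), ∑ y₂ : Bits (EstReg n m),
      ‖estState i (estVector U negI i) (Sum.elim i y₂)‖ ^ 2 *
          (2 ^ (m + 1) * fixedVal (b (fun k => y₁ (.inl k)) (fun k => y₂ (.inl k)))) =
        ∑ t, ampProb (2 ^ m) (Real.arccos (c i).im) (natVal t) *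
          (2 ^ (m + 1) * fixedVal (b (fun k => y₁ (.inl k)) t)) := by
    intro y₁
    rw [sum_estState i (estVector U negI i)
      fun t => 2 ^ (m + 1) * fixedVal (b (fun k => y₁ (.inl k)) t)]
    exact Finset.sum_congr rfl fun t _ => by rw [sum_norm_estVector_sq U hU negI i hθ₂]
  simp only [sum_biasedBit, ← Finset.mul_sum, inner]
  rw [sum_estState i (estVector U 1 i) fun s => ∑ t,
    ampProb (2 ^ m) (Real.arccos (c i).im) (natVal t) * (2 ^ (m + 1) * fixedVal (b s t)),
    averaged, Finset.mul_sum]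
  refine Finset.sum_congr rfl fun s _ => ?_
  rw [sum_norm_estVector_sq U hU 1 i hθ₁, Finset.mul_sum, Finset.mul_sum]
  exact Finset.sum_congr rfl fun t _ => by ring

theorem run_coreCircuit {c : Bits (Fin n) → ℂ} (hU : IsAnalogEncoding U c) (hc : ∀ j, ‖c j‖ ≤ 1)
    (z : Fin m) (hz : (z : ℕ) = 0) (T : Bits (Fin m) → Bits (Fin (m + 1)))
    (F : List (ElemGate (FunReg m a))) (r : Bits (Fin (m + 1)) → Bits (Fin (m + 1)) →
      Bits (Fin (m + 1)))
    (hF : ∀ x y, runElem F (ket (fourRegs a x y (zeros _))) = ket (fourRegs a x y (r x y)))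
    (i j : Bits (Fin n)) :
    run U (coreCircuit z T F) (ket (dataLabel j) : State (Fin n ⊕ AncReg n m a)) (dataLabel i) =
      if i = j then ((averaged m (fun s t => fixedVal (r (T s) (T t))) (c j) : ℝ) : ℂ) else 0 := by
  classical
  have heval : ∀ x : Bits (Fin n ⊕ AncReg n m a), ∃ x', x ∘ restWire = zeros _ →
      run U (evalCircuit T F) (ket x) = ket x' ∧ x' (bitWire 0) =
      biasedBit (r (T fun i => x (reEmb (timeWire i))) (T fun i => x (imEmb (timeWire i))))
        (x ∘ coinWire) := by
    intro x
    by_cases hx : x ∘ restWire = zeros _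
    · obtain ⟨x', h⟩ := run_evalCircuit U T F r hF x hx
      exact ⟨x', fun _ => h⟩
    · exact ⟨x, fun h => absurd h hx⟩
  choose π hπ using heval
  have hsupp : ∀ x, sampleState (a := a) (m := m) U j x ≠ 0 → x ∘ restWire = zeros _ := by
    intro x hx
    by_contra h
    exact hx (by simp [sampleState, h])
  have hadj : ∀ φ : State (Fin n ⊕ AncReg n m a),
      run U (invCircuit (samplingCircuit z)) φ (dataLabel i) = star (sampleState U i) ⬝ᵥ φ := by
    intro φ
    rw [← run_samplingCircuit U z hz, star_run_dotProduct, star_ket_dotProduct]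
  rw [coreCircuit, run_append, run_append, run_samplingCircuit U z hz,
    run_conj_of_ket U _ _ _ (run_signCircuit U) π _ fun x hx => (hπ x (hsupp x hx)).1, hadj]
  split_ifs with hij
  · subst hij
    have hterm : ∀ x : Bits (Fin n ⊕ AncReg n m a),
        star (sampleState U i) x * ((if π x (bitWire 0) = true then (1 : ℂ) else -1) *
          sampleState U i x) =
        (((2 ^ (m + 1) : ℝ)⁻¹ * (‖estState i (estVector U 1 i) (x ∘ reEmb)‖ ^ 2 *
          (‖estState i (estVector U negI i) (x ∘ imEmb)‖ ^ 2 *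
          ((if x ∘ restWire = zeros _ then 1 else 0) *
            (if biasedBit (r (T fun i => x (reEmb (timeWire i)))
              (T fun i => x (imEmb (timeWire i)))) (x ∘ coinWire) = true then 1 else -1)))) : ℝ) :
            ℂ) := by
      intro x
      by_cases hx : x ∘ restWire = zeros _
      · have hn : ∀ w : ℂ, (starRingEnd ℂ) w * w = ((‖w‖ ^ 2 : ℝ) : ℂ) := fun w => by
          rw [mul_comm, Complex.mul_conj, Complex.normSq_eq_norm_sq]
        have hs : ((Real.sqrt 2 : ℂ)⁻¹ ^ (m + 1)) * ((Real.sqrt 2 : ℂ)⁻¹ ^ (m + 1)) =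
            (((2 ^ (m + 1) : ℝ)⁻¹ : ℝ) : ℂ) := by
          rw [← mul_pow, sqrt_two_inv_mul_self]
          push_cast
          rw [one_div, inv_pow]
        have hsign : (if π x (bitWire 0) = true then (1 : ℂ) else -1) =
            (((if biasedBit (r (T fun i => x (reEmb (timeWire i)))
              (T fun i => x (imEmb (timeWire i)))) (x ∘ coinWire) = true then 1 else -1 : ℝ)) :
              ℂ) := by
          rw [(hπ x hx).2]
          split_ifs <;> simp
        rw [hsign, Pi.star_apply, RCLike.star_def]
        simp only [sampleState, hx, if_true, mul_one, one_mul, map_mul, map_pow, map_inv₀,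
          Complex.conj_ofReal]
        rw [Complex.ofReal_mul, Complex.ofReal_mul, Complex.ofReal_mul, ← hn, ← hn, ← hs]
        ring
      · simp [sampleState, hx]
    rw [dotProduct]
    simp only [hterm]
    rw [← Complex.ofReal_sum]
    congr 1
    rw [← Finset.mul_sum, sum_labels i (fun y => ‖estState i (estVector U 1 i) y‖ ^ 2)
      (fun y => ‖estState i (estVector U negI i) y‖ ^ 2)
      (fun y hy => by rw [estState_eq_zero i _ y hy]; simp)
      (fun s t u => if biasedBit (r (T s) (T t)) u = true then 1 else -1),
      sum_sign U hU i (hc i) (fun s t => r (T s) (T t)),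
      inv_mul_cancel_left₀ (by positivity)]
  · refine Finset.sum_eq_zero fun x _ => ?_
    by_cases hxj : x ∘ Sum.inl = j
    · have : star (sampleState (a := a) (m := m) U i) x = 0 := by
        rw [Pi.star_apply, sampleState, estState_eq_zero i _ (x ∘ reEmb)]
        · simp
        · intro h
          exact hij (h.symm.trans hxj)
      rw [this, zero_mul]
    · have : sampleState (a := a) (m := m) U j x = 0 := by
        rw [sampleState, estState_eq_zero j _ (x ∘ reEmb) hxj]
        simp
      simp only [this, mul_zero]

end Full

/-! ### The uniform superposition -/

section Uniform

variable {n : ℕ} (U : Unitary (Fin n))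

/-- Uncompute `U` with a control that is set for this purpose, then apply the Fourier transform.
This turns `U|0⟩` into the uniform superposition of all labels. -/
def uniformCircuit : List (Gate n (Fin (n + 1))) :=
  compile [.xor1 (Fin.last n) 0 fun _ => true] ++ [.ctrlUInv (Function.Embedding.refl _)] ++
    compile [.xor1 (Fin.last n) 0 fun _ => true] ++ liftCircuit (Fin.succEmb n) (qft n)

theorem run_uniformCircuit (hn : 1 ≤ n) {c : Bits (Fin n) → ℂ} (hU : IsAnalogEncoding U c) :
    run U uniformCircuit (fun y => if y 0 = false then c (y ∘ Fin.succ) else 0) =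
      fun y => if y 0 = false then (Real.sqrt 2 : ℂ)⁻¹ ^ n else 0 := by
  have hne : Fin.last n ≠ 0 := by
    rw [Ne, Fin.last_eq_zero_iff]
    omega
  have hflip : ∀ (φ : State (Fin (n + 1))),
      run U (compile [.xor1 (Fin.last n) 0 fun _ => true]) φ =
        fun y => φ (Function.update y 0 (!(y 0))) := by
    intro φ
    funext y
    rw [run_compile, List.reverse_singleton, exec_cons, exec_nil, act_xor1 hne]
    simp
  have hsucc : ∀ (y : Bits (Fin (n + 1))) b, Function.update y 0 b ∘ Fin.succ = y ∘ Fin.succ :=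
    fun y b => funext fun i => Function.update_of_ne (Fin.succ_ne_zero i) _ _
  have hinv : U.1ᴴ *ᵥ c = ket (zeros _) := by
    rw [← hU, Matrix.mulVec_mulVec, ← Matrix.star_eq_conjTranspose,
      Matrix.mem_unitaryGroup_iff'.1 U.2, Matrix.one_mulVec]
  have hctrl : run U [.ctrlUInv (Function.Embedding.refl _)]
      (fun y : Bits (Fin (n + 1)) => if y 0 = true then c (y ∘ Fin.succ) else 0) =
      fun y => if y 0 = true then ket (zeros _) (y ∘ Fin.succ) else 0 := by
    funext y
    have hext : ∀ w : Bits (Fin (n + 1)),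
        Function.extend (Function.Embedding.refl (Fin (n + 1))) w y = w := fun w =>
      extend_comp_embedding (Function.Embedding.refl _) w y
    rw [run_cons, run_nil, ← hinv]
    change ∑ w, controlled U.1ᴴ y w * _ = _
    simp only [hext]
    rw [sum_bits_cons, Fintype.sum_bool]
    simp only [controlled, Fin.cons_zero, Fin.cons_succ]
    have hc : ∀ (b : Bool) (w : Bits (Fin n)), (Fin.cons b w : Bits (Fin (n + 1))) ∘ Fin.succ = w :=
      fun _ _ => rfl
    simp only [hc]
    by_cases hy : y 0 = true
    · simp [hy, Matrix.mulVec, dotProduct, Function.comp_def]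
    · simp [hy]
  rw [uniformCircuit, run_append, run_append, run_append, hflip, hflip]
  simp only [Function.update_self, hsucc, Bool.not_eq_false']
  rw [hctrl]
  simp only [Function.update_self, hsucc]
  have h1 : (fun y : Bits (Fin (n + 1)) =>
      if (!(y 0)) = true then (ket (zeros _) (y ∘ Fin.succ) : ℂ) else 0) =
      fun y => ket (zeros _) (y ∘ Fin.succEmb n) * if y 0 = false then 1 else 0 := by
    funext y
    cases y 0
    · simp [Function.comp_def]
    · simp
  rw [h1, run_lift_mul]
  · funext y
    have hv0 : natVal (zeros (Fin n)) = 0 := by simp [natVal, zeros]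
    rw [run_qft_ket, hv0]
    simp
  · intro x y
    rw [Function.extend_apply']
    rintro ⟨i, hi⟩
    exact Fin.succ_ne_zero i hi

/-- The data qubits, controlled by the ancilla qubit `k`. -/
def controlEmb {κ : Type} (k : κ) : Fin (n + 1) ↪ Fin n ⊕ κ :=
  ⟨Fin.cases (.inr k) fun i => .inl i, by
    intro i j
    refine Fin.cases ?_ (fun i => ?_) i <;> refine Fin.cases ?_ (fun j => ?_) j <;> simp⟩

theorem run_lift_uniformCircuit {κ : Type} [DecidableEq κ] [Fintype κ] (k : κ) (hn : 1 ≤ n)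
    {c : Bits (Fin n) → ℂ} (hU : IsAnalogEncoding U c) :
    run U (liftCircuit (controlEmb k) uniformCircuit)
      (fun x : Bits (Fin n ⊕ κ) => if x ∘ Sum.inr = zeros κ then c (x ∘ Sum.inl) else 0) =
      fun x => if x ∘ Sum.inr = zeros κ then (Real.sqrt 2 : ℂ)⁻¹ ^ n else 0 := by
  classical
  have hz : ∀ x : Bits (Fin n ⊕ κ), x ∘ Sum.inr = zeros κ ↔
      (x ∘ controlEmb k) 0 = false ∧ ∀ w, w ≠ k → x (.inr w) = false := by
    intro x
    constructor
    · exact fun h => ⟨congrFun h k, fun w _ => congrFun h w⟩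
    · rintro ⟨h0, h1⟩
      funext w
      by_cases hw : w = k
      · rw [hw]
        exact h0
      · exact h1 w hw
  have key : ∀ φ : Bits (Fin n) → ℂ,
      (fun x : Bits (Fin n ⊕ κ) => if x ∘ Sum.inr = zeros κ then φ (x ∘ Sum.inl) else 0) =
      fun x => (fun y : Bits (Fin (n + 1)) => if y 0 = false then φ (y ∘ Fin.succ) else 0)
        (x ∘ controlEmb k) * if ∀ w, w ≠ k → x (.inr w) = false then 1 else 0 := by
    intro φ
    funext x
    have hx : (x ∘ controlEmb k) ∘ Fin.succ = x ∘ Sum.inl := rfl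
    simp only [hz, hx, ite_and]
    split_ifs <;> simp
  rw [key c, run_lift_mul U (controlEmb k) uniformCircuit
    (fun y => if y 0 = false then c (y ∘ Fin.succ) else 0), run_uniformCircuit U hn hU,
    key fun _ => (Real.sqrt 2 : ℂ)⁻¹ ^ n]
  intro x y
  have : ∀ w, w ≠ k → Function.extend (controlEmb k) y x (Sum.inr w) = x (.inr w) := by
    intro w hw
    refine Function.extend_apply' _ _ _ ?_
    rintro ⟨i, hi⟩
    revert hi
    refine Fin.cases ?_ (fun i => ?_) i
    · intro hi
      exact hw (Sum.inr_injective hi).symm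
    · intro hi
      cases hi
  exact if_congr (forall₂_congr fun w hw => by rw [this w hw]) rfl rfl

end Uniform

section Full

variable {n m a : ℕ} (U : Unitary (Fin n))

/-- Make the superposition of the data labels uniform, then multiply the amplitude of every label
by the average of the function. -/
def fullCircuit (z : Fin m) (T : Bits (Fin m) → Bits (Fin (m + 1)))
    (F : List (ElemGate (FunReg m a))) : List (Gate n (Fin n ⊕ AncReg n m a)) :=
  liftCircuit (controlEmb (.inr (.inr (.inl 0)))) uniformCircuit ++ coreCircuit z T F

theorem norm_le_one_of_isAnalogEncoding {c : Bits (Fin n) → ℂ} (hU : IsAnalogEncoding U c)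
    (j : Bits (Fin n)) : ‖c j‖ ≤ 1 := by
  have hc : U.1 j (zeros _) = c j := by
    rw [← hU]
    simp [Matrix.mulVec, dotProduct, ket, Pi.single_apply]
  rw [← hc]
  exact entry_norm_bound_of_unitary U.2 j _

theorem run_fullCircuit (hn : 1 ≤ n) {c : Bits (Fin n) → ℂ} (hU : IsAnalogEncoding U c)
    (z : Fin m) (hz : (z : ℕ) = 0) (T : Bits (Fin m) → Bits (Fin (m + 1)))
    (F : List (ElemGate (FunReg m a))) (r : Bits (Fin (m + 1)) → Bits (Fin (m + 1)) →
      Bits (Fin (m + 1)))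
    (hF : ∀ x y, runElem F (ket (fourRegs a x y (zeros _))) = ket (fourRegs a x y (r x y)))
    (i : Bits (Fin n)) :
    run U (fullCircuit z T F) (fun x : Bits (Fin n ⊕ AncReg n m a) =>
      if x ∘ Sum.inr = zeros _ then c (x ∘ Sum.inl) else 0) (dataLabel i) =
      (Real.sqrt 2 : ℂ)⁻¹ ^ n *
        ((averaged m (fun s t => fixedVal (r (T s) (T t))) (c i) : ℝ) : ℂ) := by
  have h1 : (fun x : Bits (Fin n ⊕ AncReg n m a) =>
      if x ∘ Sum.inr = zeros _ then (Real.sqrt 2 : ℂ)⁻¹ ^ n else 0) =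
      (Real.sqrt 2 : ℂ)⁻¹ ^ n • ∑ j, ket (dataLabel j) := by
    funext x
    rw [Pi.smul_apply, Finset.sum_apply, Finset.sum_eq_single (x ∘ Sum.inl)]
    · have : x = dataLabel (x ∘ Sum.inl) ↔ x ∘ Sum.inr = zeros _ := by
        constructor
        · intro h
          rw [h]
          rfl
        · intro h
          rw [dataLabel, ← h, Sum.elim_comp_inl_inr]
      simp only [ket, Pi.single_apply, this]
      split_ifs <;> simp
    · intro j _ hj
      rw [ket, Pi.single_apply, if_neg]
      intro h
      exact hj (by rw [h]; rfl)
    · exact fun h => absurd (Finset.mem_univ _) h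
  rw [fullCircuit, run_append, run_lift_uniformCircuit U _ hn hU, h1, run_smul, run_sum,
    Pi.smul_apply, Finset.sum_apply, Finset.sum_eq_single i,
    run_coreCircuit U hU (norm_le_one_of_isAnalogEncoding U hU) z hz T F r hF, if_pos rfl,
    smul_eq_mul]
  · intro j _ hj
    rw [run_coreCircuit U hU (norm_le_one_of_isAnalogEncoding U hU) z hz T F r hF,
      if_neg hj.symm]
  · exact fun h => absurd (Finset.mem_univ _) h

/-- Numbering the ancilla qubits does not change the result of a circuit. -/
theorem postselect_run_lift {κ : Type} [Fintype κ] [DecidableEq κ] {A : ℕ} (e : κ ≃ Fin A)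
    (V : List (Gate n (Fin n ⊕ κ))) (c : State (Fin n)) (i : Bits (Fin n)) :
    postselect (run U (liftCircuit (Equiv.sumCongr (Equiv.refl _) e).toEmbedding V)
      (withAncillas A c)) i =
    run U V (fun x => if x ∘ Sum.inr = zeros κ then c (x ∘ Sum.inl) else 0) (dataLabel i) := by
  rw [postselect, run_lift_apply]
  congr 1
  · funext y
    have h1 : ∀ w, Function.extend (Equiv.sumCongr (Equiv.refl (Fin n)) e).toEmbedding y
        (Sum.elim i (zeros (Fin A))) ((Equiv.sumCongr (Equiv.refl (Fin n)) e).toEmbedding w) =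
        y w :=
      fun w => (Equiv.sumCongr (Equiv.refl (Fin n)) e).toEmbedding.injective.extend_apply _ _ w
    have h2 : ∀ k, Function.extend (Equiv.sumCongr (Equiv.refl (Fin n)) e).toEmbedding y
        (Sum.elim i (zeros (Fin A))) (.inl k) = y (.inl k) := fun k => h1 (.inl k)
    have h3 : ∀ k, Function.extend (Equiv.sumCongr (Equiv.refl (Fin n)) e).toEmbedding y
        (Sum.elim i (zeros (Fin A))) (.inr k) = y (.inr (e.symm k)) := by
      intro k
      have := h1 (.inr (e.symm k))
      rw [show (Equiv.sumCongr (Equiv.refl (Fin n)) e).toEmbedding (Sum.inr (e.symm k)) =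
        Sum.inr k by simp] at this
      exact this
    simp only [slice, withAncillas, h2, h3]
    refine if_congr ⟨fun h => ?_, fun h => ?_⟩ rfl rfl
    · funext w
      have := congrFun h (e w)
      simpa [zeros] using this
    · funext k
      exact congrFun h (e.symm k)
  · funext w
    rcases w with w | w <;> rfl

theorem oracleCount_fullCircuit_le (hn : 1 ≤ n) (z : Fin m)
    (T : Bits (Fin m) → Bits (Fin (m + 1))) (F : List (ElemGate (FunReg m a))) :
    oracleCount (fullCircuit z T F : List (Gate n (Fin n ⊕ AncReg n m a))) ≤ 13 * 2 ^ m := by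
  have h0 : oracleCount [Gate.ctrlUInv (Function.Embedding.refl (Fin (n + 1)))] = 1 := rfl
  have h1 := oracleCount_estCircuit_le (m := m) hn 1 z
  have h2 := oracleCount_estCircuit_le (m := m) hn negI z
  have h3 : 1 ≤ 2 ^ m := Nat.one_le_two_pow
  simp only [fullCircuit, uniformCircuit, coreCircuit, samplingCircuit, evalCircuit, signCircuit,
    oracleCount_append, oracleCount_lift, oracleCount_inv, oracleCount_compile, oracleCount_qft,
    oracleCount_map_elem, oracleCount_diagGate, h0]
  omega

theorem elemCount_evalCircuit_le (T : Bits (Fin m) → Bits (Fin (m + 1)))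
    (F : List (ElemGate (FunReg m a))) :
    elemCount (evalCircuit T F : List (Gate n (Fin n ⊕ AncReg n m a))) ≤
      112 * 2 ^ m + F.length + 14 * (m + 1) := by
  have hT : ∀ (c c' : Fin n ⊕ AncReg n m a) e k Y o e' k' Y' o', elemCount (compile
      (tableProg T c e k Y o ++ tableProg T c' e' k' Y' o') :
      List (Gate n (Fin n ⊕ AncReg n m a))) ≤ 112 * 2 ^ m := by
    intro c c' e k Y o e' k' Y' o'
    have h1 := length_tableProg_le T c e k Y o
    have h2 := length_tableProg_le T c' e' k' Y' o'
    refine (elemCount_compile_le _).trans ?_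
    rw [List.length_append]
    rw [pow_succ 2 m] at h1 h2
    omega
  have h := elemCount_compile_le (n := n) (biasedProg (fun i => funEmb (.inr (.inr (.inl i))))
    coinWire bitWire : List (ClInstr (Fin n ⊕ AncReg n m a)))
  rw [length_biasedProg] at h
  rw [evalCircuit, elemCount_append, elemCount_append, elemCount_lift, elemCount_map_elem]
  refine Nat.add_le_add (Nat.add_le_add_right (hT _ _ _ _ _ _ _ _ _ _) _) (h.trans (by omega))

theorem elemCount_fullCircuit_le (hn : 1 ≤ n) (z : Fin m)
    (T : Bits (Fin m) → Bits (Fin (m + 1))) (F : List (ElemGate (FunReg m a))) {P : ℕ}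
    (hP : F.length ≤ P * 2 ^ m) :
    elemCount (fullCircuit z T F : List (Gate n (Fin n ⊕ AncReg n m a))) ≤
      (1000 + 2 * P) * (n ^ 2 * 2 ^ m) := by
  have h0 : elemCount [Gate.ctrlUInv (Function.Embedding.refl (Fin (n + 1)))] = 0 := rfl
  have h1 := elemCount_estCircuit_le (m := m) hn 1 z
  have h2 := elemCount_estCircuit_le (m := m) hn negI z
  have h3 := elemCount_compile_le (n := n)
    [ClInstr.xor1 (Fin.last n) (0 : Fin (n + 1)) fun _ => true]
  rw [List.length_singleton] at h3
  have h4 := elemCount_qft_le (n := n) n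
  have h5 := elemCount_qft_le (n := n) (m + 1)
  have h6 := elemCount_evalCircuit_le (n := n) T F
  have h9 := elemCount_diagGate_le (n := n) (coinWire 0 : Fin n ⊕ AncReg n m a) (bitWire 0)
    fun _ g => if g = true then 1 else Circle.exp Real.pi
  have hsq : ∀ k : ℕ, k ^ 2 ≤ 2 * 2 ^ k := by
    intro k
    rcases Nat.lt_or_ge k 4 with h | h
    · interval_cases k <;> norm_num
    · have : k ^ 2 ≤ 2 ^ k := by
        induction k, h using Nat.le_induction with
        | base => norm_num
        | succ k hk ih =>
          rw [pow_succ 2]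
          nlinarith
      omega
  have hm2 := hsq m
  have hm3 := hsq (m + 1)
  rw [pow_succ 2] at hm3
  have hm1 : m + 1 ≤ 2 ^ m := Nat.lt_two_pow_self
  have hb1 : n * 2 ^ m ≤ n ^ 2 * 2 ^ m :=
    Nat.mul_le_mul_right _ (Nat.le_self_pow two_ne_zero n)
  have hb2 : 2 ^ m ≤ n ^ 2 * 2 ^ m := Nat.le_mul_of_pos_left _ (by positivity)
  have hb3 : n ^ 2 ≤ n ^ 2 * 2 ^ m := Nat.le_mul_of_pos_right _ (by positivity)
  have hb4 : P * 2 ^ m ≤ P * (n ^ 2 * 2 ^ m) := Nat.mul_le_mul_left _ hb2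
  rw [mul_assoc] at h1 h2
  simp only [fullCircuit, uniformCircuit, coreCircuit, samplingCircuit, signCircuit,
    elemCount_append, elemCount_lift, elemCount_inv, h0]
  have : (1000 + 2 * P) * (n ^ 2 * 2 ^ m) = 1000 * (n ^ 2 * 2 ^ m) + 2 * (P * (n ^ 2 * 2 ^ m)) := by
    ring
  rw [this]
  omega

end Full

/-! ### Rounding -/

theorem exists_binary_fraction (m : ℕ) {x : ℝ} (h0 : 0 ≤ x) (h1 : x ≤ 1) :
    ∃ b : Bits (Fin m), (∑ k, if b k = true then (1 / 2 : ℝ) ^ (k.1 + 1) else 0) ∈ Set.Icc 0 1 ∧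
      |(∑ k, if b k = true then (1 / 2 : ℝ) ^ (k.1 + 1) else 0) - x| ≤ (1 / 2 : ℝ) ^ m := by
  induction m generalizing x with
  | zero => exact ⟨zeros _, by simp, by simpa [abs_of_nonneg h0] using h1⟩
  | succ m ih =>
    have key : ∀ (d : Bool) (b : Bits (Fin m)),
        (∑ k, if (Fin.cons d b : Bits (Fin (m + 1))) k = true then (1 / 2 : ℝ) ^ (k.1 + 1) else 0) =
          (if d = true then 1 / 2 else 0) +
            1 / 2 * ∑ k, if b k = true then (1 / 2 : ℝ) ^ (k.1 + 1) else 0 := by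
      intro d b
      rw [Fin.sum_univ_succ, Finset.mul_sum]
      congr 1
      · simp
      · refine Finset.sum_congr rfl fun k _ => ?_
        rw [Fin.cons_succ, Fin.val_succ, pow_succ' _ (k.1 + 1), mul_ite, mul_zero]
    rcases lt_or_ge x (1 / 2) with hx | hx
    · obtain ⟨b, ⟨hb0, hb1⟩, hb⟩ := ih (x := 2 * x) (by linarith) (by linarith)
      refine ⟨Fin.cons false b, ?_⟩
      rw [key, if_neg (by simp), zero_add]
      refine ⟨⟨by linarith, by linarith⟩, ?_⟩
      rw [abs_le] at hb ⊢
      rw [pow_succ]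
      constructor <;> linarith
    · obtain ⟨b, ⟨hb0, hb1⟩, hb⟩ := ih (x := 2 * x - 1) (by linarith) (by linarith)
      refine ⟨Fin.cons true b, ?_⟩
      rw [key, if_pos rfl]
      refine ⟨⟨by linarith, by linarith⟩, ?_⟩
      rw [abs_le] at hb ⊢
      rw [pow_succ]
      constructor <;> linarith

theorem exists_fixedVal (m : ℕ) {x : ℝ} (hx : |x| ≤ 1) :
    ∃ b : Bits (Fin (m + 1)), |fixedVal b| ≤ 1 ∧ |fixedVal b - x| ≤ (1 / 2 : ℝ) ^ m := by
  rw [abs_le] at hx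
  have key : ∀ (d : Bool) (b : Bits (Fin m)), fixedVal (Fin.cons d b : Bits (Fin (m + 1))) =
      -(if d = true then 1 else 0) + ∑ k, if b k = true then (1 / 2 : ℝ) ^ (k.1 + 1) else 0 :=
    fun _ _ => rfl
  -- For negative `x` the sign bit subtracts `1` from a binary fraction close to `x + 1`.
  rcases lt_or_ge x 0 with h | h
  · obtain ⟨b, ⟨hb0, hb1⟩, hb⟩ := exists_binary_fraction m (x := x + 1) (by linarith) (by linarith)
    refine ⟨Fin.cons true b, ?_⟩
    rw [key, if_pos rfl]
    rw [abs_le] at hb ⊢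
    rw [abs_le]
    exact ⟨⟨by linarith, by linarith⟩, by linarith, by linarith⟩
  · obtain ⟨b, ⟨hb0, hb1⟩, hb⟩ := exists_binary_fraction m h hx.2
    refine ⟨Fin.cons false b, ?_⟩
    rw [key, if_neg (by simp), neg_zero, zero_add]
    exact ⟨abs_le.2 ⟨by linarith, hb1⟩, hb⟩

/-! ### The error of the averaged function -/

theorem abs_averaged_sub_le {m : ℕ} (hm : 1 ≤ m) {val : Bits (Fin m) → Bits (Fin m) → ℝ} {z : ℂ}
    (hre : |z.re| ≤ 1) (him : |z.im| ≤ 1) {w δ L : ℝ} (hL : 0 ≤ L)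
    (h : ∀ s t, |val s t - w| ≤ δ +
      L * (|Real.cos (2 * Real.pi * natVal s / (2 ^ m : ℕ)) - z.re| +
        |Real.cos (2 * Real.pi * natVal t / (2 ^ m : ℕ)) - z.im|)) :
    |averaged m val z - w| ≤ δ + L * (10 / 2 ^ m) := by
  have hM : 2 ≤ 2 ^ m := by
    calc 2 = 2 ^ 1 := rfl
      _ ≤ 2 ^ m := Nat.pow_le_pow_right (by norm_num) hm
  set p : Bits (Fin m) → ℝ := fun s => ampProb (2 ^ m) (Real.arccos z.re) (natVal s)
  set q : Bits (Fin m) → ℝ := fun s => ampProb (2 ^ m) (Real.arccos z.im) (natVal s)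
  set X : Bits (Fin m) → ℝ := fun s => |Real.cos (2 * Real.pi * natVal s / (2 ^ m : ℕ)) - z.re|
  set Y : Bits (Fin m) → ℝ := fun s => |Real.cos (2 * Real.pi * natVal s / (2 ^ m : ℕ)) - z.im|
  have hp0 : ∀ s, 0 ≤ p s := fun s => ampProb_nonneg _ _ _
  have hq0 : ∀ s, 0 ≤ q s := fun s => ampProb_nonneg _ _ _
  have hp1 : ∑ s, p s = 1 := (sum_natVal _).trans (sum_ampProb hM _)
  have hq1 : ∑ s, q s = 1 := (sum_natVal _).trans (sum_ampProb hM _)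
  have hpX : ∑ s, p s * X s ≤ 5 / 2 ^ m := by
    have e := sum_ampProb_error_le hM (Real.arccos z.re)
    rw [← sum_natVal, Real.cos_arccos (abs_le.1 hre).1 (abs_le.1 hre).2] at e
    exact_mod_cast e
  have hqY : ∑ s, q s * Y s ≤ 5 / 2 ^ m := by
    have e := sum_ampProb_error_le hM (Real.arccos z.im)
    rw [← sum_natVal, Real.cos_arccos (abs_le.1 him).1 (abs_le.1 him).2] at e
    exact_mod_cast e
  have hsum : ∀ u v x : ℝ,
      ∑ s, ∑ t, p s * (q t * (u + v * X s + x * Y t)) =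
        u + v * ∑ s, p s * X s + x * ∑ t, q t * Y t := by
    intro u v x
    have : ∀ s, ∑ t, p s * (q t * (u + v * X s + x * Y t)) =
        p s * u + v * (p s * X s) + p s * (x * ∑ t, q t * Y t) := by
      intro s
      calc ∑ t, p s * (q t * (u + v * X s + x * Y t)) =
          p s * ((u + v * X s) * ∑ t, q t + x * ∑ t, q t * Y t) := by
            rw [Finset.mul_sum, Finset.mul_sum, ← Finset.sum_add_distrib, Finset.mul_sum]
            exact Finset.sum_congr rfl fun t _ => by ring
        _ = _ := by rw [hq1]; ring
    simp only [this, Finset.sum_add_distrib]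
    rw [← Finset.sum_mul, ← Finset.mul_sum, ← Finset.sum_mul, hp1]
    ring
  have hw : averaged m val z - w = ∑ s, ∑ t, p s * (q t * (val s t - w)) := by
    have := hsum w 0 0
    simp only [zero_mul, add_zero] at this
    rw [averaged]
    nth_rw 1 [← this]
    simp only [mul_sub, Finset.sum_sub_distrib]
    rfl
  rw [hw]
  calc |∑ s, ∑ t, p s * (q t * (val s t - w))| ≤
      ∑ s, ∑ t, p s * (q t * (δ + L * X s + L * Y t)) := by
        refine (Finset.abs_sum_le_sum_abs _ _).trans (Finset.sum_le_sum fun s _ => ?_)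
        refine (Finset.abs_sum_le_sum_abs _ _).trans (Finset.sum_le_sum fun t _ => ?_)
        rw [abs_mul, abs_mul, abs_of_nonneg (hp0 s), abs_of_nonneg (hq0 t)]
        refine mul_le_mul_of_nonneg_left (mul_le_mul_of_nonneg_left ?_ (hq0 t)) (hp0 s)
        exact (h s t).trans (le_of_eq (by ring))
    _ = δ + L * ∑ s, p s * X s + L * ∑ t, q t * Y t := hsum _ _ _
    _ ≤ δ + L * (5 / 2 ^ m) + L * (5 / 2 ^ m) := by gcongr
    _ = δ + L * (10 / 2 ^ m) := by ring

/-- Rounding the estimates to fixed-point numbers and evaluating a Lipschitz function with the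
accuracy of these numbers costs no more than the order of the accuracy of the estimates. -/
theorem abs_averaged_fixedVal_sub_le {f : ℂ → ℝ} {L : NNReal}
    (hL : LipschitzOnWith L f {z : ℂ | |z.re| ≤ 1 ∧ |z.im| ≤ 1}) {m : ℕ} (hm : 1 ≤ m)
    {T : Bits (Fin m) → Bits (Fin (m + 1))} (hT1 : ∀ t, |fixedVal (T t)| ≤ 1)
    (hT : ∀ t, |fixedVal (T t) - Real.cos (2 * Real.pi * natVal t / (2 ^ m : ℕ))| ≤ (1 / 2) ^ m)
    {r : Bits (Fin (m + 1)) → Bits (Fin (m + 1)) → Bits (Fin (m + 1))}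
    (hr : ∀ x y, |fixedVal (r x y) - f ⟨fixedVal x, fixedVal y⟩| ≤ (1 / 2 : ℝ) ^ m) {z : ℂ}
    (hre : |z.re| ≤ 1) (him : |z.im| ≤ 1) :
    |averaged m (fun s t => fixedVal (r (T s) (T t))) z - f z| ≤ (1 + 12 * L) / 2 ^ m := by
  have hδ : (1 / 2 : ℝ) ^ m = 1 / 2 ^ m := by rw [div_pow, one_pow]
  refine (abs_averaged_sub_le hm hre him (δ := (1 + 2 * L) / 2 ^ m) (L := L) L.2
    fun s t => ?_).trans (le_of_eq (by ring))
  have h1 := hr (T s) (T t)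
  have h2 := hL.dist_le_mul ⟨fixedVal (T s), fixedVal (T t)⟩ ⟨hT1 s, hT1 t⟩ z ⟨hre, him⟩
  rw [Real.dist_eq, dist_eq_norm] at h2
  have h3 := Complex.norm_le_abs_re_add_abs_im ((⟨fixedVal (T s), fixedVal (T t)⟩ : ℂ) - z)
  rw [Complex.sub_re, Complex.sub_im] at h3
  have h4 := abs_sub_le (fixedVal (T s)) (Real.cos (2 * Real.pi * natVal s / (2 ^ m : ℕ))) z.re
  have h5 := abs_sub_le (fixedVal (T t)) (Real.cos (2 * Real.pi * natVal t / (2 ^ m : ℕ))) z.im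
  have h6 := hT s
  have h7 := hT t
  have h8 := abs_sub_le (fixedVal (r (T s) (T t))) (f ⟨fixedVal (T s), fixedVal (T t)⟩) (f z)
  rw [hδ] at h1 h6 h7
  set A := |Real.cos (2 * Real.pi * natVal s / (2 ^ m : ℕ)) - z.re|
  set B := |Real.cos (2 * Real.pi * natVal t / (2 ^ m : ℕ)) - z.im|
  have h9 : (L : ℝ) * ‖(⟨fixedVal (T s), fixedVal (T t)⟩ : ℂ) - z‖ ≤
      L * ((1 / 2 ^ m + A) + (1 / 2 ^ m + B)) := by
    refine mul_le_mul_of_nonneg_left ?_ L.2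
    linarith
  calc _ ≤ 1 / 2 ^ m + L * ((1 / 2 ^ m + A) + (1 / 2 ^ m + B)) := by linarith
    _ = _ := by ring

/-! ### Normalization and constants -/

theorem fidelity_normalized_smul {ι : Type} [Fintype ι] [DecidableEq ι] (φ : State ι) {a : ℝ}
    (ha : 0 < a) (h : 0 < normSqState φ) :
    fidelity (normalized φ) (normalized ((a : ℂ) • φ)) = 1 := by
  have hsq : 0 < Real.sqrt (normSqState φ) := Real.sqrt_pos.2 h
  have h1 : normSqState ((a : ℂ) • φ) = a ^ 2 * normSqState φ := by
    simp only [normSqState, Pi.smul_apply, smul_eq_mul, norm_mul, mul_pow, Finset.mul_sum,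
      Complex.norm_real, Real.norm_eq_abs, sq_abs]
  have h2 : normalized ((a : ℂ) • φ) = normalized φ := by
    funext x
    rw [normalized, normalized, h1, Real.sqrt_mul (sq_nonneg a), Real.sqrt_sq ha.le, Pi.smul_apply,
      smul_eq_mul, Complex.ofReal_mul]
    have : (a : ℂ) ≠ 0 := by exact_mod_cast ha.ne'
    exact mul_div_mul_left _ _ this
  have h3 : star (normalized φ) ⬝ᵥ normalized φ = ((normSqState (normalized φ) : ℝ) : ℂ) := by
    rw [dotProduct, normSqState, Complex.ofReal_sum]
    refine Finset.sum_congr rfl fun x _ => ?_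
    rw [Pi.star_apply, RCLike.star_def, mul_comm, Complex.mul_conj, Complex.normSq_eq_norm_sq]
  have h4 : normSqState (normalized φ) = 1 := by
    rw [normSqState]
    simp only [normalized, norm_div, Complex.norm_real, Real.norm_eq_abs, div_pow, sq_abs,
      Real.sq_sqrt h.le]
    rw [← Finset.sum_div]
    exact div_self h.ne'
  rw [fidelity, h2, h3, h4]
  simp

theorem exists_eval_le_mul_two_pow (p : Polynomial ℕ) : ∃ P : ℕ, ∀ m, p.eval m ≤ P * 2 ^ m := by
  induction p using Polynomial.induction_on' with
  | add p q hp hq =>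
    obtain ⟨P, hP⟩ := hp
    obtain ⟨Q, hQ⟩ := hq
    refine ⟨P + Q, fun m => ?_⟩
    rw [Polynomial.eval_add, add_mul]
    exact Nat.add_le_add (hP m) (hQ m)
  | monomial k a =>
    obtain ⟨B, hB⟩ := (tendsto_pow_const_div_const_pow_of_one_lt k one_lt_two).bddAbove_range
    refine ⟨a * ⌈B⌉₊, fun m => ?_⟩
    rw [Polynomial.eval_monomial, mul_assoc]
    refine Nat.mul_le_mul_left a ?_
    have h1 : (m : ℝ) ^ k / 2 ^ m ≤ B := hB ⟨m, rfl⟩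
    rw [div_le_iff₀ (by positivity)] at h1
    have h2 : B * 2 ^ m ≤ ⌈B⌉₊ * 2 ^ m := by
      gcongr
      exact Nat.le_ceil B
    exact_mod_cast h1.trans h2

theorem exists_two_pow_accuracy {K ε : ℝ} (hK : 1 ≤ K) (h0 : 0 < ε) (h1 : ε < 1) :
    ∃ m : ℕ, 1 ≤ m ∧ K / 2 ^ m ≤ ε ∧ (2 : ℝ) ^ m ≤ 2 * K / ε := by
  obtain ⟨k, hk1, hk2⟩ := exists_nat_pow_near (x := K / ε) ((one_le_div h0).2 (h1.le.trans hK))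
    one_lt_two
  refine ⟨k + 1, by omega, ?_, ?_⟩
  · rw [div_le_iff₀ (by positivity)]
    rw [div_lt_iff₀ h0] at hk2
    linarith
  · rw [pow_succ, mul_comm, mul_div_assoc]
    linarith

end QCirc

end

theorem theorem5 (f : ℂ → ℝ) (hf : ∀ z, f z ∈ Set.Icc (-1 : ℝ) 1)
    (hcomp : QCirc.EfficientlyComputable f)
    (hlip : ∃ L : NNReal, LipschitzOnWith L f {z : ℂ | |z.re| ≤ 1 ∧ |z.im| ≤ 1}) :
    ∃ (C : ℝ) (k : ℕ), 0 < C ∧ 1 ≤ k ∧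
      ∀ n : ℕ, 1 ≤ n → ∀ ε : ℝ, 0 < ε → ε < 1 →
        ∃ (a : ℕ) (V : List (QCirc.Gate n (Fin n ⊕ Fin a))) (ft : ℂ → ℝ),
          (∀ z, |ft z - f z| ≤ ε) ∧
          (QCirc.oracleCount V : ℝ) ≤ C / ε ∧
          (QCirc.elemCount V : ℝ) ≤ C * (Real.log ((2 : ℝ) ^ n)) ^ 2 / ε ∧
          ∀ (c : QCirc.Bits (Fin n) → ℂ) (U : QCirc.Unitary (Fin n)),
            QCirc.IsAnalogEncoding U c →
            QCirc.normSqState (QCirc.postselect (QCirc.run U V (QCirc.withAncillas a c)))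
                = (∑ j, (ft (c j)) ^ 2) / (2 : ℝ) ^ n ∧
            (0 < QCirc.normSqState (QCirc.postselect (QCirc.run U V (QCirc.withAncillas a c))) →
              1 - C * ε ^ k ≤ QCirc.fidelity
                (QCirc.normalized (fun j => ((ft (c j) : ℝ) : ℂ)))
                (QCirc.normalized
                  (QCirc.postselect (QCirc.run U V (QCirc.withAncillas a c))))) := by
  classical
  obtain ⟨p, hp⟩ := hcomp
  obtain ⟨L, hL⟩ := hlip
  obtain ⟨P, hP⟩ := QCirc.exists_eval_le_mul_two_pow p
  set K : ℝ := 1 + 12 * L with hK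
  have hK1 : 1 ≤ K := by
    have : (0 : ℝ) ≤ L := L.2
    linarith
  have hlog0 : 0 < Real.log 2 := Real.log_pos one_lt_two
  have hlog1 : Real.log 2 ^ 2 ≤ 1 := by
    have := Real.log_two_lt_d9
    nlinarith
  -- `2 K / ε` bounds the number of walk steps; the logarithm is that of `N = 2 ^ n`, so that
  -- `(log N)² = n² (log 2)²`.
  set C : ℝ := (1000 + 2 * P) * (2 * K) / Real.log 2 ^ 2 with hC
  have hC0 : 0 < C := by positivity
  have hCge : (1000 + 2 * P) * (2 * K) ≤ C := by
    rw [hC, le_div_iff₀ (by positivity)]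
    exact mul_le_of_le_one_right (by positivity) hlog1
  refine ⟨C, 1, hC0, le_rfl, fun n hn ε hε0 hε1 => ?_⟩
  obtain ⟨m, hm, hm1, hm2⟩ := QCirc.exists_two_pow_accuracy hK1 hε0 hε1
  obtain ⟨a, F, hFlen, hF⟩ := hp m hm
  choose r hr using hF
  have hround : ∀ t : QCirc.Bits (Fin m), ∃ b : QCirc.Bits (Fin (m + 1)), |QCirc.fixedVal b| ≤ 1 ∧
      |QCirc.fixedVal b - Real.cos (2 * Real.pi * QCirc.natVal t / (2 ^ m : ℕ))| ≤ (1 / 2) ^ m :=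
    fun t => QCirc.exists_fixedVal m (Real.abs_cos_le_one _)
  choose T hT using hround
  set avg : ℂ → ℝ :=
    QCirc.averaged m (fun s t => QCirc.fixedVal (r (T s) (T t))) with havg
  -- Amplitudes lie in the unit disc, so outside of it the function need not be changed.
  set ft : ℂ → ℝ := fun z => if ‖z‖ ≤ 1 then avg z else f z with hft
  set e := Fintype.equivFin (QCirc.AncReg n m a)
  set z₀ : Fin m := ⟨0, hm⟩
  set V₀ : List (QCirc.Gate n (Fin n ⊕ QCirc.AncReg n m a)) := QCirc.fullCircuit z₀ T F
  set s : ℝ := (Real.sqrt 2)⁻¹ ^ n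
  have hs : 0 < s := by positivity
  have hrun : ∀ (c : QCirc.Bits (Fin n) → ℂ) (U : QCirc.Unitary (Fin n)),
      QCirc.IsAnalogEncoding U c → QCirc.postselect (QCirc.run U
        (QCirc.liftCircuit (Equiv.sumCongr (Equiv.refl _) e).toEmbedding V₀)
        (QCirc.withAncillas _ c)) = (s : ℂ) • fun j => ((ft (c j) : ℝ) : ℂ) := by
    intro c U hU
    funext j
    rw [QCirc.postselect_run_lift, QCirc.run_fullCircuit U hn hU z₀ rfl T F r
      (fun x y => (hr x y).1), Pi.smul_apply, smul_eq_mul, hft]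
    simp only [QCirc.norm_le_one_of_isAnalogEncoding U hU j, if_true]
    rw [Complex.ofReal_pow, Complex.ofReal_inv]
  have hnorm : ∀ c : QCirc.Bits (Fin n) → ℂ,
      QCirc.normSqState ((s : ℂ) • fun j => ((ft (c j) : ℝ) : ℂ)) =
        (∑ j, (ft (c j)) ^ 2) / (2 : ℝ) ^ n := by
    intro c
    have hs2 : s ^ 2 = ((2 : ℝ) ^ n)⁻¹ := by
      rw [← pow_mul, mul_comm, pow_mul, inv_pow, Real.sq_sqrt (by norm_num), inv_pow]
    simp only [QCirc.normSqState, Pi.smul_apply, smul_eq_mul, norm_mul, mul_pow,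
      Complex.norm_real, Real.norm_eq_abs, sq_abs, hs2]
    rw [← Finset.mul_sum, div_eq_inv_mul]
  refine ⟨_, QCirc.liftCircuit (Equiv.sumCongr (Equiv.refl _) e).toEmbedding V₀, ft, ?_, ?_, ?_,
    fun c U hU => ?_⟩
  · intro z
    by_cases hz : ‖z‖ ≤ 1
    · rw [hft]
      simp only [hz, if_true]
      exact (QCirc.abs_averaged_fixedVal_sub_le hL hm (fun t => (hT t).1) (fun t => (hT t).2)
        (fun x y => (hr x y).2) ((Complex.abs_re_le_norm z).trans hz)
        ((Complex.abs_im_le_norm z).trans hz)).trans hm1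
    · rw [hft]
      simp only [hz, if_false, sub_self, abs_zero]
      exact hε0.le
  · rw [QCirc.oracleCount_lift]
    have h := QCirc.oracleCount_fullCircuit_le hn z₀ T F
    have h' : (QCirc.oracleCount V₀ : ℝ) ≤ 13 * 2 ^ m := by exact_mod_cast h
    calc (QCirc.oracleCount V₀ : ℝ) ≤ 13 * 2 ^ m := h'
      _ ≤ (1000 + 2 * P) * (2 * K / ε) := by
        gcongr
        have : (0 : ℝ) ≤ P := P.cast_nonneg
        linarith
      _ = (1000 + 2 * P) * (2 * K) / ε := by ring
      _ ≤ C / ε := by gcongr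
  · rw [QCirc.elemCount_lift]
    have h := QCirc.elemCount_fullCircuit_le hn z₀ T F (hFlen.trans (hP m))
    have h' : (QCirc.elemCount V₀ : ℝ) ≤ (1000 + 2 * P) * (n ^ 2 * 2 ^ m) := by exact_mod_cast h
    calc (QCirc.elemCount V₀ : ℝ) ≤ (1000 + 2 * P) * (n ^ 2 * 2 ^ m) := h'
      _ ≤ (1000 + 2 * P) * (n ^ 2 * (2 * K / ε)) := by gcongr
      _ = C * Real.log (2 ^ n) ^ 2 / ε := by
        rw [Real.log_pow, hC]
        field_simp
  · rw [hrun c U hU, hnorm]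
    refine ⟨rfl, fun hpos => ?_⟩
    rw [QCirc.fidelity_normalized_smul _ hs]
    · rw [pow_one]
      have : 0 < C * ε := by positivity
      linarith
    · have h1 := hnorm c
      rw [← h1] at hpos
      refine lt_of_le_of_ne (Finset.sum_nonneg fun x _ => by positivity) fun h0 => ?_
      have h2 : ∀ j, ft (c j) = 0 := by
        intro j
        have := (Finset.sum_eq_zero_iff_of_nonneg (fun x _ => by positivity)).1 h0.symm j
          (Finset.mem_univ j)
        simpa using this
      simp [QCirc.normSqState, h2] at hpos
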